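/- Let $p$ be an odd prime and let $F$ be a finite extension of $\mathbb{Q}_p$, with ring of integers $\mathcal{O}$, maximal ideal $\mathfrak{p}$, residue field $k=\mathcal{O}/\mathfrak{p}$ of cardinality $q$, and absolute value normalized by $|\varpi|=q^{-1}$ for a generator $\varpi$ of $\mathfrak{p}$. Characters are continuous homomorphisms to $\mathbb{C}^*$. Let $\psi$ be a non-trivial character of $F$, put $\psi_a(x)=\psi(ax)$ for $a\in F^*$, and let $e(\psi)$ be the least $n\in\mathbb{Z}$ with $\psi(\mathfrak{p}^n)=1$. Let $\chi$ be a character of $F^*$; it is unramified if it is trivial on $\mathcal{O}^*$, in which case $e(\chi)=0$, and otherwise it is ramified and $e(\chi)$ is the least $m\ge 1$ with $\chi(1+\mathfrak{p}^m)=1$. Let $d_\psi x$ be the Haar measure on $F$ that is self-dual for the Fourier transform $\phi_\psi(x)=\int_F\phi(y)\psi(xy)\,d_\psi y$, and let $L(s,\chi)=(1-q^{-s}\chi(\varpi))^{-1}$ if $\chi$ is unramified and $L(s,\chi)=1$ otherwise. Let $\zeta(s,\chi,\phi)$ be the meromorphic continuation of $\int_{F^*}\phi(x)\chi(x)|x|^{s-1}\,d_\psi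 x$. Tate's factor $\epsilon(s,\chi,\psi)$ is defined by $$L(1-s,\chi^{-1})^{-1}\zeta(1-s,\chi^{-1},\phi_\psi)=\epsilon(s,\chi,\psi)\,L(s,\chi)^{-1}\zeta(s,\chi,\phi)$$ for all locally constant compactly supported $\phi:F\to\mathbb{C}$. Let $\gamma(\psi)=|2|^{1/2}\lim_{r\to\infty}\int_{\mathfrak{p}^{-r}}\psi(x^2)\,d_\psi x$ be the Weil index, and define the metaplectic factor by $$\widetilde\epsilon(1-s,\chi^{-1},\psi)=\gamma(\psi)\,\chi(-1)\,\frac{\epsilon(s+\frac12,\chi,\psi)}{\epsilon(2s,\chi^2,\psi_2)}.$$ Let $sign(F)$ be $1$ if $-1$ is a square in $F$ and $-1$ otherwise. Write $\widehat{F^*/F^{*d}}$ for the group of characters of $F^*$ that are trivial on $d$-th powers, and similarly for $k$. Let $s\in\mathbb{C}$. In (1) and (2), let $d$ be an odd positive integer prime to $p$ such that $F$ contains the $d$-th roots of unity $\mu_d$, and let $J$ be a subgroup of $\widehat{F^*/F^{*d}}$ such that restriction to $\mathcal{O}^*$ is an isomorphism from $J$ to $\widehat{k^*/k^{*d}}$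 (whose elements are viewed as characters of $\mathcal{O}^*$). (1) If $\chi^d$ is ramified, then $$\prod_{\eta\in J}\epsilon(1-s,(\chi\eta)^{-1},\psi)=q^{\frac{d-1}{2}(e(\psi)-e(\chi^d))}\,\epsilon(1-ds,\chi^{-d},\psi_d).$$ (2) If $\chi^{2d}$ is ramified, then $$\prod_{\eta\in J}\widetilde\epsilon(1-s,(\chi\eta)^{-1},\psi)=q^{\frac{d-1}{2}(e(\psi)-e(\chi^{2d}))}\,\widetilde\epsilon(1-ds,\chi^{-d},\psi_d).$$ (3) If $\chi^2$ is ramified, then $$\prod_{\beta\in\widehat{F^*/F^{*2}}}\widetilde\epsilon(1-s,\chi^{-1}\beta,\psi)=q^{e(\psi)-e(\chi)}\,\epsilon(1-2s,\chi^{-2},\psi_2)^2\,sign(F)^{e(\chi)}.$$ -/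

import Mathlib

open MeasureTheory Filter Topology
open scoped NormedField

noncomputable section

namespace PadicEpsilon

/- Throughout, `F` is a finite extension of `ℚ_[p]`, and its norm is the *normalized* absolute
value, `‖ϖ‖ = q⁻¹` for a uniformizer `ϖ`, where `q` is the cardinality of the residue field (this
normalization is a hypothesis of the theorem).  Then `Valued.integer F = {x | ‖x‖ ≤ 1}` is the
ring of integers, `Valued.maximalIdeal F` its maximal ideal and `Valued.ResidueField F` its
residue field. -/

section Field

variable (F : Type*) [NontriviallyNormedField F] [IsUltrametricDist F]

/-- The cardinality `q` of the residue field. -/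
def residueCard : ℕ := Nat.card (Valued.ResidueField F)

/-- The fractional ideal `𝔭 ^ n`, for an integer `n`. -/
def primePow (n : ℤ) : Set F := {x | ‖x‖ ≤ (residueCard F : ℝ) ^ (-n)}

open Classical in
/-- `sign(F)` is `1` if `-1` is a square in `F`, and `-1` otherwise. -/
def signF : ℤ := if IsSquare (-1 : F) then 1 else -1

end Field

section Characters

variable {F : Type*} [NontriviallyNormedField F] [IsUltrametricDist F]

open Classical in
/-- The character `χ` of `Fˣ` as a function on `F`, extended by `0` at `0`. -/
def extend (χ : Fˣ →ₜ* ℂˣ) (x : F) : ℂ :=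
  if h : x = 0 then 0 else (χ (Units.mk0 x h) : ℂ)

/-- The inclusion of the units of the ring of integers into `Fˣ`. -/
def unitsIncl : (Valued.integer F)ˣ →* Fˣ :=
  Units.map ((Valued.integer F).subtype : Valued.integer F →* F)

/-- Reduction of units of the ring of integers to units of the residue field. -/
def unitsResidue : (Valued.integer F)ˣ →* (Valued.ResidueField F)ˣ :=
  Units.map (IsLocalRing.residue (Valued.integer F) : Valued.integer F →* Valued.ResidueField F)

/-- `χ` is unramified if it is trivial on the units of the ring of integers. -/
def IsUnramified (χ : Fˣ →ₜ* ℂˣ) : Prop :=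
  ∀ u : (Valued.integer F)ˣ, χ (unitsIncl u) = 1

/-- `χ` is ramified if it is not unramified. -/
def IsRamified (χ : Fˣ →ₜ* ℂˣ) : Prop := ¬ IsUnramified χ

open Classical in
/-- The conductor exponent `e(χ)`: it is `0` if `χ` is unramified, and otherwise the least
`m ≥ 1` with `χ(1 + 𝔭 ^ m) = 1`. -/
def condMul (χ : Fˣ →ₜ* ℂˣ) : ℕ :=
  if IsUnramified χ then 0
  else sInf {m : ℕ | 1 ≤ m ∧ ∀ u : Fˣ, (u : F) - 1 ∈ primePow F m → χ u = 1}

/-- The conductor exponent `e(ψ)`: the least integer `n` with `ψ(𝔭 ^ n) = 1`. -/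
def condAdd (ψ : AddChar F ℂ) : ℤ :=
  sInf {n : ℤ | ∀ x ∈ primePow F n, ψ x = 1}

variable (F) in
/-- The dual of `Fˣ / (Fˣ)ᵈ`, as a group of characters of `Fˣ`. -/
def dualModPow (d : ℕ) : Subgroup (Fˣ →ₜ* ℂˣ) where
  carrier := {η | ∀ x : Fˣ, η (x ^ d) = 1}
  one_mem' := by intro x; rfl
  mul_mem' := by
    intro a b ha hb x
    change a (x ^ d) * b (x ^ d) = 1
    rw [ha x, hb x, one_mul]
  inv_mem' := by
    intro a ha x
    change (a (x ^ d))⁻¹ = 1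
    rw [ha x, inv_one]

variable (F) in
/-- The dual of `𝕂ˣ / (𝕂ˣ)ᵈ`, as a group of characters of `𝕂ˣ`, with `𝕂` the residue field. -/
def residueDualModPow (d : ℕ) : Subgroup ((Valued.ResidueField F)ˣ →* ℂˣ) where
  carrier := {κ | ∀ x : (Valued.ResidueField F)ˣ, κ (x ^ d) = 1}
  one_mem' := by intro x; rfl
  mul_mem' := by
    intro a b ha hb x
    change a (x ^ d) * b (x ^ d) = 1
    rw [ha x, hb x, one_mul]
  inv_mem' := by
    intro a ha x
    change (a (x ^ d))⁻¹ = 1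
    rw [ha x, inv_one]

/-- `J` is a lift of the dual of `𝕂ˣ / (𝕂ˣ)ᵈ`: a subgroup of the dual of `Fˣ / (Fˣ)ᵈ` such that
restriction to the units of the ring of integers is an isomorphism from `J` to the dual of
`𝕂ˣ / (𝕂ˣ)ᵈ` (whose elements are pulled back to the units of the ring of integers). -/
def IsLift (d : ℕ) (J : Subgroup (Fˣ →ₜ* ℂˣ)) : Prop :=
  J ≤ dualModPow F d ∧
    ∃ Φ : J ≃* residueDualModPow F d, ∀ (η : J) (u : (Valued.integer F)ˣ),
      (η : Fˣ →ₜ* ℂˣ) (unitsIncl u) =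
        (Φ η : (Valued.ResidueField F)ˣ →* ℂˣ) (unitsResidue u)

end Characters

section Factors

variable {F : Type*} [NontriviallyNormedField F] [IsUltrametricDist F]

/-- Schwartz functions on `F`: locally constant with compact support. -/
def IsSchwartz (φ : F → ℂ) : Prop := IsLocallyConstant φ ∧ HasCompactSupport φ

variable [MeasurableSpace F] [BorelSpace F]

/-- The Fourier transform with respect to `ψ` and the measure `μ`. -/
def fourierWith (μ : Measure F) (ψ : AddChar F ℂ) (φ : F → ℂ) (x : F) : ℂ :=
  ∫ y, φ y * ψ (x * y) ∂μ

/-- `μ` is a Haar measure on `F` that is self-dual with respect to `ψ`. -/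
def IsSelfDual (ψ : AddChar F ℂ) (μ : Measure F) : Prop :=
  μ.IsAddHaarMeasure ∧
    ∀ φ : F → ℂ, IsSchwartz φ → ∀ x, fourierWith μ ψ (fourierWith μ ψ φ) x = φ (-x)

/-- The self-dual Haar measure `d_ψ x` on `F`. -/
def selfDual (ψ : AddChar F ℂ) : Measure F := Classical.epsilon (IsSelfDual ψ)

/-- The Fourier transform `φ_ψ`. -/
def fourier (ψ : AddChar F ℂ) (φ : F → ℂ) : F → ℂ := fourierWith (selfDual ψ) ψ φ

open Classical in
/-- The local `L`-factor `L(s, χ)`, with respect to a uniformizer `ϖ`. -/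
def localL (ϖ : F) (χ : Fˣ →ₜ* ℂˣ) (s : ℂ) : ℂ :=
  if IsUnramified χ then 1 / (1 - (residueCard F : ℂ) ^ (-s) * extend χ ϖ) else 1

/-- The zeta integral `∫ φ(x) χ(x) |x|^s d*x`, where `d*x = d_ψ x / |x|`. It converges when the
real part of `s` is large. -/
def zetaIntegral (ψ : AddChar F ℂ) (χ : Fˣ →ₜ* ℂˣ) (φ : F → ℂ) (s : ℂ) : ℂ :=
  ∫ x, φ x * (extend χ x * (‖x‖ : ℂ) ^ s) * (‖x‖ : ℂ)⁻¹ ∂(selfDual ψ)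

/-- `Z` is the holomorphic continuation to `ℂ` of `s ↦ L(s, χ)⁻¹ ζ(s, χ, φ)`, initially given by
the zeta integral for `s` of large real part. -/
def IsNormalizedZeta (ϖ : F) (ψ : AddChar F ℂ) (χ : Fˣ →ₜ* ℂˣ) (φ : F → ℂ) (Z : ℂ → ℂ) : Prop :=
  Differentiable ℂ Z ∧
    ∃ σ : ℝ, ∀ s : ℂ, σ < s.re → Z s = (localL ϖ χ s)⁻¹ * zetaIntegral ψ χ φ s

/-- `L(s, χ)⁻¹ ζ(s, χ, φ)`, as an entire function of `s`. -/
def normalizedZeta (ϖ : F) (ψ : AddChar F ℂ) (χ : Fˣ →ₜ* ℂˣ) (φ : F → ℂ) : ℂ → ℂ :=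
  Classical.epsilon (IsNormalizedZeta ϖ ψ χ φ)

/-- `c` is the proportionality factor in the functional equation
`L(1 - s, χ⁻¹)⁻¹ ζ(1 - s, χ⁻¹, φ_ψ) = c L(s, χ)⁻¹ ζ(s, χ, φ)` for all Schwartz functions `φ`. -/
def IsEpsilonFactor (ϖ : F) (χ : Fˣ →ₜ* ℂˣ) (ψ : AddChar F ℂ) (s c : ℂ) : Prop :=
  ∀ φ : F → ℂ, IsSchwartz φ →
    normalizedZeta ϖ ψ χ⁻¹ (fourier ψ φ) (1 - s) = c * normalizedZeta ϖ ψ χ φ s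

/-- Tate's `ε(s, χ, ψ)`. -/
def tateEpsilon (ϖ : F) (s : ℂ) (χ : Fˣ →ₜ* ℂˣ) (ψ : AddChar F ℂ) : ℂ :=
  Classical.epsilon (IsEpsilonFactor ϖ χ ψ s)

/-- The Weil index `γ(ψ) = |2|^(1/2) lim_{r → ∞} ∫_{𝔭^(-r)} ψ(x²) d_ψ x`. -/
def weilIndex (ψ : AddChar F ℂ) : ℂ :=
  ((‖(2 : F)‖ ^ (1 / 2 : ℝ) : ℝ) : ℂ) *
    limUnder atTop (fun r : ℕ => ∫ x in primePow F (-(r : ℤ)), ψ (x ^ 2) ∂(selfDual ψ))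

/-- The metaplectic factor, defined by
`ε~(1 - s, χ⁻¹, ψ) = γ(ψ) χ(-1) ε(s + 1/2, χ, ψ) / ε(2s, χ², ψ₂)`; the definition is this formula
with `s` replaced by `1 - s` and `χ` by `χ⁻¹`. -/
def metaEpsilon (ϖ : F) (s : ℂ) (χ : Fˣ →ₜ* ℂˣ) (ψ : AddChar F ℂ) : ℂ :=
  weilIndex ψ * (χ⁻¹ (-1) : ℂˣ) * tateEpsilon ϖ ((1 - s) + 1 / 2) χ⁻¹ ψ /
    tateEpsilon ϖ (2 * (1 - s)) (χ⁻¹ ^ 2) (ψ.mulShift 2)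

end Factors

end PadicEpsilon

end

/-! Every character whose epsilon factor occurs is ramified, and for a ramified `χ` Tate's
functional equation can be solved explicitly. The zeta integral is a finite sum over the shells `|x|
= q^(-n)`, and the Fourier transform carries shell `n` to shell `e(ψ) - e(χ) - n`. The factor is
therefore `q^((e(ψ) - e(χ)) s)` times the Gauss integral `g(χ, ψ)`, the integral of `ψ χ⁻¹` over the
shell of valuation `e(ψ) - e(χ)` (`tateEpsilon_eq`). With `d = 2t + 1`, the theorem reduces to two
product formulas for Gauss integrals: over a lift `J` (`finprod_gaussInt_lift`) and over the four
quadratic characters (`finprod_gaussInt_two`). The twisting characters are trivial on `1 + 𝔭`, and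
two cases arise.

If `e(χ) = 1`, Gauss integrals are Gauss sums over the residue field, and the formula is the
Hasse-Davenport product formula (`prod_gaussSum_torsionChars`, `prod_gaussSum_torsionChars_two`). It
is proved with L-functions of `k[X]`. A completely multiplicative function on monic polynomials is
chosen whose prime power sums are the sums of `χ^d(N x) ψ(Tr x^d)` over the extensions of `k`.
Counting `d`-th roots by characters of order dividing `d` splits these into the corresponding sums
for `χη` with exponent `1`, which are signed powers of Gauss sums. Newton's identities then make the
degree `d` coefficient of the L-function equal to the product of the Gauss sums. The same
coefficient is computed directly, because the `d`-th power sum of the roots of a monic polynomial of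
odd degree `d` is affine in the lower half of its coefficients.

If `e(χ) ≥ 2`, stationary phase applies. On `1 + 𝔭^r`, with `r` the integral part of `e(χ)/2`, one
has `χ(1 + x) = ψ(c (x - x²/2))` (`exists_extend_one_add_eq`), and the Gauss integral equals `χ(c)⁻¹
ψ(c)` times a quadratic Gauss integral, up to a power of `q` (`gaussInt_eq_quadInt`). A tame twist
only contributes `η(c)⁻¹`, and these factors multiply to `1`. What remains is a relation for
quadratic Gauss integrals (`quadInt_sq`, `quadInt_pow`); the latter uses that `(-1)^t d` is a square
in a field containing a primitive `d`-th root of unity.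

For the metaplectic factors, numerators and denominators are multiplied separately. Squaring
permutes `J`, because its order is odd, and `γ(ψ)^d = γ(ψ_d)`. For quadratic twists all denominators
coincide, `γ(ψ)^4 = 1`, and the duality between `ε(2s, χ²)` and `ε(1 - 2s, χ⁻²)` turns the result
into the stated form. -/

noncomputable section

open Polynomial

namespace PadicEpsilon

/-! ### Monic polynomials over a finite field and their prime factors. -/

section MonicPolynomials

variable (k : Type*) [Field k] [Fintype k]

open Classical in
/-- The finite set of monic polynomials of degree `n` over a finite field. -/
def monicsOfDegree (n : ℕ) : Finset k[X] :=
  Finset.univ.image fun c : Fin n → k => X ^ n + ∑ i, C (c i) * X ^ (i : ℕ)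

open Classical in
/-- The finite set of monic irreducible polynomials of degree `n` over a finite field. -/
def primesOfDegree (n : ℕ) : Finset k[X] :=
  (monicsOfDegree k n).filter Irreducible

variable {k}

lemma degree_sum_C_mul_X_pow_lt {n : ℕ} (c : Fin n → k) :
    (∑ i, C (c i) * X ^ (i : ℕ)).degree < (n : WithBot ℕ) := by
  refine (degree_sum_le _ _).trans_lt ((Finset.sup_lt_iff (WithBot.bot_lt_coe n)).2 fun i _ => ?_)
  exact (degree_C_mul_X_pow_le _ _).trans_lt (Nat.cast_lt.2 i.2)

lemma mem_monicsOfDegree {n : ℕ} {f : k[X]} :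
    f ∈ monicsOfDegree k n ↔ f.Monic ∧ f.natDegree = n := by
  classical
  simp only [monicsOfDegree, Finset.mem_image, Finset.mem_univ, true_and]
  constructor
  · rintro ⟨c, rfl⟩
    have h := degree_sum_C_mul_X_pow_lt c
    refine ⟨monic_X_pow_add h, ?_⟩
    rw [natDegree_add_eq_left_of_degree_lt] <;> simp [h]
  · rintro ⟨hf, rfl⟩
    refine ⟨fun i => f.coeff i, ?_⟩
    conv_rhs => rw [hf.as_sum]
    rw [Finset.sum_range]

lemma sum_monicsOfDegree {n : ℕ} (Λ : k[X] → ℂ) :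
    ∑ f ∈ monicsOfDegree k n, Λ f =
      ∑ c : Fin n → k, Λ (X ^ n + ∑ i, C (c i) * X ^ (i : ℕ)) := by
  classical
  rw [monicsOfDegree, Finset.sum_image]
  intro c _ c' _ h
  have h' := add_left_cancel h
  ext i
  have := congrArg (fun f : k[X] => f.coeff i) h'
  simpa [finsetSum_coeff, coeff_C_mul, coeff_X_pow, Fin.val_inj] using this

lemma mem_primesOfDegree {n : ℕ} {f : k[X]} :
    f ∈ primesOfDegree k n ↔ (f.Monic ∧ f.natDegree = n) ∧ Irreducible f := by
  simp [primesOfDegree, mem_monicsOfDegree]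

open Classical in
-- The number of exponents `i ≥ 1` with `P ^ i ∣ f` is the multiplicity of `P` in `f`, so the sum
-- adds up the degrees of the prime factors with multiplicity. This is the polynomial form of the
-- identity that sums the von Mangoldt function over divisors. Cutting `e` and `i` off at `n` loses
-- nothing, since primes have degree at least `1`.
lemma sum_degree_primes {n : ℕ} {f : k[X]} (hf : f ∈ monicsOfDegree k n) :
    ∑ e ∈ Finset.Icc 1 n, ∑ P ∈ primesOfDegree k e, ∑ i ∈ Finset.Icc 1 n,
      (if P ^ i ∣ f then (e : ℂ) else 0) = n := by
  obtain ⟨hm, hn⟩ := mem_monicsOfDegree.1 hf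
  have hf0 := hm.ne_zero
  set s := UniqueFactorizationMonoid.normalizedFactors f
  have hprod : s.prod = f := by
    have h := UniqueFactorizationMonoid.prod_normalizedFactors_eq hf0
    rwa [hm.normalize_eq_self] at h
  have hs : ∀ P ∈ s, P.Monic ∧ Irreducible P := fun P hP => by
    refine ⟨?_, UniqueFactorizationMonoid.irreducible_of_normalized_factor P hP⟩
    have h0 := (UniqueFactorizationMonoid.irreducible_of_normalized_factor P hP).ne_zero
    have := UniqueFactorizationMonoid.normalize_normalized_factor P hP
    rw [← this]; exact Polynomial.monic_normalize h0
  have hdeg : (s.map natDegree).sum = n := by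
    rw [← hn, ← hprod, natDegree_multiset_prod_of_monic _ fun P hP => (hs P hP).1]
  have hcount : ∀ e, ∀ P ∈ primesOfDegree k e, ∑ i ∈ Finset.Icc 1 n,
      (if P ^ i ∣ f then (e : ℂ) else 0) = s.count P * e := by
    intro e P hP
    obtain ⟨⟨hPm, hPe⟩, hPi⟩ := mem_primesOfDegree.1 hP
    have hdvd : ∀ i, P ^ i ∣ f ↔ i ≤ s.count P := fun i => by
      rw [pow_dvd_iff_le_emultiplicity,
        UniqueFactorizationMonoid.emultiplicity_eq_count_normalizedFactors hPi hf0,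
        hPm.normalize_eq_self]
      simp [s]
    have hle : s.count P ≤ n := by
      have h1 := natDegree_le_of_dvd ((hdvd _).2 le_rfl) hf0
      rw [natDegree_pow, hn] at h1
      exact le_trans (Nat.le_mul_of_pos_right _ hPi.natDegree_pos) h1
    simp_rw [hdvd]
    rw [← Finset.sum_filter, Finset.sum_const, nsmul_eq_mul]
    congr 2
    rw [show Finset.filter (fun i => i ≤ s.count P) (Finset.Icc 1 n) = Finset.Icc 1 (s.count P) by
      ext i; simp only [Finset.mem_filter, Finset.mem_Icc]; omega]
    simp
  rw [Finset.sum_congr rfl fun e _ => Finset.sum_congr rfl (hcount e)]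
  have hdeg' : (n : ℂ) = ∑ P ∈ s.toFinset, (s.count P : ℂ) * P.natDegree := by
    rw [← hdeg, Finset.sum_multiset_map_count]
    simp
  rw [Finset.sum_sigma', hdeg']
  symm
  refine Finset.sum_bij_ne_zero (fun P _ _ => ⟨P.natDegree, P⟩) ?_ ?_ ?_ ?_
  · intro P hP _
    have hP' := Multiset.mem_toFinset.1 hP
    have h1 := natDegree_le_of_dvd (hprod ▸ Multiset.dvd_prod hP') hf0
    simp only [Finset.mem_sigma, Finset.mem_Icc, mem_primesOfDegree]
    exact ⟨⟨(hs P hP').2.natDegree_pos, by omega⟩, ⟨(hs P hP').1, trivial⟩, (hs P hP').2⟩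
  · intro P _ _ Q _ _ h
    simpa using (Sigma.mk.inj_iff.1 h).2
  · rintro ⟨e, P⟩ h1 h2
    simp only [Finset.mem_sigma, mem_primesOfDegree] at h1
    obtain ⟨-, ⟨-, rfl⟩, -⟩ := h1
    have : s.count P ≠ 0 := by rintro h; simp [h] at h2
    exact ⟨P, by simpa using Multiset.count_ne_zero.1 this, by simpa using h2, rfl⟩
  · intro P _ _
    simp

end MonicPolynomials

/-! ### L-series of completely multiplicative functions on monic polynomials. -/

section MultiplicativeFunctions

variable {k : Type*} [Field k] [Fintype k] (Λ : k[X] → ℂ)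

/-- The sum of `Λ` over the monic polynomials of degree `n`. -/
def monicSum (n : ℕ) : ℂ := ∑ f ∈ monicsOfDegree k n, Λ f

/-- The sum over prime powers of degree `j` attached to a multiplicative function `Λ`. -/
def primePowerSum (j : ℕ) : ℂ :=
  ∑ e ∈ j.divisors, ∑ P ∈ primesOfDegree k e, (e : ℂ) * Λ P ^ (j / e)

variable {Λ}

open Classical in
lemma sum_monics_dvd (hone : Λ 1 = 1) (hmul : ∀ f g : k[X], f.Monic → g.Monic → Λ (f * g) = Λ f * Λ g)
    {n e i : ℕ} {P : k[X]} (hP : P ∈ primesOfDegree k e) :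
    ∑ f ∈ monicsOfDegree k n, (if P ^ i ∣ f then Λ f else 0) =
      if e * i ≤ n then Λ P ^ i * monicSum Λ (n - e * i) else 0 := by
  obtain ⟨⟨hPm, hPe⟩, hPi⟩ := mem_primesOfDegree.1 hP
  have hpow : Λ (P ^ i) = Λ P ^ i := by
    induction i with
    | zero => simp [hone]
    | succ i ih => rw [pow_succ, hmul _ _ (hPm.pow i) hPm, ih, pow_succ]
  have hPid : (P ^ i).natDegree = e * i := by rw [natDegree_pow, hPe, mul_comm]
  split_ifs with h
  · rw [← Finset.sum_filter, monicSum, Finset.mul_sum]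
    symm
    refine Finset.sum_bij (fun g _ => P ^ i * g) ?_ ?_ ?_ ?_
    · intro g hg
      obtain ⟨hgm, hgn⟩ := mem_monicsOfDegree.1 hg
      rw [Finset.mem_filter, mem_monicsOfDegree]
      refine ⟨⟨(hPm.pow i).mul hgm, ?_⟩, dvd_mul_right _ _⟩
      rw [(hPm.pow i).natDegree_mul hgm, hPid, hgn]; omega
    · intro g _ g' _ h
      exact mul_left_cancel₀ (hPm.pow i).ne_zero h
    · intro f hf
      rw [Finset.mem_filter, mem_monicsOfDegree] at hf
      obtain ⟨⟨hfm, hfn⟩, g, rfl⟩ := hf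
      have hgm := (hPm.pow i).of_mul_monic_left hfm
      refine ⟨g, mem_monicsOfDegree.2 ⟨hgm, ?_⟩, rfl⟩
      rw [(hPm.pow i).natDegree_mul hgm, hPid] at hfn; omega
    · intro g hg
      rw [hmul _ _ (hPm.pow i) (mem_monicsOfDegree.1 hg).1, hpow]
  · refine Finset.sum_eq_zero fun f hf => if_neg fun hd => h ?_
    obtain ⟨hfm, hfn⟩ := mem_monicsOfDegree.1 hf
    have := natDegree_le_of_dvd hd hfm.ne_zero
    omega

/-- The logarithmic derivative of the Euler product of a completely multiplicative function. -/
lemma mul_monicSum (hone : Λ 1 = 1)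
    (hmul : ∀ f g : k[X], f.Monic → g.Monic → Λ (f * g) = Λ f * Λ g) (n : ℕ) :
    (n : ℂ) * monicSum Λ n =
      ∑ j ∈ Finset.Icc 1 n, primePowerSum Λ j * monicSum Λ (n - j) := by
  classical
  -- The factor `n = deg f` is expanded over the prime powers dividing `f`, and the sum over `f` is
  -- moved inside.
  have h1 : (n : ℂ) * monicSum Λ n = ∑ e ∈ Finset.Icc 1 n, ∑ P ∈ primesOfDegree k e,
      ∑ i ∈ Finset.Icc 1 n, (e : ℂ) * ∑ f ∈ monicsOfDegree k n, (if P ^ i ∣ f then Λ f else 0) := by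
    rw [monicSum, Finset.mul_sum]
    rw [Finset.sum_congr rfl fun f hf => by rw [← sum_degree_primes hf]]
    simp_rw [Finset.sum_mul, Finset.mul_sum]
    rw [Finset.sum_comm]
    refine Finset.sum_congr rfl fun e _ => ?_
    rw [Finset.sum_comm]
    refine Finset.sum_congr rfl fun P _ => ?_
    rw [Finset.sum_comm]
    refine Finset.sum_congr rfl fun i _ => Finset.sum_congr rfl fun f _ => ?_
    split_ifs <;> simp
  rw [h1]
  have h2 : ∀ e ∈ Finset.Icc 1 n, ∑ P ∈ primesOfDegree k e,
      ∑ i ∈ Finset.Icc 1 n, (e : ℂ) * ∑ f ∈ monicsOfDegree k n, (if P ^ i ∣ f then Λ f else 0) =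
      ∑ i ∈ Finset.Icc 1 n, if e * i ≤ n then
        (∑ P ∈ primesOfDegree k e, (e : ℂ) * Λ P ^ i) * monicSum Λ (n - e * i) else 0 := by
    intro e _
    rw [Finset.sum_comm]
    refine Finset.sum_congr rfl fun i _ => ?_
    rw [Finset.sum_congr rfl fun P hP => by rw [sum_monics_dvd hone hmul hP]]
    split_ifs
    · rw [Finset.sum_mul]
      exact Finset.sum_congr rfl fun P _ => by ring
    · simp
  rw [Finset.sum_congr rfl h2, ← Finset.sum_product', ← Finset.sum_filter]
  simp_rw [primePowerSum, Finset.sum_mul (Nat.divisors _)]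
  rw [Finset.sum_sigma']
  -- Prime powers `P ^ i` with `deg P = e` are regrouped by total degree `j = e i`; `e` then runs
  -- over the divisors of `j`.
  refine Finset.sum_bij' (fun x _ => ⟨x.1 * x.2, x.1⟩) (fun y _ => (y.2, y.1 / y.2)) ?_ ?_ ?_ ?_ ?_
  · rintro ⟨e, i⟩ h
    simp only [Finset.mem_filter, Finset.mem_product, Finset.mem_Icc] at h
    simp only [Finset.mem_sigma, Finset.mem_Icc, Nat.mem_divisors]
    have : 0 < e * i := Nat.mul_pos (by omega) (by omega)
    exact ⟨⟨this, h.2⟩, dvd_mul_right _ _, this.ne'⟩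
  · rintro ⟨j, e⟩ h
    simp only [Finset.mem_sigma, Finset.mem_Icc, Nat.mem_divisors] at h
    obtain ⟨⟨h1, h2⟩, ⟨i, rfl⟩, h4⟩ := h
    have he : 0 < e := Nat.pos_of_ne_zero fun h => h4 (by simp [h])
    have hi : 0 < i := Nat.pos_of_ne_zero fun h => h4 (by simp [h])
    simp only [Finset.mem_filter, Finset.mem_product, Finset.mem_Icc, Nat.mul_div_cancel_left _ he]
    have h5 := Nat.le_mul_of_pos_right e hi
    have h6 := Nat.le_mul_of_pos_left i he
    omega
  · rintro ⟨e, i⟩ h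
    simp only [Finset.mem_filter, Finset.mem_product, Finset.mem_Icc] at h
    simp [Nat.mul_div_cancel_left _ (show 0 < e by omega)]
  · rintro ⟨j, e⟩ h
    simp only [Finset.mem_sigma, Finset.mem_Icc, Nat.mem_divisors] at h
    simp [Nat.mul_div_cancel' h.2.1]
  · rintro ⟨e, i⟩ h
    simp only [Finset.mem_filter, Finset.mem_product, Finset.mem_Icc] at h
    simp [Nat.mul_div_cancel_left _ (show 0 < e by omega)]

end MultiplicativeFunctions

end PadicEpsilon

end

noncomputable section

open Polynomial

namespace PadicEpsilon

/-! ### Power sums of roots through the logarithmic derivative. -/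

section PowerSums

variable {k : Type*} [Field k]

/-- `-z H'(z) / H(z)` for a power series `H`. -/
def negLogDeriv (H : PowerSeries k) : PowerSeries k :=
  -(PowerSeries.X * PowerSeries.derivative k H) * H⁻¹

lemma negLogDeriv_mul_self {H : PowerSeries k} (hH : PowerSeries.constantCoeff H ≠ 0) :
    negLogDeriv H * H = -(PowerSeries.X * PowerSeries.derivative k H) := by
  rw [negLogDeriv, mul_assoc, PowerSeries.inv_mul_cancel _ hH, mul_one]

lemma negLogDeriv_mul {G H : PowerSeries k} (hG : PowerSeries.constantCoeff G ≠ 0)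
    (hH : PowerSeries.constantCoeff H ≠ 0) :
    negLogDeriv (G * H) = negLogDeriv G + negLogDeriv H := by
  have h0 : PowerSeries.constantCoeff (G * H) ≠ 0 := by simp [hG, hH]
  have h1 : G * H ≠ 0 := fun h => h0 (by simp [h])
  refine mul_right_cancel₀ h1 ?_
  rw [negLogDeriv_mul_self h0, add_mul]
  have e1 := negLogDeriv_mul_self hG
  have e2 := negLogDeriv_mul_self hH
  have e3 : PowerSeries.derivative k (G * H) =
      G * PowerSeries.derivative k H + H * PowerSeries.derivative k G := by
    rw [Derivation.leibniz]; simp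
  rw [e3]
  linear_combination -H * e1 - G * e2

/-- The sum of the `d`-th powers of the roots of a monic polynomial, as a polynomial function of
its coefficients. -/
def rootPowerSum (d : ℕ) (f : k[X]) : k :=
  PowerSeries.coeff d (negLogDeriv (f.reverse : PowerSeries k))

lemma constantCoeff_reverse {f : k[X]} (hf : f.Monic) :
    PowerSeries.constantCoeff (f.reverse : PowerSeries k) = 1 := by
  simp [hf.leadingCoeff]

lemma rootPowerSum_mul (d : ℕ) {f g : k[X]} (hf : f.Monic) (hg : g.Monic) :
    rootPowerSum d (f * g) = rootPowerSum d f + rootPowerSum d g := by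
  rw [rootPowerSum, reverse_mul_of_domain, Polynomial.coe_mul, negLogDeriv_mul, map_add,
    rootPowerSum, rootPowerSum]
  · simp [constantCoeff_reverse hf]
  · simp [constantCoeff_reverse hg]

lemma rootPowerSum_one (d : ℕ) : rootPowerSum d (1 : k[X]) = 0 := by
  have : (1 : k[X]).reverse = 1 := by rw [← C_1, reverse_C]
  simp [rootPowerSum, negLogDeriv, this]

/-- The series is `r z / (1 - r z)`. Since the reverse of `∏ (X - r)` is `∏ (1 - r z)` and the
logarithmic derivative is additive, this is what makes `rootPowerSum` a power sum of roots, with no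
division by integers and hence in any characteristic. -/
lemma negLogDeriv_one_sub (r : k) :
    negLogDeriv (1 - PowerSeries.C r * PowerSeries.X) =
      PowerSeries.mk fun n => if n = 0 then 0 else r ^ n := by
  have h0 : PowerSeries.constantCoeff (1 - PowerSeries.C r * PowerSeries.X) ≠ 0 := by simp
  have h1 : (1 - PowerSeries.C r * PowerSeries.X) ≠ 0 := fun h => h0 (by simp [h])
  refine mul_right_cancel₀ h1 ?_
  rw [negLogDeriv_mul_self h0]
  have h2 : PowerSeries.derivative k (1 - PowerSeries.C r * PowerSeries.X) = -PowerSeries.C r := by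
    rw [map_sub, Derivation.leibniz]
    simp [PowerSeries.derivative_C]
  rw [h2, mul_sub, mul_one, ← mul_assoc]
  ext n
  rcases n with _ | n
  · simp
  · rw [map_sub, PowerSeries.coeff_succ_mul_X, PowerSeries.coeff_mul_C]
    rcases n with _ | n
    · simp
    · simp [PowerSeries.coeff_X, pow_succ]

lemma rootPowerSum_X_sub_C {d : ℕ} (hd : d ≠ 0) (r : k) :
    rootPowerSum d (X - C r) = r ^ d := by
  have : (X - C r).reverse = 1 - C r * X := by
    rw [reverse, natDegree_X_sub_C, reflect_sub, reflect_C]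
    simp [reflect_one_X, pow_one]
  rw [rootPowerSum, this]
  have h2 : ((1 - C r * X : k[X]) : PowerSeries k) = 1 - PowerSeries.C r * PowerSeries.X := by
    simp
  rw [h2, negLogDeriv_one_sub]
  simp [hd]

/-- Needed because the power sum is an element of `k`, while the roots that compute it lie in an
extension. -/
lemma rootPowerSum_map {K : Type*} [Field K] (φ : k →+* K) (d : ℕ) {f : k[X]} (hf : f.Monic) :
    rootPowerSum d (f.map φ) = φ (rootPowerSum d f) := by
  have hc := constantCoeff_reverse hf
  have hc' := constantCoeff_reverse (hf.map φ)
  have h0 : PowerSeries.constantCoeff (f.reverse : PowerSeries k) ≠ 0 := by rw [hc]; simp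
  have h0' : PowerSeries.constantCoeff ((f.map φ).reverse : PowerSeries K) ≠ 0 := by rw [hc']; simp
  have h1 : ((f.map φ).reverse : PowerSeries K) ≠ 0 := fun h => h0' (by rw [h]; simp)
  have hr : ((f.map φ).reverse : PowerSeries K) =
      PowerSeries.map φ (f.reverse : PowerSeries k) := by
    rw [reverse, reverse, hf.natDegree_map, Polynomial.reflect_map]
    ext n; simp
  suffices negLogDeriv ((f.map φ).reverse : PowerSeries K) =
      PowerSeries.map φ (negLogDeriv (f.reverse : PowerSeries k)) by
    rw [rootPowerSum, this, PowerSeries.coeff_map, rootPowerSum]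
  refine mul_right_cancel₀ h1 ?_
  rw [negLogDeriv_mul_self h0', hr, ← map_mul, negLogDeriv_mul_self h0]
  ext n
  rcases n with _ | n
  · simp
  · simp [← neg_mul, mul_comm PowerSeries.X, PowerSeries.coeff_succ_mul_X,
      PowerSeries.coeff_derivative]

lemma rootPowerSum_prod {d : ℕ} (hd : d ≠ 0) {ι : Type*} (s : Finset ι) (r : ι → k) :
    rootPowerSum d (∏ i ∈ s, (X - C (r i))) = ∑ i ∈ s, r i ^ d := by
  classical
  induction s using Finset.induction_on with
  | empty => simp [rootPowerSum_one]
  | insert i s hi ih =>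
    rw [Finset.prod_insert hi, Finset.sum_insert hi, rootPowerSum_mul _ (monic_X_sub_C _)
      (monic_prod_of_monic _ _ fun i _ => monic_X_sub_C _), ih, rootPowerSum_X_sub_C hd]

end PowerSums

/-! ### Sums over an extension field as sums over prime polynomials. -/

section FiniteFieldExtension

variable {k K : Type*} [Field k] [Fintype k] [Field K] [Fintype K] [Algebra k K]

/-- The right side is Galois invariant, so it descends to a monic `R` over `k`. Every monic
irreducible factor of `R` has some conjugate `σ x` as a root and so is the minimal polynomial of
`x`; thus `R` is a power of it, and degrees determine the exponent. -/
lemma map_minpoly_pow (x : K) :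
    ((minpoly k x) ^ (Module.finrank k K / (minpoly k x).natDegree)).map (algebraMap k K) =
      ∏ σ : Gal(K/k), (X - C (σ x)) := by
  classical
  have hx : IsIntegral k x := Algebra.IsIntegral.isIntegral x
  have hirr := minpoly.irreducible hx
  have hmon := minpoly.monic hx
  have := Algebra.IsInvariant.charpoly_mem_lifts k K Gal(K/k) x
  obtain ⟨R, hR, hRd, hRm⟩ := Polynomial.lifts_and_natDegree_eq_and_monic this
    (MulSemiringAction.monic_charpoly Gal(K/k) x)
  have hdeg : R.natDegree = Module.finrank k K := by
    rw [hRd, MulSemiringAction.charpoly_eq, natDegree_prod_of_monic _ _ fun _ _ => monic_X_sub_C _]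
    simp [IsGalois.card_aut_eq_finrank, ← Nat.card_eq_fintype_card]
  have hall : ∀ Q ∈ UniqueFactorizationMonoid.normalizedFactors R, Q = minpoly k x := by
    intro Q hQ
    have hQi := UniqueFactorizationMonoid.irreducible_of_normalized_factor Q hQ
    have hQm : Q.Monic := by
      rw [← UniqueFactorizationMonoid.normalize_normalized_factor Q hQ]
      exact Polynomial.monic_normalize hQi.ne_zero
    have hdvd : Q.map (algebraMap k K) ∣ ∏ σ : Gal(K/k), (X - C (σ x)) := by
      have := Polynomial.map_dvd (algebraMap k K)
        (UniqueFactorizationMonoid.dvd_of_mem_normalizedFactors hQ)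
      rwa [hR] at this
    have hsp : (Q.map (algebraMap k K)).Splits :=
      (MulSemiringAction.splits_charpoly (G := Gal(K/k)) x).of_dvd
        (MulSemiringAction.monic_charpoly Gal(K/k) x).ne_zero hdvd
    obtain ⟨y, hy⟩ := hsp.exists_eval_eq_zero (by
      rw [degree_map]; exact (degree_pos_of_irreducible hQi).ne')
    have hy' : (∏ σ : Gal(K/k), (X - C (σ x))).eval y = 0 := eval_eq_zero_of_dvd_of_eval_eq_zero hdvd hy
    rw [eval_prod, Finset.prod_eq_zero_iff] at hy'
    obtain ⟨σ, -, hσ⟩ := hy'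
    have hyσ : y = σ x := by simpa [sub_eq_zero] using hσ
    rw [minpoly.eq_of_irreducible_of_monic hQi (x := y) (by rwa [eval_map_algebraMap] at hy) hQm, hyσ,
      minpoly.algEquiv_eq]
  have hRpow : R = (minpoly k x) ^
      Multiset.card (UniqueFactorizationMonoid.normalizedFactors R) := by
    have h := UniqueFactorizationMonoid.prod_normalizedFactors_eq hRm.ne_zero
    rw [hRm.normalize_eq_self, Multiset.eq_replicate_card.2 hall, Multiset.prod_replicate] at h
    exact h.symm
  have hc : Module.finrank k K / (minpoly k x).natDegree =
      Multiset.card (UniqueFactorizationMonoid.normalizedFactors R) := by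
    rw [← hdeg]
    nth_rw 1 [hRpow]
    rw [natDegree_pow, Nat.mul_div_cancel _ hirr.natDegree_pos]
  rw [hc, ← hRpow, hR]
  rfl

/-- The elements of `K` are grouped by minimal polynomial. A prime of degree `e` dividing `[K : k]`
has exactly `e` distinct roots in `K`, which accounts for the weight `e` in `primePowerSum`. -/
lemma sum_minpoly (Λ : k[X] → ℂ) :
    primePowerSum Λ (Module.finrank k K) =
      ∑ x : K, Λ (minpoly k x) ^ (Module.finrank k K / (minpoly k x).natDegree) := by
  classical
  rw [primePowerSum, Finset.sum_sigma']
  have hmaps : ∀ x ∈ (Finset.univ : Finset K),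
      (⟨(minpoly k x).natDegree, minpoly k x⟩ : Σ _ : ℕ, k[X]) ∈
        (Module.finrank k K).divisors.sigma fun e => primesOfDegree k e := by
    intro x _
    have hx : IsIntegral k x := Algebra.IsIntegral.isIntegral x
    simp only [Finset.mem_sigma, Nat.mem_divisors, mem_primesOfDegree]
    exact ⟨⟨minpoly.degree_dvd hx, Module.finrank_pos.ne'⟩, ⟨minpoly.monic hx, trivial⟩,
      minpoly.irreducible hx⟩
  rw [← Finset.sum_fiberwise_of_maps_to hmaps]
  refine Finset.sum_congr rfl ?_
  rintro ⟨e, P⟩ h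
  simp only [Finset.mem_sigma, Nat.mem_divisors, mem_primesOfDegree] at h
  obtain ⟨⟨hdvd, -⟩, ⟨hPm, rfl⟩, hPi⟩ := h
  have hfib : (Finset.univ.filter fun x : K => (⟨(minpoly k x).natDegree, minpoly k x⟩ : Σ _ : ℕ, k[X]) =
      ⟨P.natDegree, P⟩) = (P.aroots K).toFinset := by
    ext x
    simp only [Finset.mem_filter, Finset.mem_univ, true_and, Multiset.mem_toFinset,
      mem_aroots, ne_eq, hPm.ne_zero, not_false_eq_true]
    constructor
    · intro h
      have := (Sigma.mk.inj_iff.1 h).2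
      rw [← eq_of_heq this]; exact minpoly.aeval k x
    · intro h
      rw [← minpoly.eq_of_irreducible_of_monic hPi h hPm]
  rw [Finset.sum_congr rfl (g := fun _ => Λ P ^ (Module.finrank k K / P.natDegree)), hfib,
    Finset.sum_const, nsmul_eq_mul]
  · congr 2
    have hsep : P.Separable := PerfectField.separable_of_irreducible hPi
    -- The field `k[X]/(P)` embeds into `K` because its degree divides `[K : k]`; normality of `K/k`
    -- then splits `P`.
    have hsp : (P.map (algebraMap k K)).Splits := by
      have : Fact (Irreducible P) := ⟨hPi⟩
      have hfr : Module.finrank k (AdjoinRoot P) = P.natDegree :=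
        finrank_quotient_span_eq_natDegree
      obtain ⟨φ⟩ := FiniteField.nonempty_algHom_of_finrank_dvd (F := k) (K := AdjoinRoot P) (L := K)
        (by rwa [hfr])
      have h0 : aeval (φ (AdjoinRoot.root P)) P = 0 := by
        rw [aeval_algHom_apply]; simp
      have := Normal.splits (F := k) (K := K) inferInstance (φ (AdjoinRoot.root P))
      rwa [← minpoly.eq_of_irreducible_of_monic hPi h0 hPm] at this
    rw [Multiset.toFinset_card_of_nodup (nodup_roots (hsep.map)),
      ← hsp.natDegree_eq_card_roots,
      natDegree_map]
  · intro x hx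
    have := (Sigma.mk.inj_iff.1 (Finset.mem_filter.1 hx).2).2
    rw [eq_of_heq this]

/-- The completely multiplicative function on monic polynomials whose value at the characteristic
polynomial of `x` is `χ(N x ^ d) ψ(Tr (x ^ d))`. -/
def charFun (χ : MulChar k ℂ) (ψ : AddChar k ℂ) (d : ℕ) (f : k[X]) : ℂ :=
  (χ ^ d) ((-1) ^ f.natDegree * f.coeff 0) * ψ (rootPowerSum d f)

lemma charFun_one (χ : MulChar k ℂ) (ψ : AddChar k ℂ) (d : ℕ) : charFun χ ψ d 1 = 1 := by
  simp [charFun, rootPowerSum_one]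

lemma charFun_mul (χ : MulChar k ℂ) (ψ : AddChar k ℂ) (d : ℕ) (f g : k[X]) (hf : f.Monic)
    (hg : g.Monic) : charFun χ ψ d (f * g) = charFun χ ψ d f * charFun χ ψ d g := by
  rw [charFun, charFun, charFun, rootPowerSum_mul d hf hg, AddChar.map_add_eq_mul,
    hf.natDegree_mul hg, mul_coeff_zero, pow_add,
    show ((-1 : k) ^ f.natDegree * (-1) ^ g.natDegree * (f.coeff 0 * g.coeff 0)) =
      ((-1 : k) ^ f.natDegree * f.coeff 0) * ((-1) ^ g.natDegree * g.coeff 0) by ring, map_mul]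
  ring

lemma charFun_pow (χ : MulChar k ℂ) (ψ : AddChar k ℂ) (d : ℕ) {f : k[X]} (hf : f.Monic) (i : ℕ) :
    charFun χ ψ d (f ^ i) = charFun χ ψ d f ^ i := by
  induction i with
  | zero => simp [charFun_one]
  | succ i ih => rw [pow_succ, charFun_mul _ _ _ _ _ (hf.pow i) hf, ih, pow_succ]

/-- The power of the minimal polynomial that appears is `∏ (X - σ x)`. Its constant coefficient is
the norm up to sign, and the `d`-th power sum of its roots is the trace of `x ^ d`. -/
lemma primePowerSum_charFun (χ : MulChar k ℂ) (ψ : AddChar k ℂ) {d : ℕ} (hd : d ≠ 0) :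
    primePowerSum (charFun χ ψ d) (Module.finrank k K) =
      ∑ x : K, (χ ^ d) (Algebra.norm k x) * ψ (Algebra.trace k K (x ^ d)) := by
  rw [sum_minpoly]
  refine Finset.sum_congr rfl fun x _ => ?_
  have hx : IsIntegral k x := Algebra.IsIntegral.isIntegral x
  have hm := minpoly.monic hx
  rw [← charFun_pow χ ψ d hm, charFun]
  set f := minpoly k x ^ (Module.finrank k K / (minpoly k x).natDegree)
  have hf : f.map (algebraMap k K) = ∏ σ : Gal(K/k), (X - C (σ x)) := map_minpoly_pow x
  have hfm : f.Monic := hm.pow _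
  have hinj := (algebraMap k K).injective
  congr 2
  · apply hinj
    have hc : f.natDegree = Finset.card (Finset.univ : Finset Gal(K/k)) := by
      rw [← hfm.natDegree_map (algebraMap k K), hf,
        natDegree_prod_of_monic _ _ fun _ _ => monic_X_sub_C _]
      simp
    rw [Algebra.norm_eq_prod_automorphisms, map_mul, ← coeff_map, hf, map_pow, map_neg, map_one,
      coeff_zero_prod, hc, ← Finset.prod_const, ← Finset.prod_mul_distrib]
    simp
  · apply hinj
    rw [trace_eq_sum_automorphisms, ← rootPowerSum_map _ _ hfm, hf, rootPowerSum_prod hd]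
    simp

end FiniteFieldExtension

end PadicEpsilon

end

noncomputable section

open Polynomial

namespace PadicEpsilon

lemma IsCyclic.mem_range_pow_iff {G : Type*} [CommGroup G] [IsCyclic G] [Finite G] {d e : ℕ}
    (h : Nat.card G = d * e) (x : G) : (∃ y, y ^ d = x) ↔ x ^ e = 1 := by
  have hpos : 0 < d * e := h ▸ Nat.card_pos
  have hd : 0 < d := Nat.pos_of_mul_pos_right hpos
  have hle : (powMonoidHom d : G →* G).range ≤ (powMonoidHom e : G →* G).ker := by
    rintro _ ⟨y, rfl⟩
    rw [MonoidHom.mem_ker, powMonoidHom_apply, powMonoidHom_apply, ← pow_mul, ← h, pow_card_eq_one']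
  have heq := Subgroup.eq_of_le_of_card_ge hle (by
    rw [IsCyclic.card_powMonoidHom_range, IsCyclic.card_powMonoidHom_ker, h, Nat.gcd_mul_right_left,
      Nat.gcd_mul_left_left, Nat.mul_div_cancel_left _ hd])
  have := SetLike.ext_iff.1 heq x
  simpa using this

/-! ### Counting `d`-th roots by multiplicative characters. -/

section PowerCharacters

variable {k K : Type*} [Field k] [Fintype k] [Field K] [Fintype K] [Algebra k K]

open Classical in
-- In the cyclic group of units a fibre of the `d`-th power map is empty or a coset of a kernel of
-- order `d`.
lemma card_filter_pow_eq {d e : ℕ} (h : Nat.card K - 1 = d * e) {y : K} (hy : y ≠ 0) :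
    ((Finset.univ.filter fun x : K => x ^ d = y).card : ℂ) = if y ^ e = 1 then (d : ℂ) else 0 := by
  have hK : Nat.card Kˣ = d * e := by rw [Nat.card_units, h]
  have hpos : 0 < d * e := hK ▸ Nat.card_pos
  have hd : 0 < d := Nat.pos_of_mul_pos_right hpos
  have h1 : (Finset.univ.filter fun x : K => x ^ d = y).card =
      (Finset.univ.filter fun x : Kˣ => powMonoidHom d x = Units.mk0 y hy).card := by
    symm
    refine Finset.card_bij (fun x _ => (x : K)) ?_ (fun a _ b _ h => Units.ext h) ?_
    · intro x hx
      have := (Finset.mem_filter.1 hx).2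
      simpa [Units.ext_iff] using this
    · intro x hx
      have hx' := (Finset.mem_filter.1 hx).2
      have hx0 : x ≠ 0 := by rintro rfl; rw [zero_pow hd.ne'] at hx'; exact hy hx'.symm
      exact ⟨Units.mk0 x hx0, by simpa [Units.ext_iff] using hx', rfl⟩
  have hiff := IsCyclic.mem_range_pow_iff hK (Units.mk0 y hy)
  rw [h1]
  split_ifs with hye
  · obtain ⟨z, hz⟩ := hiff.2 (by ext; simpa using hye)
    rw [MonoidHom.card_fiber_eq_of_mem_range (powMonoidHom d : Kˣ →* Kˣ) (y := 1) ⟨z, hz⟩ ⟨1, map_one _⟩]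
    have := IsCyclic.card_powMonoidHom_ker Kˣ d
    rw [hK, Nat.gcd_mul_right_left] at this
    rw [Nat.card_eq_fintype_card, Fintype.card_subtype] at this
    rw [← Nat.cast_inj (R := ℂ)] at this
    rw [← this]
    simp [MonoidHom.mem_ker]
  · rw [Nat.cast_eq_zero, Finset.card_eq_zero, Finset.filter_eq_empty_iff]
    rintro x - hx
    exact hye (by simpa [Units.ext_iff] using hiff.1 ⟨x, hx⟩)

variable [Fintype (MulChar k ℂ)]

variable (k) in
open Classical in
/-- The multiplicative characters of a finite field whose `d`-th power is trivial. -/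
def torsionChars (d : ℕ) : Finset (MulChar k ℂ) := Finset.univ.filter fun η => η ^ d = 1

lemma mem_torsionChars {d : ℕ} {η : MulChar k ℂ} : η ∈ torsionChars k d ↔ η ^ d = 1 := by
  simp [torsionChars]

lemma card_torsionChars {d : ℕ} (h : d ∣ Nat.card k - 1) : (torsionChars k d).card = d := by
  obtain ⟨e⟩ := MulChar.mulEquiv_units k ℂ
  have hcyc : IsCyclic (MulChar k ℂ) := isCyclic_of_surjective e.symm e.symm.surjective
  have hc : Nat.card (MulChar k ℂ) = Nat.card k - 1 := by
    rw [Nat.card_congr e.toEquiv, Nat.card_units]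
  have := IsCyclic.card_powMonoidHom_ker (MulChar k ℂ) d
  rw [hc, Nat.gcd_eq_right h] at this
  classical
  rw [Nat.card_eq_fintype_card, Fintype.card_subtype] at this
  simpa [torsionChars, MonoidHom.mem_ker] using this

open Classical in
-- Orthogonality of characters. If `a ^ e = 1`, then `a` is a `d`-th power and each term is `1`;
-- otherwise some torsion character differs from `1` at `a`, and multiplying by it permutes the sum.
lemma sum_torsionChars_apply {d e : ℕ} (h : Nat.card k - 1 = d * e) {a : k} (ha : a ≠ 0) :
    ∑ η ∈ torsionChars k d, η a = if a ^ e = 1 then (d : ℂ) else 0 := by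
  have hk : Nat.card kˣ = d * e := by rw [Nat.card_units, h]
  split_ifs with hae
  · obtain ⟨z, hz⟩ := (IsCyclic.mem_range_pow_iff hk (Units.mk0 a ha)).2 (by ext; simpa using hae)
    have hz' : (z : k) ^ d = a := by simpa [Units.ext_iff] using hz
    rw [Finset.sum_congr rfl (g := fun _ => (1 : ℂ))]
    · simp [card_torsionChars (k := k) (h ▸ dvd_mul_right d e)]
    · intro η hη
      have hd : d ≠ 0 := by
        rintro rfl
        have h0 : 0 < Nat.card kˣ := Nat.card_pos
        rw [hk, zero_mul] at h0
        exact h0.false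
      rw [← hz', map_pow, ← MulChar.pow_apply' η hd, mem_torsionChars.1 hη, MulChar.one_apply_coe]
  -- A character `ω` that is nontrivial at `a ^ e` gives `ω ^ e`, whose order divides `d` and which
  -- is nontrivial at `a`.
  · obtain ⟨ω, hω⟩ := MulChar.exists_apply_ne_one_of_hasEnoughRootsOfUnity k ℂ hae
    have hω' : ω ^ e ∈ torsionChars k d := by
      rw [mem_torsionChars, ← pow_mul, mul_comm, ← h]
      ext u
      rw [MulChar.pow_apply_coe, ← map_pow, ← Units.val_pow_eq_pow_val, ← Nat.card_units,
        pow_card_eq_one']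
      simp
    have he : e ≠ 0 := by rintro rfl; simp at hae
    have hval : (ω ^ e) a ≠ 1 := by rwa [MulChar.pow_apply' ω he, ← map_pow]
    have hinv : ∑ η ∈ torsionChars k d, η a = (ω ^ e) a * ∑ η ∈ torsionChars k d, η a := by
      rw [Finset.mul_sum]
      refine Finset.sum_bij' (fun η _ => (ω ^ e)⁻¹ * η) (fun η _ => ω ^ e * η) ?_ ?_ ?_ ?_ ?_
      · intro η hη
        rw [mem_torsionChars] at *
        rw [mul_pow, inv_pow, hω', hη]; simp
      · intro η hη
        rw [mem_torsionChars] at *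
        rw [mul_pow, hω', hη]; simp
      · intro η _; simp
      · intro η _; simp
      · intro η _
        rw [← MulChar.mul_apply, mul_inv_cancel_left]
    have : ((ω ^ e) a - 1) * ∑ η ∈ torsionChars k d, η a = 0 := by
      rw [sub_mul, one_mul, ← hinv, sub_self]
    exact (mul_eq_zero.1 this).resolve_left (sub_ne_zero.2 hval)

/-- The norm is the power map with exponent `1 + q + q² + ⋯`, so the criterion for `y` to be a
`d`-th power in `K` is the criterion for `N y` to be one in `k`. -/
lemma card_filter_pow_eq_sum [DecidableEq K] {d : ℕ} (hd : d ∣ Nat.card k - 1) {y : K} (hy : y ≠ 0) :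
    ((Finset.univ.filter fun x : K => x ^ d = y).card : ℂ) =
      ∑ η ∈ torsionChars k d, η (Algebra.norm k y) := by
  classical
  obtain ⟨e, he⟩ := hd
  have hK : Nat.card K - 1 = d * (e * ∑ i ∈ Finset.range (Module.finrank k K), Nat.card k ^ i) := by
    rw [← mul_assoc, ← he, Module.natCard_eq_pow_finrank (K := k) (V := K), mul_comm, Nat.geomSum_eq]
    · rw [Nat.div_mul_cancel]
      simpa using Nat.sub_dvd_pow_sub_pow (Nat.card k) 1 (Module.finrank k K)
    · exact Finite.one_lt_card
  have hN : Algebra.norm k y ≠ 0 := by simpa using hy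
  rw [sum_torsionChars_apply he hN]
  have := card_filter_pow_eq hK hy
  have hiff : (Algebra.norm k y) ^ e = 1 ↔
      y ^ (e * ∑ i ∈ Finset.range (Module.finrank k K), Nat.card k ^ i) = 1 := by
    rw [← (algebraMap k K).injective.eq_iff, map_pow, FiniteField.algebraMap_norm_eq_pow_sum,
      ← pow_mul, map_one, mul_comm e]
  simp_rw [hiff]
  convert this

/-- The sum is grouped by `y = x ^ d`; the fibre over `0` contributes nothing because `χ` vanishes
at `0`. The exponents `1` are kept so that `primePowerSum_charFun` applies to the right side with `d
= 1`. -/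
lemma sum_pow_eq_sum_torsionChars (χ : MulChar k ℂ) (ψ : AddChar k ℂ) {d : ℕ} (hd0 : d ≠ 0)
    (hd : d ∣ Nat.card k - 1) :
    ∑ x : K, (χ ^ d) (Algebra.norm k x) * ψ (Algebra.trace k K (x ^ d)) =
      ∑ η ∈ torsionChars k d,
        ∑ y : K, ((χ * η) ^ 1) (Algebra.norm k y) * ψ (Algebra.trace k K (y ^ 1)) := by
  classical
  have h1 : ∀ x : K, (χ ^ d) (Algebra.norm k x) * ψ (Algebra.trace k K (x ^ d)) =
      χ (Algebra.norm k (x ^ d)) * ψ (Algebra.trace k K (x ^ d)) := fun x => by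
    rw [MulChar.pow_apply' χ hd0, ← map_pow χ, ← map_pow (Algebra.norm k)]
  simp_rw [h1]
  rw [← Finset.sum_fiberwise (g := fun x : K => x ^ d) (s := Finset.univ), Finset.sum_comm]
  refine Finset.sum_congr rfl fun y _ => ?_
  rw [Finset.sum_congr rfl (g := fun _ => χ (Algebra.norm k y) * ψ (Algebra.trace k K y))
    (fun x hx => by rw [(Finset.mem_filter.1 hx).2]), Finset.sum_const, nsmul_eq_mul]
  by_cases hy : y = 0
  · have : Nontrivial K := inferInstance
    simp [hy, Algebra.norm_zero, MulChar.map_zero]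
  · rw [card_filter_pow_eq_sum hd hy, Finset.sum_mul]
    refine Finset.sum_congr rfl fun η _ => ?_
    rw [pow_one, pow_one, MulChar.mul_apply]
    ring

end PowerCharacters

/-! ### The L-function attached to Gauss sums. -/

section LFunction

variable {k : Type*} [Field k] [Fintype k]

lemma exists_extension (j : ℕ) (hj : j ≠ 0) :
    ∃ (K : Type) (_ : Field K) (_ : Fintype K) (_ : Algebra k K), Module.finrank k K = j := by
  obtain ⟨p, hp⟩ := CharP.exists k
  have : Fact p.Prime := ⟨CharP.char_is_prime k p⟩
  have : NeZero j := ⟨hj⟩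
  exact ⟨FiniteField.Extension k p j, inferInstance, Fintype.ofFinite _, inferInstance,
    FiniteField.finrank_extension k p j⟩

lemma primePowerSum_charFun_eq_sum [Fintype (MulChar k ℂ)] (χ : MulChar k ℂ) (ψ : AddChar k ℂ) {d : ℕ}
    (hd0 : d ≠ 0) (hd : d ∣ Nat.card k - 1) {j : ℕ} (hj : j ≠ 0) :
    primePowerSum (charFun χ ψ d) j =
      ∑ η ∈ torsionChars k d, primePowerSum (charFun (χ * η) ψ 1) j := by
  obtain ⟨K, _, _, _, rfl⟩ := exists_extension (k := k) j hj
  rw [primePowerSum_charFun χ ψ hd0, sum_pow_eq_sum_torsionChars χ ψ hd0 hd]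
  exact Finset.sum_congr rfl fun η _ => (primePowerSum_charFun (χ * η) ψ one_ne_zero).symm

lemma monicSum_zero {Λ : k[X] → ℂ} (hone : Λ 1 = 1) : monicSum Λ 0 = 1 := by
  simp [monicSum, sum_monicsOfDegree, hone]

lemma rootPowerSum_one_eq {f : k[X]} (hf : f.Monic) : rootPowerSum 1 f = -f.nextCoeff := by
  have h := congrArg (PowerSeries.coeff 1) (negLogDeriv_mul_self (H := (f.reverse : PowerSeries k))
    (by rw [constantCoeff_reverse hf]; exact one_ne_zero))
  have h0 : PowerSeries.coeff 0 (negLogDeriv (f.reverse : PowerSeries k)) = 0 := by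
    simp [negLogDeriv]
  rw [PowerSeries.coeff_mul, Finset.Nat.antidiagonal_succ] at h
  simp only [Finset.sum_cons, h0, zero_mul, zero_add, Finset.Nat.antidiagonal_zero,
    Finset.map_singleton, Finset.sum_singleton, Function.Embedding.prodMap] at h
  simp only [Function.Embedding.coeFn_mk, Prod.map, Function.Embedding.refl_apply, zero_add,
    PowerSeries.coeff_zero_eq_constantCoeff, constantCoeff_reverse hf, mul_one,
    Nat.succ_eq_add_one] at h
  rw [rootPowerSum, h, map_neg, show (1 : ℕ) = 0 + 1 from rfl, PowerSeries.coeff_succ_X_mul,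
    PowerSeries.coeff_derivative]
  simp [coeff_one_reverse]

lemma natDegree_X_pow_add_sum {n : ℕ} (c : Fin n → k) :
    (X ^ n + ∑ i, C (c i) * X ^ (i : ℕ)).natDegree = n := by
  rw [natDegree_add_eq_left_of_degree_lt] <;> simp [degree_sum_C_mul_X_pow_lt c]

lemma coeff_X_pow_add_sum {n : ℕ} (c : Fin n → k) (i : Fin n) :
    (X ^ n + ∑ i, C (c i) * X ^ (i : ℕ)).coeff i = c i := by
  simp [finsetSum_coeff, coeff_X_pow, Fin.val_inj, i.2.ne]

lemma charFun_one_X_pow_add_sum (χ : MulChar k ℂ) (ψ : AddChar k ℂ) {n : ℕ} (c : Fin (n + 1) → k) :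
    charFun χ ψ 1 (X ^ (n + 1) + ∑ i, C (c i) * X ^ (i : ℕ)) =
      χ ((-1) ^ (n + 1) * c 0) * ψ (-c (Fin.last n)) := by
  rw [charFun, rootPowerSum_one_eq (monic_X_pow_add (degree_sum_C_mul_X_pow_lt c)), pow_one,
    natDegree_X_pow_add_sum, nextCoeff_of_natDegree_pos (by rw [natDegree_X_pow_add_sum]; omega),
    natDegree_X_pow_add_sum, ← coeff_X_pow_add_sum c 0, ← coeff_X_pow_add_sum c (Fin.last n)]
  simp

lemma monicSum_charFun_one_one (χ : MulChar k ℂ) (ψ : AddChar k ℂ) :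
    monicSum (charFun χ ψ 1) 1 = gaussSum χ ψ := by
  rw [monicSum, sum_monicsOfDegree, gaussSum,
    ← (Equiv.funUnique (Fin 1) k).symm.sum_comp, ← Equiv.sum_comp (Equiv.neg k)]
  refine Finset.sum_congr rfl fun c _ => ?_
  rw [charFun_one_X_pow_add_sum]
  simp

lemma exists_map_ne_one {ψ : AddChar k ℂ} (hψ : ψ ≠ 1) {b : k} (hb : b ≠ 0) : ∃ s, ψ (b * s) ≠ 1 := by
  obtain ⟨t, ht⟩ := AddChar.ne_one_iff.1 hψ
  exact ⟨b⁻¹ * t, by rwa [mul_inv_cancel_left₀ hb]⟩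

lemma sum_eq_zero_of_perm {ι : Type*} [Fintype ι] (e : ι ≃ ι) {F : ι → ℂ} {w : ℂ} (hw : w ≠ 1)
    (h : ∀ i, F (e i) = w * F i) : ∑ i, F i = 0 := by
  have h1 : ∑ i, F i = w * ∑ i, F i := by
    rw [Finset.mul_sum, ← e.sum_comp]
    exact Finset.sum_congr rfl fun i _ => h i
  have h2 : (w - 1) * ∑ i, F i = 0 := by rw [sub_mul, ← h1, one_mul, sub_self]
  exact (mul_eq_zero.1 h2).resolve_left (sub_ne_zero.2 hw)

/-- In degree at least `2` the constant coefficient, which enters through `χ`, and the subleading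
one, which enters through `ψ`, are independent; the sum over the latter vanishes. -/
lemma monicSum_charFun_one (χ : MulChar k ℂ) {ψ : AddChar k ℂ} (hψ : ψ ≠ 1) (n : ℕ) :
    monicSum (charFun χ ψ 1) (n + 2) = 0 := by
  rw [monicSum, sum_monicsOfDegree]
  obtain ⟨s, hs⟩ := exists_map_ne_one hψ (b := -1) (by simp)
  refine sum_eq_zero_of_perm (Equiv.addRight (Pi.single (Fin.last (n + 1)) s)) hs fun c => ?_
  rw [charFun_one_X_pow_add_sum, charFun_one_X_pow_add_sum]
  have : (0 : Fin (n + 2)) ≠ Fin.last (n + 1) := Fin.last_pos.ne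
  simp only [Equiv.coe_addRight, Pi.add_apply, Pi.single_eq_same, Pi.single_eq_of_ne this, add_zero]
  rw [neg_add, AddChar.map_add_eq_mul, neg_one_mul]
  ring

/-- The L-series is `1 + g z` with `g` the Gauss sum, and the prime power sums are the coefficients
of `z L'/L`. This is the Hasse-Davenport lifting relation. -/
lemma primePowerSum_charFun_one (χ : MulChar k ℂ) {ψ : AddChar k ℂ} (hψ : ψ ≠ 1) (n : ℕ) :
    primePowerSum (charFun χ ψ 1) (n + 1) = (-1) ^ n * gaussSum χ ψ ^ (n + 1) := by
  have hone := charFun_one χ ψ 1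
  have key := mul_monicSum hone (charFun_mul χ ψ 1)
  induction n with
  | zero =>
    have := key 1
    simp [monicSum_zero hone, monicSum_charFun_one_one] at this
    simp [this]
  | succ n ih =>
    have := key (n + 2)
    rw [monicSum_charFun_one χ hψ, Finset.sum_Icc_succ_top (by omega),
      Finset.sum_Icc_succ_top (by omega), Finset.sum_eq_zero] at this
    · rw [show n + 2 - (n + 1) = 1 by omega, show n + 1 + 1 = n + 2 by rfl,
        Nat.sub_self, monicSum_zero hone, monicSum_charFun_one_one, ih] at this
      rw [show n + 1 + 1 = n + 2 by rfl]
      linear_combination -this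
    · intro j hj
      rw [Finset.mem_Icc] at hj
      rw [show n + 2 - j = (n - j) + 2 by omega, monicSum_charFun_one χ hψ, mul_zero]

/-- The product of the Gauss sums of the twists of `χ` by the characters of order dividing `d`, as
a sum over monic polynomials of degree `d`. -/
lemma prod_gaussSum_eq_monicSum [Fintype (MulChar k ℂ)] (χ : MulChar k ℂ) {ψ : AddChar k ℂ}
    (hψ : ψ ≠ 1) {d : ℕ} (hd0 : d ≠ 0) (hd : d ∣ Nat.card k - 1) :
    ∏ η ∈ torsionChars k d, gaussSum (χ * η) ψ = monicSum (charFun χ ψ d) d := by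
  classical
  let g : torsionChars k d → ℂ := fun η => gaussSum (χ * η.1) ψ
  have hone := charFun_one χ ψ d
  have key := mul_monicSum hone (charFun_mul χ ψ d)
  -- Up to sign, the prime power sums for exponent `d` are the power sums of the Gauss sums of the
  -- twists.
  have hM : ∀ j, primePowerSum (charFun χ ψ d) (j + 1) =
      (-1) ^ j * MvPolynomial.aeval g (MvPolynomial.psum (torsionChars k d) ℂ (j + 1)) := by
    intro j
    rw [primePowerSum_charFun_eq_sum χ ψ hd0 hd (by omega), MvPolynomial.psum, map_sum,
      Finset.mul_sum, ← Finset.sum_coe_sort]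
    exact Finset.sum_congr rfl fun η _ => by
      rw [primePowerSum_charFun_one _ hψ, map_pow, MvPolynomial.aeval_X]
  -- `mul_monicSum` and Newton's identities are the same recursion, so the coefficients are
  -- elementary symmetric functions of the Gauss sums; the one of index `d`, the number of
  -- variables, is their product.
  have hesymm : ∀ n, monicSum (charFun χ ψ d) n =
      MvPolynomial.aeval g (MvPolynomial.esymm (torsionChars k d) ℂ n) := by
    intro n
    induction n using Nat.strong_induction_on with
    | _ n ih =>
    rcases Nat.eq_zero_or_pos n with rfl | hn
    · simp [monicSum_zero hone]
    have hn' : (n : ℂ) ≠ 0 := by exact_mod_cast hn.ne'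
    refine mul_left_cancel₀ hn' ?_
    have newton := congrArg (MvPolynomial.aeval g)
      (MvPolynomial.mul_esymm_eq_sum (torsionChars k d) ℂ n)
    simp only [map_mul, map_natCast, map_pow, map_neg, map_one, map_sum] at newton
    rw [key, newton, Finset.mul_sum]
    refine Finset.sum_bij' (fun j _ => (n - j, j)) (fun a _ => a.2) ?_ ?_ ?_ ?_ ?_
    · intro j hj; rw [Finset.mem_Icc] at hj
      rw [Finset.mem_filter, Finset.HasAntidiagonal.mem_antidiagonal]; omega
    · rintro ⟨a, b⟩ h; rw [Finset.mem_filter, Finset.HasAntidiagonal.mem_antidiagonal] at h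
      rw [Finset.mem_Icc]; omega
    · intro j _; rfl
    · rintro ⟨a, b⟩ h; rw [Finset.mem_filter, Finset.HasAntidiagonal.mem_antidiagonal] at h
      ext <;> simp; omega
    · intro j hj
      rw [Finset.mem_Icc] at hj
      obtain ⟨j, rfl⟩ : ∃ i, j = i + 1 := ⟨j - 1, by omega⟩
      obtain ⟨m, rfl⟩ : ∃ m, n = m + (j + 1) := ⟨n - (j + 1), by omega⟩
      rw [hM, Nat.add_sub_cancel, ih m (by omega)]
      have : (-1 : ℂ) ^ (m + (j + 1) + 1) * (-1) ^ m = (-1) ^ j := by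
        rw [← pow_add, show m + (j + 1) + 1 + m = 2 * (m + 1) + j by ring, pow_add, pow_mul]
        simp
      rw [← this]; ring
  rw [hesymm d, MvPolynomial.esymm]
  have hcard : (Finset.univ : Finset (torsionChars k d)).card = d := by
    simp [card_torsionChars hd]
  have hset : Finset.powersetCard d (Finset.univ : Finset (torsionChars k d)) = {Finset.univ} := by
    have := Finset.powersetCard_self (Finset.univ : Finset (torsionChars k d))
    rwa [hcard] at this
  rw [hset, Finset.sum_singleton, map_prod]
  simp only [MvPolynomial.aeval_X]
  exact (Finset.prod_coe_sort (torsionChars k d) fun η => gaussSum (χ * η) ψ).symm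

end LFunction

end PadicEpsilon

end

noncomputable section

open Polynomial

namespace PadicEpsilon

/-! ### Direct evaluation of the coefficient of degree `d` for odd `d`. -/

section Evaluation

variable {k : Type*} [Field k]

/-- With `F = X^(t+1) E`, the terms of the logarithmic derivative beyond `-X F'` are divisible by
`X^(2t+2)`, so the coefficient of index `2t + 1` sees only the linear term. -/
lemma coeff_negLogDeriv_one_add {t : ℕ} (E : PowerSeries k) :
    PowerSeries.coeff (2 * t + 1) (negLogDeriv (1 + PowerSeries.X ^ (t + 1) * E)) =
      -((2 * t + 1 : ℕ) : k) * PowerSeries.coeff t E := by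
  set F := PowerSeries.X ^ (t + 1) * E with hF
  have hc : PowerSeries.constantCoeff (1 + F) ≠ 0 := by simp [hF]
  have hder : PowerSeries.derivative k (1 + F) =
      PowerSeries.X ^ t * (((t + 1 : ℕ) : PowerSeries k) * E + PowerSeries.X * PowerSeries.derivative k E) := by
    rw [map_add, hF, Derivation.leibniz, Derivation.leibniz_pow]
    simp [pow_succ]
    ring
  have hinv : (1 + F)⁻¹ = 1 - F * (1 + F)⁻¹ := by
    have := PowerSeries.mul_inv_cancel (1 + F) hc
    linear_combination this
  have h1 : negLogDeriv (1 + F) = -(PowerSeries.X ^ (t + 1) *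
      (((t + 1 : ℕ) : PowerSeries k) * E + PowerSeries.X * PowerSeries.derivative k E)) +
      PowerSeries.X ^ (2 * t + 2) * (((((t + 1 : ℕ) : PowerSeries k) * E + PowerSeries.X * PowerSeries.derivative k E)) *
        (E * (1 + F)⁻¹)) := by
    rw [negLogDeriv, hder]
    nth_rw 1 [hinv]
    rw [hF]; ring
  rw [h1, map_add, map_neg, PowerSeries.coeff_X_pow_mul', PowerSeries.coeff_X_pow_mul',
    if_pos (by omega), if_neg (by omega), add_zero, show 2 * t + 1 - (t + 1) = t by omega, map_add]
  rw [← nsmul_eq_mul, map_nsmul]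
  rcases t with _ | t
  · simp
  · rw [PowerSeries.coeff_succ_X_mul, PowerSeries.coeff_derivative]
    simp
    ring

/-- The monic polynomial of degree `2t+1` with constant coefficient `a`, lower half `u` and upper half
`h` of its coefficients. -/
def oddMonic {t : ℕ} (x : k × (Fin t → k) × (Fin t → k)) : k[X] :=
  X ^ (2 * t + 1) + (∑ i, C (x.2.2 i) * X ^ (t + 1 + (i : ℕ)) +
    (∑ i, C (x.2.1 i) * X ^ (1 + (i : ℕ)) + C x.1))

lemma degree_oddMonic_aux {t : ℕ} (x : k × (Fin t → k) × (Fin t → k)) :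
    (∑ i, C (x.2.2 i) * X ^ (t + 1 + (i : ℕ)) +
      (∑ i, C (x.2.1 i) * X ^ (1 + (i : ℕ)) + C x.1)).degree < ((2 * t + 1 : ℕ) : WithBot ℕ) := by
  have h1 : ∀ (c : k) (i : ℕ), i < 2 * t + 1 → C c * X ^ i ∈ degreeLT k (2 * t + 1) := fun c i hi =>
    mem_degreeLT.2 ((degree_C_mul_X_pow_le _ _).trans_lt (Nat.cast_lt.2 hi))
  refine mem_degreeLT.1 (Submodule.add_mem _ (Submodule.sum_mem _ fun i _ => h1 _ _ (by omega))
    (Submodule.add_mem _ (Submodule.sum_mem _ fun i _ => h1 _ _ (by omega)) ?_))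
  simpa using h1 x.1 0 (by omega)

lemma oddMonic_monic {t : ℕ} (x : k × (Fin t → k) × (Fin t → k)) : (oddMonic x).Monic :=
  monic_X_pow_add (degree_oddMonic_aux x)

lemma natDegree_oddMonic {t : ℕ} (x : k × (Fin t → k) × (Fin t → k)) :
    (oddMonic x).natDegree = 2 * t + 1 := by
  rw [oddMonic, natDegree_add_eq_left_of_degree_lt] <;> simp
  exact_mod_cast degree_oddMonic_aux x

lemma coeff_oddMonic_zero {t : ℕ} (x : k × (Fin t → k) × (Fin t → k)) :
    (oddMonic x).coeff 0 = x.1 := by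
  have h1 : ∀ j : Fin t, ¬ (0 = t + 1 + (j : ℕ)) := fun j => by omega
  have h2 : ∀ j : Fin t, ¬ (0 = 1 + (j : ℕ)) := fun j => by omega
  simp [oddMonic, finsetSum_coeff, coeff_X_pow, h1, h2]

lemma coeff_oddMonic_low {t : ℕ} (x : k × (Fin t → k) × (Fin t → k)) (i : Fin t) :
    (oddMonic x).coeff (1 + i) = x.2.1 i := by
  have h1 : ∀ j : Fin t, ¬ (1 + (i : ℕ) = t + 1 + j) := fun j => by omega
  have h2 : ¬ (1 + (i : ℕ) = 2 * t + 1) := by omega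
  simp [oddMonic, finsetSum_coeff, coeff_X_pow, h1, h2, coeff_C, Fin.val_inj]

lemma coeff_oddMonic_high {t : ℕ} (x : k × (Fin t → k) × (Fin t → k)) (i : Fin t) :
    (oddMonic x).coeff (t + 1 + i) = x.2.2 i := by
  have h1 : ∀ j : Fin t, ¬ (t + 1 + (i : ℕ) = 1 + j) := fun j => by omega
  have h2 : ¬ (t + 1 + (i : ℕ) = 2 * t + 1) := by omega
  simp [oddMonic, finsetSum_coeff, coeff_X_pow, h1, h2, coeff_C, Fin.val_inj]

lemma oddMonic_coeff {t : ℕ} {f : k[X]} (hm : f.Monic) (hn : f.natDegree = 2 * t + 1) :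
    oddMonic (f.coeff 0, (fun i : Fin t => f.coeff (1 + i)),
      fun i : Fin t => f.coeff (t + 1 + i)) = f := by
  set x : k × (Fin t → k) × (Fin t → k) := (f.coeff 0, (fun i : Fin t => f.coeff (1 + i)),
    fun i : Fin t => f.coeff (t + 1 + i)) with hx
  ext n
  rcases lt_trichotomy n (2 * t + 1) with h | h | h
  · rcases Nat.eq_zero_or_pos n with rfl | h0
    · exact coeff_oddMonic_zero x
    · rcases lt_or_ge n (t + 1) with h1 | h1
      · have := coeff_oddMonic_low x ⟨n - 1, by omega⟩
        simp only [hx] at this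
        rwa [show 1 + (n - 1) = n by omega] at this
      · have := coeff_oddMonic_high x ⟨n - (t + 1), by omega⟩
        simp only [hx] at this
        rwa [show t + 1 + (n - (t + 1)) = n by omega] at this
  · have h1 := (oddMonic_monic x).coeff_natDegree
    have h2 := hm.coeff_natDegree
    rw [natDegree_oddMonic] at h1
    rw [h, h1, ← hn, h2]
  · rw [coeff_eq_zero_of_natDegree_lt (by rw [natDegree_oddMonic]; exact h),
      coeff_eq_zero_of_natDegree_lt (by rw [hn]; exact h)]

lemma sum_monicsOfDegree_odd [Fintype k] {t : ℕ} (Λ : k[X] → ℂ) :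
    ∑ f ∈ monicsOfDegree k (2 * t + 1), Λ f =
      ∑ x : k × (Fin t → k) × (Fin t → k), Λ (oddMonic x) := by
  refine Finset.sum_bij' (fun f _ => (f.coeff 0, (fun i : Fin t => f.coeff (1 + i)),
    fun i : Fin t => f.coeff (t + 1 + i))) (fun x _ => oddMonic x) ?_ ?_ ?_ ?_ ?_
  · intro _ _; exact Finset.mem_univ _
  · intro x _; exact mem_monicsOfDegree.2 ⟨oddMonic_monic x, natDegree_oddMonic x⟩
  · intro f hf
    obtain ⟨hm, hn⟩ := mem_monicsOfDegree.1 hf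
    exact oddMonic_coeff hm hn
  · intro x _
    refine Prod.ext (coeff_oddMonic_zero x) (Prod.ext (funext fun i => ?_) (funext fun i => ?_))
    · exact coeff_oddMonic_low x i
    · exact coeff_oddMonic_high x i
  · intro f hf
    obtain ⟨hm, hn⟩ := mem_monicsOfDegree.1 hf
    exact congrArg Λ (oddMonic_coeff hm hn).symm

/-- The upper half of the reversed polynomial. -/
def upperSeries {t : ℕ} (h : Fin t → k) : PowerSeries k :=
  1 + ∑ i, PowerSeries.C (h i) * PowerSeries.X ^ (t - (i : ℕ))

lemma constantCoeff_upperSeries {t : ℕ} (h : Fin t → k) :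
    PowerSeries.constantCoeff (upperSeries h) = 1 := by
  rw [upperSeries, map_add, map_sum, Finset.sum_eq_zero]
  · simp
  · intro i _
    have : t - (i : ℕ) ≠ 0 := by omega
    simp [this]

lemma reverse_oddMonic {t : ℕ} (x : k × (Fin t → k) × (Fin t → k)) :
    ((oddMonic x).reverse : PowerSeries k) = upperSeries x.2.2 + PowerSeries.X ^ (t + 1) *
      (∑ i, PowerSeries.C (x.2.1 i) * PowerSeries.X ^ (t - 1 - (i : ℕ)) +
        PowerSeries.C x.1 * PowerSeries.X ^ t) := by
  have hr : (oddMonic x).reverse = 1 + ∑ i, C (x.2.2 i) * X ^ (t - (i : ℕ)) +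
      X ^ (t + 1) * (∑ i, C (x.2.1 i) * X ^ (t - 1 - (i : ℕ)) + C x.1 * X ^ t) := by
    have hsum : ∀ (s : Fin t → k[X]) (N : ℕ), reflect N (∑ i, s i) = ∑ i, reflect N (s i) := by
      intro s N; ext n; simp [finsetSum_coeff, coeff_reflect]
    have h1 : reflect (2 * t + 1) (X ^ (2 * t + 1) : k[X]) = 1 := by
      rw [← one_mul (X ^ (2 * t + 1)), ← C_1, reflect_C_mul_X_pow, revAt_le le_rfl]; simp
    have h2 : reflect (2 * t + 1) (∑ i, C (x.2.2 i) * X ^ (t + 1 + (i : ℕ))) =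
        ∑ i, C (x.2.2 i) * X ^ (t - (i : ℕ)) := by
      rw [hsum]
      exact Finset.sum_congr rfl fun i _ => by
        rw [reflect_C_mul_X_pow, revAt_le (by omega),
          show 2 * t + 1 - (t + 1 + (i : ℕ)) = t - i by omega]
    have h3 : reflect (2 * t + 1) (∑ i, C (x.2.1 i) * X ^ (1 + (i : ℕ))) =
        X ^ (t + 1) * ∑ i, C (x.2.1 i) * X ^ (t - 1 - (i : ℕ)) := by
      rw [hsum, Finset.mul_sum]
      exact Finset.sum_congr rfl fun i _ => by
        rw [reflect_C_mul_X_pow, revAt_le (by omega),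
          show 2 * t + 1 - (1 + (i : ℕ)) = (t + 1) + (t - 1 - i) by omega, pow_add]
        exact mul_left_comm _ _ _
    rw [reverse, natDegree_oddMonic, oddMonic, reflect_add, reflect_add, reflect_add, h1, h2, h3,
      reflect_C, show 2 * t + 1 = (t + 1) + t by ring, pow_add]
    ring
  have hco : ∀ (s : Fin t → k[X]), ((∑ i, s i : k[X]) : PowerSeries k) = ∑ i, (s i : PowerSeries k) :=
    fun s => map_sum (Polynomial.coeToPowerSeries.ringHom) s Finset.univ
  rw [hr, upperSeries]
  simp [hco]

/-- The reversed polynomial is `A + X^(t+1) C = A (1 + X^(t+1) C A⁻¹)`, where `A` carries the upper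
half of the coefficients and `C` the lower half and the constant one. Additivity and
`coeff_negLogDeriv_one_add` make the power sum affine in `C`. -/
lemma rootPowerSum_oddMonic {t : ℕ} (x : k × (Fin t → k) × (Fin t → k)) :
    rootPowerSum (2 * t + 1) (oddMonic x) =
      PowerSeries.coeff (2 * t + 1) (negLogDeriv (upperSeries x.2.2)) +
        -((2 * t + 1 : ℕ) : k) * (∑ i : Fin t, x.2.1 i *
          PowerSeries.coeff (1 + (i : ℕ)) (upperSeries x.2.2)⁻¹ + x.1) := by
  set A := upperSeries x.2.2 with hA
  have hA0 : PowerSeries.constantCoeff A = 1 := constantCoeff_upperSeries _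
  have hA1 : PowerSeries.constantCoeff A ≠ 0 := by simp [hA0]
  set Cc : PowerSeries k := ∑ i, PowerSeries.C (x.2.1 i) * PowerSeries.X ^ (t - 1 - (i : ℕ)) +
        PowerSeries.C x.1 * PowerSeries.X ^ t with hCc
  have h1 : A + PowerSeries.X ^ (t + 1) * Cc = A * (1 + PowerSeries.X ^ (t + 1) * (Cc * A⁻¹)) := by
    have := PowerSeries.mul_inv_cancel A hA1
    linear_combination -(PowerSeries.X ^ (t + 1) * Cc) * this
  rw [rootPowerSum, reverse_oddMonic, h1, negLogDeriv_mul hA1 (by simp), map_add,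
    coeff_negLogDeriv_one_add]
  congr 2
  rw [hCc, add_mul, Finset.sum_mul, map_add, map_sum, mul_assoc (PowerSeries.C x.1),
    PowerSeries.coeff_C_mul, PowerSeries.coeff_X_pow_mul', if_pos le_rfl, Nat.sub_self,
    PowerSeries.coeff_zero_eq_constantCoeff, PowerSeries.constantCoeff_inv, hA0, inv_one, mul_one]
  congr 1
  refine Finset.sum_congr rfl fun i _ => ?_
  rw [mul_assoc, PowerSeries.coeff_C_mul, PowerSeries.coeff_X_pow_mul', if_pos (by omega),
    show t - (t - 1 - (i : ℕ)) = 1 + i by omega]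

/-- The hypothesis says that `A⁻¹`, hence also `A`, is `1` modulo `X^(t+1)`; but `A` has no terms of
degree above `t`. -/
lemma upperSeries_eq_one {t : ℕ} {h : Fin t → k}
    (hh : ∀ i : Fin t, PowerSeries.coeff (1 + (i : ℕ)) (upperSeries h)⁻¹ = 0) : h = 0 := by
  set A := upperSeries h with hA
  have hA0 : PowerSeries.constantCoeff A = 1 := constantCoeff_upperSeries _
  have hinv := PowerSeries.mul_inv_cancel A (by simp [hA0])
  have hB : ∃ Q, A⁻¹ = 1 + PowerSeries.X ^ (t + 1) * Q := by
    have : PowerSeries.X ^ (t + 1) ∣ A⁻¹ - 1 := by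
      rw [PowerSeries.X_pow_dvd_iff]
      intro m hm
      rcases Nat.eq_zero_or_pos m with rfl | h0
      · simp [hA0]
      · have := hh ⟨m - 1, by omega⟩
        rw [map_sub, PowerSeries.coeff_one, if_neg h0.ne', sub_zero]
        simpa [show 1 + (m - 1) = m by omega] using this
    obtain ⟨Q, hQ⟩ := this
    exact ⟨Q, by rw [← hQ]; ring⟩
  obtain ⟨Q, hQ⟩ := hB
  have hA1 : A = 1 - PowerSeries.X ^ (t + 1) * (A * Q) := by
    rw [hQ] at hinv; linear_combination hinv
  funext i
  have hc := congrArg (PowerSeries.coeff (t - (i : ℕ))) hA1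
  rw [map_sub, PowerSeries.coeff_X_pow_mul', if_neg (by omega), sub_zero, hA, upperSeries, map_add,
    add_eq_left, map_sum, Finset.sum_eq_single i] at hc
  · simpa [PowerSeries.coeff_C_mul, PowerSeries.coeff_X_pow] using hc
  · intro j _ hj
    have : ¬ (t - (i : ℕ) = t - j) := fun h => hj (Fin.ext (by omega))
    simp [PowerSeries.coeff_X_pow, this]
  · simp

variable [Fintype k]

/-- For a fixed upper half `h`, the summand is an additive character of the lower half `u`,
nontrivial unless `h = 0`. Only `h = 0` survives: the `q ^ t` choices of `u` contribute equally, and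
the constant coefficient runs through a Gauss sum. -/
lemma monicSum_charFun_odd (χ : MulChar k ℂ) {ψ : AddChar k ℂ} (hψ : ψ ≠ 1) {t : ℕ}
    (hd : ((2 * t + 1 : ℕ) : k) ≠ 0) :
    monicSum (charFun χ ψ (2 * t + 1)) (2 * t + 1) =
      (Nat.card k : ℂ) ^ t * gaussSum (χ ^ (2 * t + 1)) (ψ.mulShift ((2 * t + 1 : ℕ) : k)) := by
  set d := 2 * t + 1
  have hval : ∀ x : k × (Fin t → k) × (Fin t → k), charFun χ ψ d (oddMonic x) =
      (χ ^ d) (-x.1) * ψ (PowerSeries.coeff d (negLogDeriv (upperSeries x.2.2)) +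
        -(d : k) * (∑ i : Fin t, x.2.1 i *
          PowerSeries.coeff (1 + (i : ℕ)) (upperSeries x.2.2)⁻¹ + x.1)) := fun x => by
    rw [charFun, rootPowerSum_oddMonic, natDegree_oddMonic, coeff_oddMonic_zero,
      Odd.neg_one_pow ⟨t, rfl⟩, neg_one_mul]
  rw [monicSum, sum_monicsOfDegree_odd, Fintype.sum_prod_type]
  simp_rw [hval, Fintype.sum_prod_type_right]
  have hin : ∀ a : k, ∀ h : Fin t → k, h ≠ 0 → ∑ u : Fin t → k, (χ ^ d) (-a) *
      ψ (PowerSeries.coeff d (negLogDeriv (upperSeries h)) + -(d : k) * (∑ i : Fin t, u i *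
          PowerSeries.coeff (1 + (i : ℕ)) (upperSeries h)⁻¹ + a)) = 0 := by
    intro a h hh
    have : ∃ i : Fin t, PowerSeries.coeff (1 + (i : ℕ)) (upperSeries h)⁻¹ ≠ 0 := by
      by_contra! hcon; exact hh (upperSeries_eq_one hcon)
    obtain ⟨i, hi⟩ := this
    obtain ⟨s, hs⟩ := exists_map_ne_one hψ (mul_ne_zero (neg_ne_zero.2 hd) hi)
    refine sum_eq_zero_of_perm (Equiv.addRight (Pi.single i s)) hs fun u => ?_
    have h2 : ∑ j : Fin t, (u + Pi.single i s : Fin t → k) j * PowerSeries.coeff (1 + (j : ℕ)) (upperSeries h)⁻¹ =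
        ∑ j : Fin t, u j * PowerSeries.coeff (1 + (j : ℕ)) (upperSeries h)⁻¹ +
          s * PowerSeries.coeff (1 + (i : ℕ)) (upperSeries h)⁻¹ := by
      simp_rw [Pi.add_apply, add_mul]
      rw [Finset.sum_add_distrib]
      congr 1
      rw [Finset.sum_eq_single i] <;> simp +contextual
    rw [Equiv.coe_addRight, h2, mul_left_comm, ← AddChar.map_add_eq_mul]
    congr 2
    ring
  have hzero : ∀ a : k, ∑ h : Fin t → k, ∑ u : Fin t → k, (χ ^ d) (-a) *
      ψ (PowerSeries.coeff d (negLogDeriv (upperSeries h)) + -(d : k) * (∑ i : Fin t, u i *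
          PowerSeries.coeff (1 + (i : ℕ)) (upperSeries h)⁻¹ + a)) =
      (Nat.card k : ℂ) ^ t * ((χ ^ d) (-a) * ψ (-(d : k) * a)) := by
    intro a
    rw [Finset.sum_eq_single 0 (fun h _ hh => hin a h hh) (by simp)]
    have h1 : upperSeries (0 : Fin t → k) = 1 := by simp [upperSeries]
    have h3 : negLogDeriv (1 : PowerSeries k) = 0 := by simp [negLogDeriv]
    simp [h1, h3]
  rw [Finset.sum_congr rfl fun a _ => hzero a, ← Finset.mul_sum, gaussSum,
    ← Equiv.sum_comp (Equiv.neg k)]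
  simp [AddChar.mulShift_apply]

end Evaluation

/-- The **Hasse-Davenport product formula** for odd `d`. -/
theorem prod_gaussSum_torsionChars {k : Type*} [Field k] [Fintype k] [Fintype (MulChar k ℂ)]
    (χ : MulChar k ℂ) {ψ : AddChar k ℂ} (hψ : ψ ≠ 1) {t : ℕ} (hd : 2 * t + 1 ∣ Nat.card k - 1) :
    ∏ η ∈ torsionChars k (2 * t + 1), gaussSum (χ * η) ψ =
      (Nat.card k : ℂ) ^ t * gaussSum (χ ^ (2 * t + 1)) (ψ.mulShift ((2 * t + 1 : ℕ) : k)) := by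
  rw [prod_gaussSum_eq_monicSum χ hψ (by omega) hd, monicSum_charFun_odd χ hψ]
  -- Divisibility of `q - 1` by `d` prevents `d` from vanishing in `k`, where `q = 0`.
  intro h
  obtain ⟨e, he⟩ := hd
  have h1 : ((Nat.card k : ℕ) : k) = 0 := by simp [Nat.card_eq_fintype_card]
  have h2 : Nat.card k = (2 * t + 1) * e + 1 := by
    have : 0 < Nat.card k := Nat.card_pos
    omega
  rw [h2, Nat.cast_add, Nat.cast_mul, h] at h1
  simp at h1

end PadicEpsilon

end

noncomputable section

open Polynomial

namespace PadicEpsilon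

/-! ### The case `d = 2` and quadratic Gauss sums. -/

section QuadraticGaussSum

variable {k : Type*} [Field k] [Fintype k]

lemma rootPowerSum_two (a b : k) : rootPowerSum 2 (X ^ 2 + (C a + C b * X)) = b ^ 2 - 2 * a := by
  have hdeg : (C a + C b * X).degree < ((2 : ℕ) : WithBot ℕ) := by
    rw [add_comm]
    exact (degree_linear_le).trans_lt (by norm_num)
  have hm : (X ^ 2 + (C a + C b * X)).Monic := monic_X_pow_add hdeg
  have hn : (X ^ 2 + (C a + C b * X)).natDegree = 2 := by
    rw [natDegree_add_eq_left_of_degree_lt] <;> simp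
    exact_mod_cast hdeg
  set f := X ^ 2 + (C a + C b * X) with hf
  have hc : ∀ i ≤ 2, PowerSeries.coeff i (f.reverse : PowerSeries k) = f.coeff (2 - i) := by
    intro i hi
    rw [coeff_coe, coeff_reverse, hn, revAt_le hi]
  have c0 : PowerSeries.coeff 0 (f.reverse : PowerSeries k) = 1 := by
    rw [hc 0 (by omega)]; simp [hf]
  have c1 : PowerSeries.coeff 1 (f.reverse : PowerSeries k) = b := by
    rw [hc 1 (by omega)]; simp [hf, coeff_C]
  have c2 : PowerSeries.coeff 2 (f.reverse : PowerSeries k) = a := by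
    rw [hc 2 (by omega)]; simp [hf]
  have hid := negLogDeriv_mul_self (H := (f.reverse : PowerSeries k))
    (by rw [constantCoeff_reverse hm]; exact one_ne_zero)
  set D := negLogDeriv (f.reverse : PowerSeries k)
  have hD0 : PowerSeries.coeff 0 D = 0 := by simp [D, negLogDeriv]
  have anti2 : Finset.HasAntidiagonal.antidiagonal 2 = {((0 : ℕ), (2 : ℕ)), (1, 1), (2, 0)} := rfl
  have anti1 : Finset.HasAntidiagonal.antidiagonal 1 = {((0 : ℕ), (1 : ℕ)), (1, 0)} := rfl
  have h1 := congrArg (PowerSeries.coeff 1) hid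
  have h2 := congrArg (PowerSeries.coeff 2) hid
  rw [PowerSeries.coeff_mul, anti1, map_neg, show (1 : ℕ) = 0 + 1 from rfl,
    PowerSeries.coeff_succ_X_mul, PowerSeries.coeff_derivative] at h1
  rw [PowerSeries.coeff_mul, anti2, map_neg, show (2 : ℕ) = 1 + 1 from rfl,
    PowerSeries.coeff_succ_X_mul, PowerSeries.coeff_derivative] at h2
  simp [hD0, c0, c1, c2, -PowerSeries.coeff_zero_eq_constantCoeff, -Polynomial.coeff_coe] at h1 h2
  rw [rootPowerSum]
  change PowerSeries.coeff 2 D = _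
  rw [h1] at h2
  linear_combination h2

/-- The **Hasse-Davenport product formula** for `d = 2`. -/
theorem prod_gaussSum_torsionChars_two [Fintype (MulChar k ℂ)] (χ : MulChar k ℂ) {ψ : AddChar k ℂ}
    (hψ : ψ ≠ 1) (h2 : 2 ∣ Nat.card k - 1) :
    ∏ η ∈ torsionChars k 2, gaussSum (χ * η) ψ =
      (∑ b : k, ψ (b ^ 2)) * gaussSum (χ ^ 2) (ψ.mulShift 2) := by
  -- The substitution `a ↦ -a` in the constant coefficient turns `ψ(b² - 2a)` into `ψ(b²) ψ(2a)` and
  -- leaves `χ²` unchanged, so the double sum factors.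
  rw [prod_gaussSum_eq_monicSum χ hψ (by omega) h2, monicSum, sum_monicsOfDegree,
    ← (finTwoArrowEquiv k).symm.sum_comp, Fintype.sum_prod_type, gaussSum, Finset.mul_sum,
    ← Equiv.sum_comp (Equiv.neg k)]
  refine Finset.sum_congr rfl fun a _ => ?_
  rw [Finset.sum_mul]
  refine Finset.sum_congr rfl fun b _ => ?_
  have hp : (X ^ 2 + ∑ i, C ((finTwoArrowEquiv k).symm (Equiv.neg k a, b) i) * X ^ (i : ℕ) : k[X]) =
      X ^ 2 + (C (-a) + C b * X) := by
    simp [Fin.sum_univ_two]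
  have hn : (X ^ 2 + (C (-a) + C b * X)).natDegree = 2 := by
    rw [← hp]; exact natDegree_X_pow_add_sum _
  rw [hp, charFun, rootPowerSum_two, hn]
  have hχ : (χ ^ 2) (-a) = (χ ^ 2) a := by
    rw [MulChar.pow_apply' χ two_ne_zero, MulChar.pow_apply' χ two_ne_zero, ← map_pow, ← map_pow,
      neg_sq]
  simp only [even_two, Even.neg_pow, one_pow, coeff_add, coeff_X_pow, OfNat.zero_ne_ofNat, if_false,
    coeff_C_zero, mul_coeff_zero, coeff_X_zero, mul_zero, add_zero, zero_add, one_mul, hχ,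
    AddChar.mulShift_apply]
  rw [show b ^ 2 - 2 * -a = b ^ 2 + 2 * a by ring, AddChar.map_add_eq_mul]
  ring

variable [DecidableEq k]

/-- An element `y` has `1` plus its quadratic character many square roots, and the constant part
sums to `0` against `ψ`. -/
lemma sum_sq_eq_gaussSum (h2 : ringChar k ≠ 2) {ψ : AddChar k ℂ} (hψ : ψ ≠ 1) :
    ∑ b : k, ψ (b ^ 2) =
      gaussSum ((quadraticChar k).ringHomComp (Int.castRingHom ℂ)) ψ := by
  rw [← Finset.sum_fiberwise (g := fun x : k => x ^ 2) (s := Finset.univ), gaussSum]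
  have h0 : ∑ a : k, ψ a = 0 := AddChar.sum_eq_zero_of_ne_one hψ
  have h3 : ∀ y : k, ∑ b with b ^ 2 = y, ψ (b ^ 2) = ((quadraticChar k y : ℤ) : ℂ) * ψ y + ψ y := by
    intro y
    rw [Finset.sum_congr rfl (g := fun _ => ψ y) (fun x hx => by rw [(Finset.mem_filter.1 hx).2]),
      Finset.sum_const, nsmul_eq_mul, ← add_one_mul]
    congr 1
    have := quadraticChar_card_sqrts h2 y
    rw [Set.toFinset_ofPred] at this
    exact_mod_cast this
  rw [Finset.sum_congr rfl fun y _ => h3 y, Finset.sum_add_distrib, h0, add_zero]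
  rfl

lemma sum_sq_sq (h2 : ringChar k ≠ 2) {ψ : AddChar k ℂ} (hψ : ψ ≠ 1) :
    (∑ b : k, ψ (b ^ 2)) ^ 2 = ((quadraticChar k (-1) : ℤ) : ℂ) * Nat.card k := by
  rw [sum_sq_eq_gaussSum h2 hψ, gaussSum_sq, Nat.card_eq_fintype_card]
  · rfl
  · intro h
    obtain ⟨a, ha⟩ := quadraticChar_exists_neg_one h2
    have h3 := congrArg (fun χ : MulChar k ℂ => χ a) h
    have ha0 : a ≠ 0 := by rintro rfl; simp at ha
    simp only [MulChar.ringHomComp_apply, ha, MulChar.one_apply ha0.isUnit] at h3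
    norm_num at h3
  · exact (quadraticChar_isQuadratic k).comp _
  · exact AddChar.IsPrimitive.of_ne_one hψ

lemma sum_neg_sq (h2 : ringChar k ≠ 2) {ψ : AddChar k ℂ} (hψ : ψ ≠ 1) :
    ∑ b : k, ψ (-b ^ 2) = ((quadraticChar k (-1) : ℤ) : ℂ) * ∑ b : k, ψ (b ^ 2) := by
  have hψ' : ψ.mulShift (-1) ≠ 1 := by
    intro h
    refine hψ (DFunLike.ext _ _ fun x => ?_)
    have := DFunLike.congr_fun h (-x)
    simpa [AddChar.mulShift_apply] using this
  have h3 := sum_sq_eq_gaussSum h2 hψ'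
  simp only [AddChar.mulShift_apply, neg_one_mul] at h3
  rw [h3, sum_sq_eq_gaussSum h2 hψ]
  have h4 := gaussSum_mulShift ((quadraticChar k).ringHomComp (Int.castRingHom ℂ)) ψ (-1)
  have h5 : ((quadraticChar k (-1) : ℤ) : ℂ) ^ 2 = 1 := by
    have := quadraticChar_sq_one (F := k) (a := -1) (by simp)
    exact_mod_cast this
  rw [← h4, ← mul_assoc]
  simp only [MulChar.ringHomComp_apply, Units.val_neg, Units.val_one, Int.coe_castRingHom]
  rw [← sq, h5, one_mul]

end QuadraticGaussSum

end PadicEpsilon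

end

/-! ### Fractional ideals and shells of a normalized local field. -/

noncomputable section

namespace PadicEpsilon

/-- A nonarchimedean local field whose norm is the normalized absolute value. -/
class IsNormalizedLocalField (F : Type*) [NontriviallyNormedField F] [IsUltrametricDist F] :
    Prop where
  finite_residue : Finite (Valued.ResidueField F)
  proper : ProperSpace F
  exists_uniformizer : ∃ ϖ : F, ‖ϖ‖ = (residueCard F : ℝ)⁻¹
  exists_norm_eq : ∀ x : F, x ≠ 0 → ∃ n : ℤ, ‖x‖ = (residueCard F : ℝ) ^ (-n)

attribute [instance] IsNormalizedLocalField.finite_residue IsNormalizedLocalField.proper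

section Basic

variable {F : Type*} [NontriviallyNormedField F] [IsUltrametricDist F]

/-- Properness makes the ring of integers compact, so the residue field is finite. -/
lemma isNormalizedLocalField_of_properSpace [ProperSpace F] (ϖ : Valued.integer F)
    (hϖ : Valued.maximalIdeal F = Ideal.span {ϖ}) (hnorm : ‖(ϖ : F)‖ = (residueCard F : ℝ)⁻¹) :
    IsNormalizedLocalField F := by
  have hcomp : CompactSpace (Valued.integer F) := by
    have h : ((Valued.integer F : Subring F) : Set F) = Metric.closedBall 0 1 := by
      ext x
      simpa using Valued.integer.mem_iff (K := F) (x := x)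
    have h' : IsCompact ((Valued.integer F : Subring F) : Set F) := h ▸ isCompact_closedBall 0 1
    exact isCompact_iff_compactSpace.1 h'
  let _ : (Valued.v : Valuation F NNReal).RankOne :=
    inferInstanceAs (NormedField.valuation (K := F)).RankOne
  have hfin : Finite (Valued.ResidueField F) :=
    (Valued.integer.compactSpace_iff_completeSpace_and_isDiscreteValuationRing_and_finite_residueField.1
      hcomp).2.2
  have hq : (1 : ℝ) < residueCard F := by
    rw [residueCard]; exact_mod_cast Finite.one_lt_card
  have hq0 : (0 : ℝ) < residueCard F := by linarith
  refine ⟨hfin, inferInstance, ⟨ϖ, hnorm⟩, fun x hx => ?_⟩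
  obtain ⟨n, hn1, hn2⟩ := exists_mem_Ioc_zpow (norm_pos_iff.2 hx) hq
  -- The exponent is chosen so that `q⁻¹ < ‖y‖ ≤ 1`. If `‖y‖ < 1`, then `ϖ` would divide `y` and
  -- force `‖y‖ ≤ q⁻¹`; hence `‖y‖ = 1`.
  set y : F := x * (ϖ : F) ^ (n + 1) with hy
  have hϖ0 : (ϖ : F) ≠ 0 := by
    rw [← norm_pos_iff, hnorm]; positivity
  have hynorm : ‖y‖ = ‖x‖ * (residueCard F : ℝ) ^ (-(n + 1)) := by
    rw [hy, norm_mul, norm_zpow, hnorm, inv_zpow, zpow_neg]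
  have hy1 : ‖y‖ ≤ 1 := by
    rw [hynorm, zpow_neg, ← div_eq_mul_inv, div_le_one (by positivity)]
    exact hn2
  have hy2 : (residueCard F : ℝ)⁻¹ < ‖y‖ := by
    rw [hynorm, zpow_neg, zpow_add₀ hq0.ne', zpow_one, mul_inv, ← mul_assoc,
      lt_mul_iff_one_lt_left (inv_pos.2 hq0), ← div_eq_mul_inv, one_lt_div (by positivity)]
    exact hn1
  have hy3 : ‖y‖ = 1 := by
    by_contra hne
    have hlt : ‖y‖ < 1 := lt_of_le_of_ne hy1 hne
    have hmem : (⟨y, Valued.integer.mem_iff.2 hy1⟩ : Valued.integer F) ∈ Valued.maximalIdeal F := by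
      rw [IsLocalRing.mem_maximalIdeal, mem_nonunits_iff, Valued.integer.isUnit_iff_norm_eq_one]
      exact hne
    rw [hϖ, Ideal.mem_span_singleton] at hmem
    obtain ⟨z, hz⟩ := hmem
    have hz' : y = ϖ * z := congrArg Subtype.val hz
    have hz1 := Valued.integer.norm_le_one z
    rw [hz', norm_mul, hnorm] at hy2
    have : (residueCard F : ℝ)⁻¹ * ‖(z : F)‖ ≤ (residueCard F : ℝ)⁻¹ :=
      mul_le_of_le_one_right (by positivity) hz1
    exact absurd hy2 (not_lt.2 this)
  refine ⟨-(n + 1), ?_⟩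
  rw [hynorm, zpow_neg, mul_inv_eq_one₀ (by positivity)] at hy3
  rw [hy3, neg_neg]

lemma properSpace_of_finiteDimensional (p : ℕ) [Fact p.Prime] [Algebra ℚ_[p] F]
    [FiniteDimensional ℚ_[p] F] [ContinuousSMul ℚ_[p] F] : ProperSpace F := by
  let e : F ≃L[ℚ_[p]] (Fin (Module.finrank ℚ_[p] F) → ℚ_[p]) :=
    ContinuousLinearEquiv.ofFinrankEq (by simp)
  have : LocallyCompactSpace F := e.toHomeomorph.isClosedEmbedding.locallyCompactSpace
  exact ProperSpace.of_locallyCompactSpace F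

/-- The norm of `F` is related to that of `ℚ_[p]` only through continuity of scalar multiplication,
which carries `p ^ n → 0` over to `F`. -/
lemma norm_prime_lt_one (p : ℕ) [Fact p.Prime] [Algebra ℚ_[p] F]
    [FiniteDimensional ℚ_[p] F] [ContinuousSMul ℚ_[p] F] : ‖(p : F)‖ < 1 := by
  have hcont : Continuous (algebraMap ℚ_[p] F) := by
    have : (algebraMap ℚ_[p] F : ℚ_[p] → F) = fun x => x • (1 : F) := by
      ext x; rw [Algebra.smul_def, mul_one]
    rw [this]
    exact continuous_id.smul continuous_const
  have h1 : Tendsto (fun n : ℕ => (p : ℚ_[p]) ^ n) atTop (𝓝 0) :=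
    tendsto_pow_atTop_nhds_zero_of_norm_lt_one Padic.norm_p_lt_one
  have h2 := (hcont.tendsto 0).comp h1
  rw [map_zero] at h2
  have h3 : Tendsto (fun n : ℕ => ‖(p : F)‖ ^ n) atTop (𝓝 0) := by
    have := h2.norm
    simpa using this
  exact (tendsto_pow_atTop_nhds_zero_iff.1 h3) |> fun h => by simpa using h

lemma norm_natCast_eq_one_of_coprime {p d : ℕ} (hp : ‖(p : F)‖ < 1) (h : d.Coprime p) :
    ‖(d : F)‖ = 1 := by
  refine le_antisymm (IsUltrametricDist.norm_natCast_le_one F d) (not_lt.1 fun hlt => ?_)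
  have hb := Nat.gcd_eq_gcd_ab d p
  rw [h.gcd_eq_one] at hb
  have hb' : (1 : F) = d * (Nat.gcdA d p : ℤ) + p * (Nat.gcdB d p : ℤ) := by
    have := congrArg (Int.cast : ℤ → F) hb
    push_cast at this
    exact this
  have h1 : ‖(d : F) * (Nat.gcdA d p : ℤ)‖ < 1 := by
    rw [norm_mul]
    exact mul_lt_one_of_nonneg_of_lt_one_left (norm_nonneg _) hlt
      (IsUltrametricDist.norm_intCast_le_one F _)
  have h2 : ‖(p : F) * (Nat.gcdB d p : ℤ)‖ < 1 := by
    rw [norm_mul]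
    exact mul_lt_one_of_nonneg_of_lt_one_left (norm_nonneg _) hp
      (IsUltrametricDist.norm_intCast_le_one F _)
  have h3 := IsUltrametricDist.norm_add_le_max ((d : F) * (Nat.gcdA d p : ℤ)) (p * (Nat.gcdB d p : ℤ))
  rw [← hb', norm_one] at h3
  exact absurd h3 (not_le.2 (max_lt h1 h2))

variable [IsNormalizedLocalField F]

variable (F) in
lemma one_lt_residueCard : (1 : ℝ) < residueCard F := by
  rw [residueCard]; exact_mod_cast Finite.one_lt_card

variable (F) in
lemma residueCard_pos : (0 : ℝ) < residueCard F := zero_lt_one.trans (one_lt_residueCard F)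

variable (F) in
/-- A chosen uniformizer. -/
def unif : F := (IsNormalizedLocalField.exists_uniformizer (F := F)).choose

variable (F) in
lemma norm_unif : ‖unif F‖ = (residueCard F : ℝ)⁻¹ :=
  (IsNormalizedLocalField.exists_uniformizer (F := F)).choose_spec

variable (F) in
lemma unif_ne_zero : unif F ≠ 0 := by
  rw [← norm_pos_iff, norm_unif]; exact inv_pos.2 (residueCard_pos F)

variable (F) in
lemma norm_unif_zpow (n : ℤ) : ‖unif F ^ n‖ = (residueCard F : ℝ) ^ (-n) := by
  rw [norm_zpow, norm_unif, inv_zpow, zpow_neg]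

lemma mem_primePow {n : ℤ} {x : F} : x ∈ primePow F n ↔ ‖x‖ ≤ (residueCard F : ℝ) ^ (-n) := Iff.rfl

lemma zero_mem_primePow (n : ℤ) : (0 : F) ∈ primePow F n := by
  rw [mem_primePow, norm_zero]; exact (zpow_pos (residueCard_pos F) _).le

lemma add_mem_primePow {n : ℤ} {x y : F} (hx : x ∈ primePow F n) (hy : y ∈ primePow F n) :
    x + y ∈ primePow F n :=
  (IsUltrametricDist.norm_add_le_max x y).trans (max_le hx hy)

lemma neg_mem_primePow {n : ℤ} {x : F} (hx : x ∈ primePow F n) : -x ∈ primePow F n := by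
  rwa [mem_primePow, norm_neg]

lemma sub_mem_primePow {n : ℤ} {x y : F} (hx : x ∈ primePow F n) (hy : y ∈ primePow F n) :
    x - y ∈ primePow F n := by
  rw [sub_eq_add_neg]; exact add_mem_primePow hx (neg_mem_primePow hy)

lemma add_mem_primePow_iff {n : ℤ} {x y : F} (hy : y ∈ primePow F n) :
    x + y ∈ primePow F n ↔ x ∈ primePow F n :=
  ⟨fun h => by simpa using sub_mem_primePow h hy, fun h => add_mem_primePow h hy⟩

lemma mul_mem_primePow {a b : ℤ} {x y : F} (hx : x ∈ primePow F a) (hy : y ∈ primePow F b) :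
    x * y ∈ primePow F (a + b) := by
  rw [mem_primePow, norm_mul, neg_add, zpow_add₀ (residueCard_pos F).ne']
  exact mul_le_mul hx hy (norm_nonneg _) (zpow_pos (residueCard_pos F) _).le

lemma primePow_anti {a b : ℤ} (h : a ≤ b) : primePow F b ⊆ primePow F a := fun _ hx =>
  le_trans (mem_primePow.1 hx) (zpow_le_zpow_right₀ (one_lt_residueCard F).le (by omega))

lemma mul_mem_primePow_le {a b c : ℤ} (h : c ≤ a + b) {x y : F} (hx : x ∈ primePow F a)
    (hy : y ∈ primePow F b) : x * y ∈ primePow F c := primePow_anti h (mul_mem_primePow hx hy)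

lemma zpow_residueCard_le_iff {a b : ℤ} :
    (residueCard F : ℝ) ^ a ≤ (residueCard F : ℝ) ^ b ↔ a ≤ b :=
  zpow_le_zpow_iff_right₀ (one_lt_residueCard F)

lemma norm_eq_of_mem_of_notMem {n : ℤ} {x : F} (h1 : x ∈ primePow F n) (h2 : x ∉ primePow F (n + 1)) :
    ‖x‖ = (residueCard F : ℝ) ^ (-n) := by
  have hx : x ≠ 0 := by rintro rfl; exact h2 (zero_mem_primePow _)
  obtain ⟨m, hm⟩ := IsNormalizedLocalField.exists_norm_eq x hx
  rw [mem_primePow, hm, zpow_residueCard_le_iff] at h1 h2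
  rw [hm, show m = n by omega]

lemma norm_eq_zpow_iff {n : ℤ} {x : F} :
    ‖x‖ = (residueCard F : ℝ) ^ (-n) ↔ x ∈ primePow F n ∧ x ∉ primePow F (n + 1) := by
  refine ⟨fun h => ⟨h.le, fun h2 => ?_⟩, fun h => norm_eq_of_mem_of_notMem h.1 h.2⟩
  rw [mem_primePow, h, zpow_residueCard_le_iff] at h2
  omega

lemma mul_mem_primePow_iff {n m : ℤ} {x y : F} (hx : ‖x‖ = (residueCard F : ℝ) ^ (-n)) :
    x * y ∈ primePow F m ↔ y ∈ primePow F (m - n) := by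
  have hpos : (0 : ℝ) < (residueCard F : ℝ) ^ (-n) := zpow_pos (residueCard_pos F) _
  rw [mem_primePow, mem_primePow, norm_mul, hx, show -m = -n + -(m - n) by ring,
    zpow_add₀ (residueCard_pos F).ne', mul_le_mul_iff_right₀ hpos]

lemma mem_primePow_zero {x : F} : x ∈ primePow F 0 ↔ ‖x‖ ≤ 1 := by simp [mem_primePow]

lemma mem_primePow_one {x : F} : x ∈ primePow F 1 ↔ ‖x‖ < 1 := by
  constructor
  · intro h
    refine lt_of_le_of_lt (mem_primePow.1 h) ?_
    rw [zpow_neg, zpow_one]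
    exact inv_lt_one_of_one_lt₀ (one_lt_residueCard F)
  · intro h
    by_contra h2
    have := norm_eq_of_mem_of_notMem (n := 0) (mem_primePow_zero.2 h.le) h2
    simp only [neg_zero, zpow_zero] at this
    exact h.ne this

lemma exists_mem_primePow (x : F) : ∃ n : ℤ, x ∈ primePow F n := by
  by_cases hx : x = 0
  · exact ⟨0, hx ▸ zero_mem_primePow 0⟩
  · obtain ⟨n, hn⟩ := IsNormalizedLocalField.exists_norm_eq x hx
    exact ⟨n, hn.le⟩

lemma exists_primePow_subset_ball {ε : ℝ} (hε : 0 < ε) :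
    ∃ n : ℕ, ∀ m : ℤ, n ≤ m → primePow F m ⊆ Metric.ball 0 ε := by
  obtain ⟨n, hn⟩ := exists_pow_lt_of_lt_one hε (inv_lt_one_of_one_lt₀ (one_lt_residueCard F))
  refine ⟨n, fun m hm x hx => ?_⟩
  rw [mem_ball_zero_iff]
  refine lt_of_le_of_lt (mem_primePow.1 (primePow_anti hm hx)) ?_
  rwa [zpow_neg, zpow_natCast, ← inv_pow]

lemma primePow_eq_closedBall (n : ℤ) :
    primePow F n = Metric.closedBall 0 ((residueCard F : ℝ) ^ (-n)) := by
  ext x; simp [mem_primePow]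

lemma isOpen_primePow (n : ℤ) : IsOpen (primePow F n) := by
  rw [primePow_eq_closedBall]
  exact IsUltrametricDist.isOpen_closedBall _ (zpow_pos (residueCard_pos F) _).ne'

lemma isCompact_primePow (n : ℤ) : IsCompact (primePow F n) := by
  rw [primePow_eq_closedBall]; exact isCompact_closedBall _ _

lemma isClosed_primePow (n : ℤ) : IsClosed (primePow F n) := (isCompact_primePow n).isClosed

lemma exists_subset_primePow {s : Set F} (hs : IsCompact s) :
    ∃ n : ℕ, ∀ m : ℤ, m ≤ -n → s ⊆ primePow F m := by
  obtain ⟨r, hr⟩ := hs.isBounded.subset_closedBall 0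
  obtain ⟨n, hn⟩ := pow_unbounded_of_one_lt r (one_lt_residueCard F)
  refine ⟨n, fun m hm x hx => primePow_anti hm ?_⟩
  have := hr hx
  rw [mem_closedBall_zero_iff] at this
  rw [mem_primePow, neg_neg, zpow_natCast]
  exact this.trans hn.le

/-- The set of elements of valuation `n`. -/
def shell (F : Type*) [NontriviallyNormedField F] [IsUltrametricDist F] (n : ℤ) : Set F :=
  {x | ‖x‖ = (residueCard F : ℝ) ^ (-n)}

lemma mem_shell {n : ℤ} {x : F} : x ∈ shell F n ↔ ‖x‖ = (residueCard F : ℝ) ^ (-n) := Iff.rfl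

lemma mem_shell_iff {n : ℤ} {x : F} : x ∈ shell F n ↔ x ∈ primePow F n ∧ x ∉ primePow F (n + 1) :=
  norm_eq_zpow_iff

lemma shell_eq_diff (n : ℤ) : shell F n = primePow F n \ primePow F (n + 1) := by
  ext x; exact mem_shell_iff

lemma shell_subset (n : ℤ) : shell F n ⊆ primePow F n := fun _ h => (mem_shell_iff.1 h).1

lemma isClosed_shell (n : ℤ) : IsClosed (shell F n) := by
  rw [shell_eq_diff]
  exact (isClosed_primePow n).sdiff (isOpen_primePow _)

lemma isOpen_shell (n : ℤ) : IsOpen (shell F n) := by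
  rw [shell_eq_diff]
  exact (isOpen_primePow n).sdiff (isClosed_primePow _)

lemma isCompact_shell (n : ℤ) : IsCompact (shell F n) :=
  (isCompact_primePow n).of_isClosed_subset (isClosed_shell n) (shell_subset n)

lemma ne_zero_of_mem_shell {n : ℤ} {x : F} (h : x ∈ shell F n) : x ≠ 0 := by
  rintro rfl
  rw [mem_shell, norm_zero] at h
  exact (zpow_pos (residueCard_pos F) _).ne h

lemma add_mem_shell_iff {n m : ℤ} (h : n < m) {x y : F} (hy : y ∈ primePow F m) :
    x + y ∈ shell F n ↔ x ∈ shell F n := by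
  rw [mem_shell_iff, mem_shell_iff, add_mem_primePow_iff (primePow_anti h.le hy),
    add_mem_primePow_iff (primePow_anti (by omega) hy)]

lemma mul_mem_shell_iff {n m : ℤ} {x y : F} (hx : x ∈ shell F n) :
    x * y ∈ shell F m ↔ y ∈ shell F (m - n) := by
  rw [mem_shell_iff, mem_shell_iff, mul_mem_primePow_iff hx, mul_mem_primePow_iff hx,
    show m + 1 - n = m - n + 1 by ring]

lemma unif_zpow_mem_shell (n : ℤ) : unif F ^ n ∈ shell F n := norm_unif_zpow F n

lemma exists_mem_shell {x : F} (hx : x ≠ 0) : ∃ n, x ∈ shell F n :=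
  IsNormalizedLocalField.exists_norm_eq x hx

lemma shell_unique {n m : ℤ} {x : F} (h1 : x ∈ shell F n) (h2 : x ∈ shell F m) : n = m := by
  rw [mem_shell] at h1 h2
  rw [h1] at h2
  have := zpow_right_injective₀ (residueCard_pos F) (one_lt_residueCard F).ne' h2
  omega

end Basic

end PadicEpsilon

end

noncomputable section

namespace PadicEpsilon

lemma continuous_indicator_of_isClopen {X : Type*} [TopologicalSpace X] {S : Set X} (hS : IsClopen S)
    {f : X → ℂ} (hf : ContinuousOn f S) : Continuous (S.indicator f) := by
  refine continuous_indicator ?_ (by rwa [hS.isClosed.closure_eq])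
  rw [hS.frontier_eq]
  simp

/-! ### Reduction to the residue field. -/

section Residue

variable {F : Type*} [NontriviallyNormedField F] [IsUltrametricDist F] [IsNormalizedLocalField F]

/-- A lift of a residue class to the field. -/
def resLift (r : Valued.ResidueField F) : F := ((IsLocalRing.residue_surjective r).choose : Valued.integer F)

lemma resLift_mem (r : Valued.ResidueField F) : resLift r ∈ primePow F 0 :=
  mem_primePow_zero.2 (Valued.integer.norm_le_one _)

lemma residue_eq_iff {x y : Valued.integer F} :
    IsLocalRing.residue (Valued.integer F) x = IsLocalRing.residue (Valued.integer F) y ↔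
      (x : F) - y ∈ primePow F 1 := by
  rw [← sub_eq_zero, ← map_sub, IsLocalRing.residue_eq_zero_iff, IsLocalRing.mem_maximalIdeal,
    mem_nonunits_iff, Valued.integer.isUnit_iff_norm_eq_one, mem_primePow_one]
  have := Valued.integer.norm_le_one (x - y)
  change _ ↔ ‖((x - y : Valued.integer F) : F)‖ < 1
  exact ⟨fun h => lt_of_le_of_ne this h, fun h => h.ne⟩

/-- Reduction modulo the maximal ideal (`0` outside the ring of integers). -/
def red (x : F) : Valued.ResidueField F :=
  open Classical in
  if h : x ∈ primePow F 0 then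
    IsLocalRing.residue (Valued.integer F) ⟨x, Valued.integer.mem_iff.2 (mem_primePow_zero.1 h)⟩
  else 0

lemma red_coe (x : Valued.integer F) : red (x : F) = IsLocalRing.residue (Valued.integer F) x := by
  rw [red, dif_pos (mem_primePow_zero.2 (Valued.integer.mem_iff.1 x.2))]

lemma exists_coe_eq {x : F} (hx : x ∈ primePow F 0) : ∃ y : Valued.integer F, (y : F) = x :=
  ⟨⟨x, Valued.integer.mem_iff.2 (mem_primePow_zero.1 hx)⟩, rfl⟩

lemma red_resLift (r : Valued.ResidueField F) : red (resLift r) = r := by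
  rw [resLift, red_coe]; exact (IsLocalRing.residue_surjective r).choose_spec

lemma red_eq_iff {x y : F} (hx : x ∈ primePow F 0) (hy : y ∈ primePow F 0) :
    red x = red y ↔ x - y ∈ primePow F 1 := by
  obtain ⟨x, rfl⟩ := exists_coe_eq hx
  obtain ⟨y, rfl⟩ := exists_coe_eq hy
  rw [red_coe, red_coe, residue_eq_iff]

lemma red_add {x y : F} (hx : x ∈ primePow F 0) (hy : y ∈ primePow F 0) :
    red (x + y) = red x + red y := by
  obtain ⟨x, rfl⟩ := exists_coe_eq hx
  obtain ⟨y, rfl⟩ := exists_coe_eq hy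
  rw [red_coe, red_coe, ← map_add, ← red_coe]; rfl

lemma red_mul {x y : F} (hx : x ∈ primePow F 0) (hy : y ∈ primePow F 0) :
    red (x * y) = red x * red y := by
  obtain ⟨x, rfl⟩ := exists_coe_eq hx
  obtain ⟨y, rfl⟩ := exists_coe_eq hy
  rw [red_coe, red_coe, ← map_mul, ← red_coe]; rfl

lemma red_zero : red (0 : F) = 0 := by
  have := red_coe (0 : Valued.integer F)
  rwa [map_zero] at this

lemma red_one : red (1 : F) = 1 := by
  have := red_coe (1 : Valued.integer F)
  rwa [map_one] at this

lemma red_neg {x : F} (hx : x ∈ primePow F 0) : red (-x) = -red x := by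
  obtain ⟨x, rfl⟩ := exists_coe_eq hx
  rw [red_coe, ← map_neg, ← red_coe]; rfl

lemma red_eq_zero_iff {x : F} (hx : x ∈ primePow F 0) : red x = 0 ↔ x ∈ primePow F 1 := by
  rw [← red_zero, red_eq_iff hx (zero_mem_primePow 0), sub_zero]

lemma red_ne_zero_iff {x : F} (hx : x ∈ primePow F 0) : red x ≠ 0 ↔ x ∈ shell F 0 := by
  rw [ne_eq, red_eq_zero_iff hx, mem_shell_iff]; simp [hx]

end Residue

/-! ### Haar measure of fractional ideals and integrals over cosets. -/

section Measure

variable {F : Type*} [NontriviallyNormedField F] [IsUltrametricDist F] [IsNormalizedLocalField F]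
  [MeasurableSpace F] [BorelSpace F] {μ : Measure F} [μ.IsAddHaarMeasure]

lemma measurableSet_primePow (n : ℤ) : MeasurableSet (primePow F n) :=
  (isClosed_primePow n).measurableSet

lemma measurableSet_shell (n : ℤ) : MeasurableSet (shell F n) := (isClosed_shell n).measurableSet

lemma isClopen_primePow (n : ℤ) : IsClopen (primePow F n) := ⟨isClosed_primePow n, isOpen_primePow n⟩

lemma isClopen_shell (n : ℤ) : IsClopen (shell F n) := ⟨isClosed_shell n, isOpen_shell n⟩

variable (μ) in
lemma measureReal_primePow_pos (n : ℤ) : 0 < μ.real (primePow F n) := by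
  refine ENNReal.toReal_pos ?_ (isCompact_primePow n).measure_lt_top.ne
  exact ((isOpen_primePow n).measure_pos μ ⟨0, zero_mem_primePow n⟩).ne'

lemma setIntegral_comp_add {S T : Set F} (hS : MeasurableSet S) (hT : MeasurableSet T) (a : F)
    (h : ∀ x, x + a ∈ T ↔ x ∈ S) (f : F → ℂ) : ∫ x in S, f (x + a) ∂μ = ∫ x in T, f x ∂μ := by
  rw [← integral_indicator hS, ← integral_indicator hT, ← integral_add_right_eq_self (T.indicator f) a]
  congr 1 with x
  by_cases hx : x ∈ S
  · rw [Set.indicator_of_mem hx, Set.indicator_of_mem ((h x).2 hx)]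
  · rw [Set.indicator_of_notMem hx, Set.indicator_of_notMem (mt (h x).1 hx)]

/-- Translation invariance makes the integral equal to `w` times itself. Together with its
multiplicative analogue, this is the source of most vanishing statements below. -/
lemma setIntegral_eq_zero_of_add {S : Set F} (hS : MeasurableSet S) {a : F} {w : ℂ} (hw : w ≠ 1)
    (h : ∀ x, x + a ∈ S ↔ x ∈ S) {f : F → ℂ} (hf : ∀ x ∈ S, f (x + a) = w * f x) :
    ∫ x in S, f x ∂μ = 0 := by
  have h1 := setIntegral_comp_add (μ := μ) hS hS a h f
  rw [setIntegral_congr_fun hS hf, integral_const_mul] at h1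
  have h2 : (w - 1) * ∫ x in S, f x ∂μ = 0 := by rw [sub_mul, h1, one_mul, sub_self]
  exact (mul_eq_zero.1 h2).resolve_left (sub_ne_zero.2 hw)

lemma setIntegral_coset (a : F) (n : ℤ) {f : F → ℂ} (hf : ∀ y ∈ primePow F n, f (a + y) = f a) :
    IntegrableOn f {x | x - a ∈ primePow F n} μ ∧
      ∫ x in {x | x - a ∈ primePow F n}, f x ∂μ = μ.real (primePow F n) * f a := by
  have hT : MeasurableSet {x | x - a ∈ primePow F n} :=
    (measurable_id.sub_const a) (measurableSet_primePow n)
  have hfT : Set.EqOn f (fun _ => f a) {x | x - a ∈ primePow F n} := fun x hx => by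
    have := hf (x - a) hx
    rwa [add_sub_cancel] at this
  have hμT : μ {x | x - a ∈ primePow F n} = μ (primePow F n) := by
    have := measure_preimage_add_right μ (-a) (primePow F n)
    simp only [← sub_eq_add_neg] at this
    exact this
  refine ⟨(integrableOn_congr_fun hfT hT).2 (integrableOn_const ?_), ?_⟩
  · rw [hμT]; exact (isCompact_primePow n).measure_lt_top.ne
  · rw [setIntegral_congr_fun hT hfT, setIntegral_const, Complex.real_smul, Measure.real, hμT, Measure.real]

variable [Fintype (Valued.ResidueField F)]

lemma setIntegral_primePow_eq_sum (n : ℤ) {f : F → ℂ}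
    (hf : ∀ x ∈ primePow F n, ∀ y ∈ primePow F (n + 1), f (x + y) = f x) :
    ∫ x in primePow F n, f x ∂μ =
      μ.real (primePow F (n + 1)) * ∑ r : Valued.ResidueField F, f (unif F ^ n * resLift r) := by
  have hϖ := unif_zpow_mem_shell (F := F) n
  have hmem : ∀ r : Valued.ResidueField F, unif F ^ n * resLift r ∈ primePow F n := fun r => by
    rw [mul_mem_primePow_iff hϖ, sub_self]; exact resLift_mem r
  have hcov : primePow F n =
      ⋃ r : Valued.ResidueField F, {x | x - unif F ^ n * resLift r ∈ primePow F (n + 1)} := by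
    ext x
    rw [Set.mem_iUnion]
    constructor
    · intro hx
      have hx' : (unif F ^ n)⁻¹ * x ∈ primePow F 0 := by
        have h1 := mul_mem_primePow_iff (m := n) (y := (unif F ^ n)⁻¹ * x) hϖ
        rw [mul_inv_cancel_left₀ (zpow_ne_zero _ (unif_ne_zero F)), sub_self] at h1
        exact h1.1 hx
      refine ⟨red ((unif F ^ n)⁻¹ * x), ?_⟩
      have h2 := (red_eq_iff hx' (resLift_mem _)).1 (red_resLift (red ((unif F ^ n)⁻¹ * x))).symm
      have h3 := (mul_mem_primePow_iff (m := n + 1) hϖ).2 (by rwa [add_sub_cancel_left])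
      rwa [mul_sub, mul_inv_cancel_left₀ (zpow_ne_zero _ (unif_ne_zero F))] at h3
    · rintro ⟨r, hr⟩
      have := add_mem_primePow (primePow_anti (by omega) hr) (hmem r)
      rwa [sub_add_cancel] at this
  have hdisj : Pairwise (Function.onFun Disjoint fun r : Valued.ResidueField F =>
      {x | x - unif F ^ n * resLift r ∈ primePow F (n + 1)}) := by
    intro r s hrs
    rw [Function.onFun, Set.disjoint_left]
    intro x hr hs
    apply hrs
    have h1 := sub_mem_primePow hs hr
    rw [sub_sub_sub_cancel_left, ← mul_sub, mul_mem_primePow_iff hϖ, add_sub_cancel_left,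
      ← red_eq_iff (resLift_mem r) (resLift_mem s), red_resLift, red_resLift] at h1
    exact h1
  rw [hcov, integral_iUnion_fintype _ hdisj, Finset.mul_sum]
  · exact Finset.sum_congr rfl fun r _ => (setIntegral_coset _ _ (hf _ (hmem r))).2
  · exact fun r => (setIntegral_coset _ _ (hf _ (hmem r))).1
  · exact fun r => (measurable_id.sub_const _) (measurableSet_primePow _)

omit [Fintype (Valued.ResidueField F)] in
variable (μ) in
lemma measureReal_primePow_succ (n : ℤ) :
    μ.real (primePow F n) = residueCard F * μ.real (primePow F (n + 1)) := by
  have := Fintype.ofFinite (Valued.ResidueField F)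
  have h := setIntegral_primePow_eq_sum (μ := μ) n (f := fun _ => 1) (by simp)
  rw [setIntegral_const, Finset.sum_const, Finset.card_univ, ← Nat.card_eq_fintype_card] at h
  simp only [Complex.real_smul, mul_one, nsmul_eq_mul] at h
  rw [mul_comm, residueCard]
  exact_mod_cast h

end Measure

/-! ### Multiplicative changes of variable and vanishing by cosets. -/

section Scaling

variable {F : Type*} [NontriviallyNormedField F] [IsUltrametricDist F] [IsNormalizedLocalField F]
  [MeasurableSpace F] [BorelSpace F] {μ : Measure F} [μ.IsAddHaarMeasure]

variable (μ) in
lemma measureReal_primePow (n : ℤ) :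
    μ.real (primePow F n) = (residueCard F : ℝ) ^ (-n) * μ.real (primePow F 0) := by
  have hq := (residueCard_pos F).ne'
  induction n using Int.induction_on with
  | zero => simp
  | succ n ih =>
    have := measureReal_primePow_succ μ (F := F) n
    rw [ih] at this
    rw [neg_add, zpow_add₀ hq, zpow_neg_one]
    field_simp
    rw [mul_comm, ← this]
  | pred n ih =>
    have := measureReal_primePow_succ μ (F := F) (-n - 1)
    rw [sub_add_cancel, ih] at this
    rw [this, neg_sub, sub_neg_eq_add, neg_neg, zpow_add₀ hq, zpow_one, mul_assoc]

open scoped Pointwise in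
-- Multiplication by `u` of valuation `n` carries `𝔭 ^ 0` onto `𝔭 ^ n`, whose relative volume is `q
-- ^ (-n) = ‖u‖`.
lemma distribHaarChar_eq_norm (u : Fˣ) : (distribHaarChar F u : ℝ) = ‖(u : F)‖ := by
  obtain ⟨n, hn⟩ := exists_mem_shell u.ne_zero
  have hset : u • primePow F 0 = primePow F n := by
    ext x
    rw [Set.mem_smul_set]
    constructor
    · rintro ⟨y, hy, rfl⟩
      exact (mul_mem_primePow_iff hn).2 (by rwa [sub_self])
    · intro hx
      refine ⟨u⁻¹ • x, ?_, smul_inv_smul u x⟩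
      have := (mul_mem_primePow_iff (m := n) (y := (u⁻¹ : Fˣ) • x) hn).1 (by
        rw [Units.smul_def, smul_eq_mul, Units.mul_inv_cancel_left]; exact hx)
      rwa [sub_self] at this
  have h := distribHaarChar_mul (Measure.addHaar : Measure F) u (primePow F 0)
  rw [hset] at h
  have h' := congrArg ENNReal.toReal h
  rw [ENNReal.toReal_mul, ENNReal.coe_toReal] at h'
  change _ * Measure.real _ _ = Measure.real _ _ at h'
  rw [measureReal_primePow _ n] at h'
  rw [mem_shell.1 hn]
  exact mul_right_cancel₀ (measureReal_primePow_pos _ 0).ne' h'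

open scoped Pointwise in
lemma map_mul_left {a : F} (ha : a ≠ 0) :
    μ.map (fun x => a * x) = ENNReal.ofReal ‖a‖⁻¹ • μ := by
  ext s hs
  have hme : Measurable fun x : F => a * x := (continuous_const_mul a).measurable
  rw [Measure.map_apply hme hs, Measure.smul_apply, smul_eq_mul]
  have h := distribHaarChar_mul μ (Units.mk0 a ha)⁻¹ s
  have hset : (Units.mk0 a ha)⁻¹ • s = (fun x => a * x) ⁻¹' s := by
    ext x
    rw [Set.mem_inv_smul_set_iff, Set.mem_preimage]; rfl
  rw [← hset, ← h]
  congr 1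
  rw [← ENNReal.ofReal_coe_nnreal, distribHaarChar_eq_norm]
  simp

lemma integral_comp_mul {a : F} (ha : a ≠ 0) (f : F → ℂ) :
    ∫ x, f (a * x) ∂μ = (‖a‖⁻¹ : ℝ) * ∫ x, f x ∂μ := by
  have hemb : MeasurableEmbedding fun x : F => a * x :=
    (Homeomorph.mulLeft₀ a ha).measurableEmbedding
  rw [← hemb.integral_map, map_mul_left ha, integral_smul_measure,
    ENNReal.toReal_ofReal (by positivity), Complex.real_smul]

lemma setIntegral_comp_mul {S T : Set F} (hS : MeasurableSet S) (hT : MeasurableSet T) {a : F}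
    (ha : a ≠ 0) (h : ∀ x, a * x ∈ T ↔ x ∈ S) (f : F → ℂ) :
    ∫ x in S, f (a * x) ∂μ = (‖a‖⁻¹ : ℝ) * ∫ x in T, f x ∂μ := by
  rw [← integral_indicator hS, ← integral_indicator hT, ← integral_comp_mul ha]
  congr 1 with x
  by_cases hx : x ∈ S
  · rw [Set.indicator_of_mem hx, Set.indicator_of_mem ((h x).2 hx)]
  · rw [Set.indicator_of_notMem hx, Set.indicator_of_notMem (mt (h x).1 hx)]

lemma setIntegral_eq_zero_of_mul {S : Set F} (hS : MeasurableSet S) {u : F} (hu : ‖u‖ = 1) {w : ℂ}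
    (hw : w ≠ 1) (h : ∀ x, u * x ∈ S ↔ x ∈ S) {f : F → ℂ} (hf : ∀ x ∈ S, f (u * x) = w * f x) :
    ∫ x in S, f x ∂μ = 0 := by
  have hu0 : u ≠ 0 := by rw [← norm_pos_iff, hu]; exact one_pos
  have h1 := setIntegral_comp_mul (μ := μ) hS hS hu0 h f
  rw [setIntegral_congr_fun hS hf, integral_const_mul, hu] at h1
  simp only [inv_one, Complex.ofReal_one, one_mul] at h1
  have h2 : (w - 1) * ∫ x in S, f x ∂μ = 0 := by rw [sub_mul, h1, one_mul, sub_self]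
  exact (mul_eq_zero.1 h2).resolve_left (sub_ne_zero.2 hw)

/-- A function whose integrals over all cosets of `𝔭 ^ n` in `S` vanish has integral `0`. -/
lemma setIntegral_eq_zero_of_cosets {S : Set F} (hS : IsClopen S) (hSc : IsCompact S) (n : ℤ)
    (h : ∀ x, ∀ y ∈ primePow F n, x + y ∈ S ↔ x ∈ S) {f : F → ℂ} (hf : ContinuousOn f S)
    (hz : ∀ x ∈ S, ∫ t in primePow F n, f (x + t) ∂μ = 0) :
    ∫ x in S, f x ∂μ = 0 := by
  have hSm := hS.isClosed.measurableSet
  have hPm := measurableSet_primePow (F := F) n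
  set g : F → F → ℂ := fun t x => (primePow F n).indicator (fun _ => S.indicator f (x + t)) t with hg
  have hgc : Continuous g.uncurry := by
    have h1 : g.uncurry = ((primePow F n) ×ˢ (Set.univ : Set F)).indicator
        (fun z : F × F => S.indicator f (z.2 + z.1)) := by
      ext ⟨t, x⟩
      by_cases ht : t ∈ primePow F n <;> simp [hg, ht, Function.uncurry, Set.indicator]
    rw [h1]
    refine continuous_indicator_of_isClopen ((isClopen_primePow n).prod isClopen_univ) ?_
    exact ((continuous_indicator_of_isClopen hS hf).comp
      (continuous_snd.add continuous_fst)).continuousOn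
  have hgs : HasCompactSupport g.uncurry := by
    refine HasCompactSupport.intro ((isCompact_primePow n).prod hSc) ?_
    rintro ⟨t, x⟩ hx
    by_cases ht : t ∈ primePow F n
    · have hxS : x ∉ S := fun hxS => hx ⟨ht, hxS⟩
      have : x + t ∉ S := mt (h x t ht).1 hxS
      simp [hg, Function.uncurry, Set.indicator_of_mem ht, Set.indicator_of_notMem this]
    · simp [hg, Function.uncurry, Set.indicator_of_notMem ht]
  -- Integrating over `x` first gives `vol(𝔭 ^ n)` times the integral sought, by translation
  -- invariance; integrating over `t` first gives `0` by hypothesis.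
  have key := integral_integral_swap_of_hasCompactSupport hgc hgs (μ := μ) (ν := μ)
  have hl : ∫ t, ∫ x, g t x ∂μ ∂μ = μ.real (primePow F n) * ∫ x in S, f x ∂μ := by
    have h1 : ∀ t, ∫ x, g t x ∂μ = (primePow F n).indicator (fun _ => ∫ x in S, f x ∂μ) t := by
      intro t
      by_cases ht : t ∈ primePow F n
      · simp only [hg, Set.indicator_of_mem ht]
        rw [integral_add_right_eq_self, integral_indicator hSm]
      · simp [hg, Set.indicator_of_notMem ht]
    simp_rw [h1]
    rw [integral_indicator hPm, setIntegral_const, Complex.real_smul]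
  have hr : ∫ x, ∫ t, g t x ∂μ ∂μ = 0 := by
    have h1 : ∀ x, ∫ t, g t x ∂μ = 0 := by
      intro x
      have : ∫ t, g t x ∂μ = ∫ t in primePow F n, S.indicator f (x + t) ∂μ := by
        rw [← integral_indicator hPm]
        rfl
      rw [this]
      by_cases hx : x ∈ S
      · rw [← hz x hx]
        exact setIntegral_congr_fun hPm fun t ht => Set.indicator_of_mem ((h x t ht).2 hx) _
      · rw [setIntegral_congr_fun (g := fun _ => 0) hPm fun t ht =>
          Set.indicator_of_notMem (mt (h x t ht).1 hx) _]
        simp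
    simp [h1]
  rw [hl, hr] at key
  refine (mul_eq_zero.1 key).resolve_left ?_
  exact_mod_cast (measureReal_primePow_pos μ n).ne'

end Scaling

end PadicEpsilon

end

/-! ### Additive characters and their conductors. -/

noncomputable section

namespace PadicEpsilon

/-- There are no small subgroups: near `1`, squaring increases the distance to `1` by a factor of at
least `3/2`. This gives both additive and multiplicative characters a conductor. -/
lemma eq_one_of_norm_pow_sub_one_le {z : ℂ} (h : ∀ k : ℕ, ‖z ^ k - 1‖ ≤ 1 / 2) : z = 1 := by
  have h1 : ∀ j : ℕ, (3 / 2 : ℝ) ^ j * ‖z - 1‖ ≤ ‖z ^ 2 ^ j - 1‖ := by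
    intro j
    induction j with
    | zero => simp
    | succ j ih =>
      have h2 : z ^ 2 ^ (j + 1) - 1 = (z ^ 2 ^ j - 1) * (z ^ 2 ^ j + 1) := by
        rw [pow_succ, pow_mul]; ring
      have h3 : (3 / 2 : ℝ) ≤ ‖z ^ 2 ^ j + 1‖ := by
        have h4 := norm_sub_norm_le (2 : ℂ) (-(z ^ 2 ^ j - 1))
        rw [norm_neg, show (2 : ℂ) - -(z ^ 2 ^ j - 1) = z ^ 2 ^ j + 1 by ring] at h4
        have h5 := h (2 ^ j)
        have h6 : ‖(2 : ℂ)‖ = 2 := by simp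
        linarith
      rw [h2, norm_mul, pow_succ]
      nlinarith [norm_nonneg (z - 1), norm_nonneg (z ^ 2 ^ j - 1)]
  by_contra hne
  have hpos : 0 < ‖z - 1‖ := norm_pos_iff.2 (sub_ne_zero.2 hne)
  obtain ⟨j, hj⟩ := pow_unbounded_of_one_lt (1 / ‖z - 1‖) (show (1 : ℝ) < 3 / 2 by norm_num)
  have h2 := (h1 j).trans (h (2 ^ j))
  rw [div_lt_iff₀ hpos] at hj
  linarith

section AdditiveCharacters

variable {F : Type*} [NontriviallyNormedField F] [IsUltrametricDist F] [IsNormalizedLocalField F]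
  {ψ : AddChar F ℂ}

lemma nsmul_mem_primePow {n : ℤ} {x : F} (hx : x ∈ primePow F n) (k : ℕ) : k • x ∈ primePow F n := by
  induction k with
  | zero => simpa using zero_mem_primePow n
  | succ k ih => rw [succ_nsmul]; exact add_mem_primePow ih hx

/-- The infimum in `ℤ` is meaningful only for a nonempty set bounded below: continuity gives the
former, nontriviality the latter. -/
lemma condAdd_spec (hψc : Continuous ψ) (hψ : ψ ≠ 1) :
    (∀ x ∈ primePow F (condAdd ψ), ψ x = 1) ∧
      ∀ n, (∀ x ∈ primePow F n, ψ x = 1) → condAdd ψ ≤ n := by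
  obtain ⟨x₀, hx₀⟩ := AddChar.ne_one_iff.1 hψ
  obtain ⟨n₀, hn₀⟩ := exists_mem_primePow x₀
  have hbdd : BddBelow {n : ℤ | ∀ x ∈ primePow F n, ψ x = 1} := by
    refine ⟨n₀, fun n hn => ?_⟩
    by_contra hlt
    exact hx₀ (hn x₀ (primePow_anti (by omega) hn₀))
  have hne : {n : ℤ | ∀ x ∈ primePow F n, ψ x = 1}.Nonempty := by
    have h1 := Metric.continuous_iff.1 hψc 0 (1 / 2) (by norm_num)
    obtain ⟨δ, hδ, h2⟩ := h1
    obtain ⟨n, hn⟩ := exists_primePow_subset_ball (F := F) hδ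
    refine ⟨n, fun x hx => eq_one_of_norm_pow_sub_one_le fun k => ?_⟩
    have h3 := h2 (k • x) (by simpa using hn n le_rfl (nsmul_mem_primePow hx k))
    rw [AddChar.map_nsmul_eq_pow, AddChar.map_zero_eq_one, dist_eq_norm] at h3
    exact h3.le
  exact ⟨Int.csInf_mem hne hbdd, fun n hn => csInf_le hbdd hn⟩

lemma map_eq_one_of_mem (hψc : Continuous ψ) (hψ : ψ ≠ 1) {n : ℤ} (hn : condAdd ψ ≤ n) {x : F}
    (hx : x ∈ primePow F n) : ψ x = 1 := (condAdd_spec hψc hψ).1 x (primePow_anti hn hx)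

lemma exists_map_ne_one_of_lt (hψc : Continuous ψ) (hψ : ψ ≠ 1) {n : ℤ} (hn : n < condAdd ψ) :
    ∃ x ∈ primePow F n, ψ x ≠ 1 := by
  by_contra! h
  exact absurd ((condAdd_spec hψc hψ).2 n h) (by omega)

/-- With `map_mul_eq_one`, this says that the annihilator of `𝔭 ^ a` under the pairing `ψ(x y)` is
`𝔭 ^ (e(ψ) - a)`. -/
lemma exists_map_mul_ne_one (hψc : Continuous ψ) (hψ : ψ ≠ 1) {a : ℤ} {b : F}
    (hb : b ∉ primePow F (condAdd ψ - a)) : ∃ y ∈ primePow F a, ψ (b * y) ≠ 1 := by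
  have hb0 : b ≠ 0 := by rintro rfl; exact hb (zero_mem_primePow _)
  obtain ⟨n, hn⟩ := exists_mem_shell hb0
  have hlt : n + a < condAdd ψ := by
    by_contra h
    exact hb (primePow_anti (by omega) (shell_subset n hn))
  obtain ⟨x, hx, hψx⟩ := exists_map_ne_one_of_lt hψc hψ hlt
  refine ⟨b⁻¹ * x, ?_, by rwa [mul_inv_cancel_left₀ hb0]⟩
  have := mul_mem_primePow_iff (m := n + a) (y := b⁻¹ * x) hn
  rw [mul_inv_cancel_left₀ hb0, add_sub_cancel_left] at this
  exact this.1 hx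

lemma map_mul_eq_one (hψc : Continuous ψ) (hψ : ψ ≠ 1) {a : ℤ} {b y : F}
    (hb : b ∈ primePow F (condAdd ψ - a)) (hy : y ∈ primePow F a) : ψ (b * y) = 1 :=
  map_eq_one_of_mem hψc hψ (le_refl _) (mul_mem_primePow_le (by omega) hb hy)

variable [MeasurableSpace F] [BorelSpace F] {μ : Measure F} [μ.IsAddHaarMeasure]

lemma setIntegral_addChar (hψc : Continuous ψ) (hψ : ψ ≠ 1) (a : ℤ) (b : F) [Decidable (b ∈ primePow F (condAdd ψ - a))] :
    ∫ y in primePow F a, ψ (b * y) ∂μ =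
      if b ∈ primePow F (condAdd ψ - a) then (μ.real (primePow F a) : ℂ) else 0 := by
  split_ifs with hb
  · rw [setIntegral_congr_fun (g := fun _ => (1 : ℂ)) (measurableSet_primePow a) fun y hy =>
      map_mul_eq_one hψc hψ hb hy, setIntegral_const]
    simp
  · obtain ⟨y, hy, hψy⟩ := exists_map_mul_ne_one hψc hψ hb
    refine setIntegral_eq_zero_of_add (measurableSet_primePow a) hψy
      (fun x => add_mem_primePow_iff hy) fun x _ => ?_
    rw [mul_add, AddChar.map_add_eq_mul, mul_comm]

end AdditiveCharacters

/-! ### Schwartz functions, Fourier inversion and the self-dual measure. -/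

section Schwartz

variable {F : Type*} [NontriviallyNormedField F] [IsUltrametricDist F] [IsNormalizedLocalField F]

/-- A Lebesgue number for the cover of a compact ball by fibres of `φ` makes local constancy
uniform. -/
lemma isSchwartz_iff {φ : F → ℂ} : IsSchwartz φ ↔
    ∃ m n : ℤ, (∀ x, x ∉ primePow F m → φ x = 0) ∧ ∀ x, ∀ y ∈ primePow F n, φ (x + y) = φ x := by
  constructor
  · rintro ⟨hl, hc⟩
    obtain ⟨m, hm⟩ := exists_subset_primePow hc
    have hm' := hm (-m) le_rfl
    have hzero : ∀ x, x ∉ primePow F (-m) → φ x = 0 := fun x hx =>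
      image_eq_zero_of_notMem_tsupport fun h => hx (hm' h)
    obtain ⟨δ, hδ, hball⟩ := lebesgue_number_lemma_of_metric (isCompact_primePow (F := F) (-m))
      (c := fun v : ℂ => φ ⁻¹' {v}) (fun v => hl.isOpen_fiber v) fun x _ =>
        Set.mem_iUnion.2 ⟨φ x, rfl⟩
    obtain ⟨n, hn⟩ := exists_primePow_subset_ball (F := F) hδ
    refine ⟨-m, n, hzero, fun x y hy => ?_⟩
    have hym : y ∈ primePow F (-m) := primePow_anti (by omega) hy
    by_cases hx : x ∈ primePow F (-m)
    · obtain ⟨v, hv⟩ := hball x hx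
      have h1 : φ x = v := hv (Metric.mem_ball_self hδ)
      have h2 : φ (x + y) = v := hv (by simpa [Metric.mem_ball, dist_eq_norm] using hn n le_rfl hy)
      rw [h1, h2]
    · rw [hzero x hx, hzero _ (mt (add_mem_primePow_iff hym).1 hx)]
  · rintro ⟨m, n, hm, hn⟩
    refine ⟨(IsLocallyConstant.iff_exists_open φ).2 fun x => ?_,
      HasCompactSupport.intro (isCompact_primePow m) hm⟩
    refine ⟨(fun z => z - x) ⁻¹' primePow F n, (isOpen_primePow n).preimage (continuous_sub_right x),
      by simpa using zero_mem_primePow n, fun z hz => ?_⟩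
    have := hn x (z - x) hz
    rwa [add_sub_cancel] at this

lemma IsSchwartz.continuous {φ : F → ℂ} (h : IsSchwartz φ) : Continuous φ := h.1.continuous

variable [MeasurableSpace F] [BorelSpace F] {μ : Measure F} [μ.IsAddHaarMeasure] {ψ : AddChar F ℂ}

lemma fourierWith_eq_zero (hψc : Continuous ψ) (hψ : ψ ≠ 1) {φ : F → ℂ} {n : ℤ}
    (hn : ∀ x, ∀ y ∈ primePow F n, φ (x + y) = φ x) {x : F} (hx : x ∉ primePow F (condAdd ψ - n)) :
    fourierWith μ ψ φ x = 0 := by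
  obtain ⟨y, hy, hψy⟩ := exists_map_mul_ne_one hψc hψ hx
  rw [fourierWith, ← setIntegral_univ]
  refine setIntegral_eq_zero_of_add (a := y) MeasurableSet.univ hψy (by simp) fun z _ => ?_
  rw [hn z y hy, mul_add, AddChar.map_add_eq_mul]; ring

lemma fourierWith_add (hψc : Continuous ψ) (hψ : ψ ≠ 1) {φ : F → ℂ} {m : ℤ}
    (hm : ∀ x, x ∉ primePow F m → φ x = 0) (x : F) {z : F} (hz : z ∈ primePow F (condAdd ψ - m)) :
    fourierWith μ ψ φ (x + z) = fourierWith μ ψ φ x := by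
  refine integral_congr_ae (Eventually.of_forall fun y => ?_)
  by_cases hy : y ∈ primePow F m
  · simp only [add_mul, AddChar.map_add_eq_mul, map_mul_eq_one hψc hψ hz hy, mul_one]
  · simp [hm y hy]

lemma IsSchwartz.fourierWith (hψc : Continuous ψ) (hψ : ψ ≠ 1) {φ : F → ℂ} (h : IsSchwartz φ) :
    IsSchwartz (fourierWith μ ψ φ) := by
  obtain ⟨m, n, hm, hn⟩ := isSchwartz_iff.1 h
  exact isSchwartz_iff.2 ⟨_, _, fun x hx => fourierWith_eq_zero hψc hψ hn hx,
    fun x y hy => fourierWith_add hψc hψ hm x hy⟩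

/-- Inversion for an arbitrary Haar measure. The transform of `φ` lives on `𝔭 ^ (e - n)`; after
interchanging integrals, the kernel is `vol(𝔭 ^ (e - n))` times the indicator of `-x + 𝔭 ^ n`, where
`φ` is constant. The product of the two volumes is the constant. -/
lemma fourierWith_fourierWith (hψc : Continuous ψ) (hψ : ψ ≠ 1) {φ : F → ℂ} (h : IsSchwartz φ)
    (x : F) : PadicEpsilon.fourierWith μ ψ (PadicEpsilon.fourierWith μ ψ φ) x =
      ((μ.real (primePow F 0) ^ 2 * (residueCard F : ℝ) ^ (-condAdd ψ) : ℝ) : ℂ) * φ (-x) := by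
  classical
  obtain ⟨m, n, hm, hn⟩ := isSchwartz_iff.1 h
  set e := condAdd ψ
  set P := primePow F (e - n) with hP
  have hPm : MeasurableSet P := measurableSet_primePow _
  set g : F → F → ℂ := fun y z => P.indicator (fun y => φ z * ψ (y * z) * ψ (x * y)) y with hg
  have h1 : PadicEpsilon.fourierWith μ ψ (PadicEpsilon.fourierWith μ ψ φ) x =
      ∫ y, ∫ z, g y z ∂μ ∂μ := by
    refine integral_congr_ae (Eventually.of_forall fun y => ?_)
    by_cases hy : y ∈ P
    · simp only [hg, Set.indicator_of_mem hy]
      rw [integral_mul_const]; rfl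
    · simp [hg, Set.indicator_of_notMem hy, fourierWith_eq_zero hψc hψ hn hy]
  have hgc : Continuous g.uncurry := by
    have h2 : g.uncurry = (P ×ˢ (Set.univ : Set F)).indicator
        (fun w : F × F => φ w.2 * ψ (w.1 * w.2) * ψ (x * w.1)) := by
      ext ⟨y, z⟩
      by_cases hy : y ∈ P <;> simp [hg, hy, Function.uncurry, Set.indicator]
    rw [h2]
    refine continuous_indicator_of_isClopen ((isClopen_primePow _).prod isClopen_univ) ?_
    have hφ := h.continuous
    fun_prop
  have hgs : HasCompactSupport g.uncurry := by
    refine HasCompactSupport.intro ((isCompact_primePow (e - n)).prod (isCompact_primePow m)) ?_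
    rintro ⟨y, z⟩ hx
    by_cases hy : y ∈ P
    · have hz : z ∉ primePow F m := fun hz => hx ⟨hy, hz⟩
      simp [hg, Function.uncurry, Set.indicator_of_mem hy, hm z hz]
    · simp [hg, Function.uncurry, Set.indicator_of_notMem hy]
  rw [h1, integral_integral_swap_of_hasCompactSupport hgc hgs]
  have h2 : ∀ z, ∫ y, g y z ∂μ = {z | z - -x ∈ primePow F n}.indicator
      (fun z => (μ.real P : ℂ) * φ z) z := by
    intro z
    have h3 : ∀ y, g y z = φ z * P.indicator (fun y => ψ ((z - -x) * y)) y := by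
      intro y
      by_cases hy : y ∈ P
      · simp only [hg, Set.indicator_of_mem hy]
        rw [sub_neg_eq_add, add_mul, AddChar.map_add_eq_mul, mul_comm y z]; ring
      · simp [hg, Set.indicator_of_notMem hy]
    simp_rw [h3]
    rw [integral_const_mul, integral_indicator hPm, hP, setIntegral_addChar hψc hψ, sub_sub_cancel]
    by_cases hz : z - -x ∈ primePow F n
    · rw [if_pos hz, Set.indicator_of_mem (by exact hz), mul_comm]
    · rw [if_neg hz, Set.indicator_of_notMem (by exact hz), mul_zero]
  simp_rw [h2]
  have hT : MeasurableSet {z : F | z - -x ∈ primePow F n} :=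
    (measurable_id.sub_const _) (measurableSet_primePow n)
  rw [integral_indicator hT, integral_const_mul,
    (setIntegral_coset (-x) n fun y hy => hn _ y hy).2, hP, measureReal_primePow μ (e - n),
    measureReal_primePow μ n, ← mul_assoc, ← Complex.ofReal_mul]
  congr 2
  rw [show -e = -(e - n) + -n by ring, zpow_add₀ (residueCard_pos F).ne']
  ring

lemma isSchwartz_indicator (n : ℤ) : IsSchwartz ((primePow F n).indicator fun _ => (1 : ℂ)) := by
  classical
  refine isSchwartz_iff.2 ⟨n, n, fun x hx => Set.indicator_of_notMem hx _, fun x y hy => ?_⟩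
  rw [Set.indicator_apply, Set.indicator_apply, add_mem_primePow_iff hy]

lemma isSelfDual_iff (hψc : Continuous ψ) (hψ : ψ ≠ 1) :
    IsSelfDual ψ μ ↔ μ.real (primePow F 0) ^ 2 = (residueCard F : ℝ) ^ condAdd ψ := by
  have hq := residueCard_pos F
  rw [IsSelfDual, and_iff_right (inferInstance : μ.IsAddHaarMeasure)]
  constructor
  · intro h
    have h1 := h _ (isSchwartz_indicator 0) 0
    rw [fourierWith_fourierWith hψc hψ (isSchwartz_indicator 0), neg_zero,
      Set.indicator_of_mem (zero_mem_primePow 0), mul_one] at h1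
    have h2 : μ.real (primePow F 0) ^ 2 * (residueCard F : ℝ) ^ (-condAdd ψ) = 1 := by
      exact_mod_cast h1
    rwa [zpow_neg, mul_inv_eq_one₀ (zpow_pos hq _).ne'] at h2
  · intro h φ hφ x
    rw [fourierWith_fourierWith hψc hψ hφ, h, ← zpow_add₀ hq.ne', add_neg_cancel]
    simp

variable (ψ) in
-- Since `selfDual` is a choice, existence has to be shown: a Haar measure is rescaled until `vol(𝔭
-- ^ 0)² = q ^ e(ψ)`.
lemma isSelfDual_selfDual (hψc : Continuous ψ) (hψ : ψ ≠ 1) : IsSelfDual ψ (selfDual ψ) := by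
  have hq := residueCard_pos F
  refine Classical.epsilon_spec (p := IsSelfDual ψ) ?_
  set ν : Measure F := Measure.addHaar
  have hν := measureReal_primePow_pos ν (F := F) 0
  set c : ℝ := Real.sqrt ((residueCard F : ℝ) ^ condAdd ψ) / ν.real (primePow F 0)
  have hc : 0 < c := div_pos (Real.sqrt_pos.2 (zpow_pos hq _)) hν
  have hmeas : (ENNReal.ofReal c • ν).IsAddHaarMeasure :=
    Measure.IsAddHaarMeasure.smul ν (by simpa using hc) ENNReal.ofReal_ne_top
  refine ⟨ENNReal.ofReal c • ν, (isSelfDual_iff hψc hψ).2 ?_⟩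
  rw [measureReal_ennreal_smul_apply, ENNReal.toReal_ofReal hc.le, div_mul_cancel₀ _ hν.ne',
    Real.sq_sqrt (zpow_pos hq _).le]

end Schwartz

end PadicEpsilon

end

noncomputable section

namespace PadicEpsilon

/-! ### Multiplicative characters as functions on the field. -/

section Extend

variable {F : Type*} [NontriviallyNormedField F] [IsUltrametricDist F] (χ η : Fˣ →ₜ* ℂˣ)

@[simp] lemma extend_zero : extend χ 0 = 0 := by simp [extend]

variable {χ} in
lemma extend_of_ne_zero {x : F} (hx : x ≠ 0) : extend χ x = χ (Units.mk0 x hx) := by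
  simp [extend, hx]

@[simp] lemma extend_coe (u : Fˣ) : extend χ (u : F) = χ u := by
  rw [extend_of_ne_zero u.ne_zero, Units.mk0_val]

@[simp] lemma extend_one : extend χ (1 : F) = 1 := by
  rw [← Units.val_one, extend_coe]; simp

lemma extend_mul (x y : F) : extend χ (x * y) = extend χ x * extend χ y := by
  by_cases hx : x = 0
  · simp [hx]
  by_cases hy : y = 0
  · simp [hy]
  rw [extend_of_ne_zero hx, extend_of_ne_zero hy, extend_of_ne_zero (mul_ne_zero hx hy),
    ← Units.val_mul, ← map_mul, Units.mk0_mul]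

lemma extend_pow_apply (x : F) (k : ℕ) : extend χ (x ^ k) = extend χ x ^ k := by
  induction k with
  | zero => simp
  | succ k ih => rw [pow_succ, extend_mul, ih, pow_succ]

lemma extend_inv_apply (x : F) : extend χ x⁻¹ = (extend χ x)⁻¹ := by
  by_cases hx : x = 0
  · simp [hx]
  refine eq_inv_of_mul_eq_one_left ?_
  rw [← extend_mul, inv_mul_cancel₀ hx, extend_one]

variable {χ} in
lemma extend_ne_zero {x : F} (hx : x ≠ 0) : extend χ x ≠ 0 := by
  rw [extend_of_ne_zero hx]; exact Units.ne_zero _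

lemma extend_mul_char (x : F) : extend (χ * η) x = extend χ x * extend η x := by
  by_cases hx : x = 0
  · simp [hx]
  simp [extend_of_ne_zero hx]

lemma extend_inv (x : F) : extend χ⁻¹ x = (extend χ x)⁻¹ := by
  by_cases hx : x = 0
  · simp [hx]
  rw [extend_of_ne_zero hx, extend_of_ne_zero hx, ← Units.val_inv_eq_inv_val]; rfl

lemma extend_pow {x : F} (hx : x ≠ 0) (n : ℕ) : extend (χ ^ n) x = extend χ x ^ n := by
  induction n with
  | zero => rw [pow_zero, pow_zero, extend_of_ne_zero hx]; rfl
  | succ n ih => rw [pow_succ, pow_succ, extend_mul_char, ih]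

lemma extend_neg (x : F) : extend χ (-x) = extend χ (-1) * extend χ x := by
  rw [← extend_mul, neg_one_mul]

lemma extend_neg_one_sq : extend χ (-1) ^ 2 = 1 := by
  rw [← extend_pow_apply]; simp

lemma extend_neg_one : extend χ (-1) = (χ (-1) : ℂˣ) := by
  rw [← extend_coe]; simp

lemma continuousOn_extend : ContinuousOn (extend χ) {x : F | x ≠ 0} := by
  rw [continuousOn_iff_continuous_domRestrict]
  have h : Set.domRestrict {x : F | x ≠ 0} (extend χ) =
      fun x => ((χ (unitsHomeomorphNeZero.symm x) : ℂˣ) : ℂ) := by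
    ext x
    rw [Set.domRestrict_apply, extend_of_ne_zero x.2]
    congr 2
    exact Units.ext (congrArg Subtype.val (unitsHomeomorphNeZero.apply_symm_apply x)).symm
  rw [h]
  exact Units.continuous_val.comp ((map_continuous χ).comp unitsHomeomorphNeZero.symm.continuous)

end Extend

/-! ### Conductors of multiplicative characters. -/

section Conductor

variable {F : Type*} [NontriviallyNormedField F] [IsUltrametricDist F] [IsNormalizedLocalField F]
  {χ η : Fˣ →ₜ* ℂˣ}

lemma one_mem_shell : (1 : F) ∈ shell F 0 := by simp [mem_shell]

lemma neg_mem_shell {n : ℤ} {x : F} (h : x ∈ shell F n) : -x ∈ shell F n := by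
  rwa [mem_shell, norm_neg]

lemma mem_shell_of_sub_one_mem {n : ℤ} (hn : 1 ≤ n) {x : F} (hx : x - 1 ∈ primePow F n) :
    x ∈ shell F 0 := by
  have := (add_mem_shell_iff (n := 0) (x := 1) (by omega) hx).2 one_mem_shell
  rwa [add_sub_cancel] at this

lemma continuousOn_extend_shell (χ : Fˣ →ₜ* ℂˣ) (n : ℤ) : ContinuousOn (extend χ) (shell F n) :=
  (continuousOn_extend χ).mono fun _ hx => ne_zero_of_mem_shell hx

lemma isUnramified_iff : IsUnramified χ ↔ ∀ x ∈ shell F 0, extend χ x = 1 := by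
  constructor
  · intro h x hx
    have hx1 : ‖x‖ = 1 := by simpa [mem_shell] using hx
    have hu : IsUnit (⟨x, Valued.integer.mem_iff.2 hx1.le⟩ : Valued.integer F) :=
      Valued.integer.isUnit_iff_norm_eq_one.2 hx1
    obtain ⟨u, hu⟩ := hu
    have h1 := h u
    have h2 : ((unitsIncl u : Fˣ) : F) = x := by
      change ((u : Valued.integer F) : F) = x
      rw [hu]
    rw [← h2, extend_coe, h1]; rfl
  · intro h u
    have := h (unitsIncl u : Fˣ) (by
      have := Valued.integer.norm_coe_unit u
      rw [mem_shell, neg_zero, zpow_zero]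
      exact this)
    rw [extend_coe] at this
    exact Units.ext this

lemma IsRamified.exists_ne_one (h : IsRamified χ) : ∃ x ∈ shell F 0, extend χ x ≠ 1 := by
  by_contra! h1
  exact h (isUnramified_iff.2 h1)

lemma pow_sub_one_mem {n : ℤ} (hn : 0 ≤ n) {x : F} (hx : x - 1 ∈ primePow F n) (k : ℕ) :
    x ^ k - 1 ∈ primePow F n := by
  have h0 : x ∈ primePow F 0 := by
    have := add_mem_primePow (primePow_anti hn hx) (shell_subset 0 (one_mem_shell (F := F)))
    rwa [sub_add_cancel] at this
  induction k with
  | zero => simpa using zero_mem_primePow n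
  | succ k ih =>
    have h1 : x ^ (k + 1) - 1 = (x ^ k - 1) * x + (x - 1) := by ring
    rw [h1]
    exact add_mem_primePow (mul_mem_primePow_le (by omega) ih h0) hx

variable (χ) in
-- Powers of `x` remain in `1 + 𝔭 ^ m`, so all powers of its value stay near `1` and the absence of
-- small subgroups applies.
lemma exists_extend_eq_one : ∃ m : ℕ, 1 ≤ m ∧ ∀ x, x - 1 ∈ primePow F m → extend χ x = 1 := by
  have hc : ContinuousAt (extend χ) 1 :=
    (continuousOn_extend χ).continuousAt (isOpen_ne.mem_nhds one_ne_zero)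
  obtain ⟨δ, hδ, h⟩ := Metric.continuousAt_iff.1 hc (1 / 2) (by norm_num)
  obtain ⟨n, hn⟩ := exists_primePow_subset_ball (F := F) hδ
  refine ⟨n + 1, by omega, fun x hx => eq_one_of_norm_pow_sub_one_le fun k => ?_⟩
  have h1 := pow_sub_one_mem (by positivity) hx k
  have h2 := h (x := x ^ k) (by simpa [dist_eq_norm] using hn _ (by push_cast; omega) h1)
  rw [extend_one, dist_eq_norm, extend_pow_apply] at h2
  exact h2.le

lemma condMul_set_eq (χ : Fˣ →ₜ* ℂˣ) :
    {m : ℕ | 1 ≤ m ∧ ∀ u : Fˣ, (u : F) - 1 ∈ primePow F m → χ u = 1} =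
    {m : ℕ | 1 ≤ m ∧ ∀ x, x - 1 ∈ primePow F m → extend χ x = 1} := by
  ext m
  refine and_congr_right fun hm => ⟨fun h x hx => ?_, fun h u hu => ?_⟩
  · have h0 := ne_zero_of_mem_shell (mem_shell_of_sub_one_mem (by exact_mod_cast hm) hx)
    rw [extend_of_ne_zero h0, h _ hx]; rfl
  · have := h u hu
    rw [extend_coe] at this
    exact Units.ext this

lemma condMul_mem (h : IsRamified χ) :
    condMul χ ∈ {m : ℕ | 1 ≤ m ∧ ∀ x, x - 1 ∈ primePow F m → extend χ x = 1} := by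
  rw [condMul, if_neg h, condMul_set_eq]
  exact Nat.sInf_mem (exists_extend_eq_one χ)

lemma one_le_condMul (h : IsRamified χ) : 1 ≤ condMul χ := (condMul_mem h).1

lemma extend_eq_one (h : IsRamified χ) {n : ℤ} (hn : (condMul χ : ℤ) ≤ n) {x : F}
    (hx : x - 1 ∈ primePow F n) : extend χ x = 1 :=
  (condMul_mem h).2 x (primePow_anti hn hx)

lemma exists_extend_ne_one (h : IsRamified χ) {n : ℤ} (h0 : 0 ≤ n) (hn : n < condMul χ) :
    ∃ x ∈ shell F 0, x - 1 ∈ primePow F n ∧ extend χ x ≠ 1 := by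
  rcases h0.eq_or_lt with rfl | h1
  · obtain ⟨x, hx, hx1⟩ := h.exists_ne_one
    exact ⟨x, hx, sub_mem_primePow (shell_subset 0 hx) (shell_subset 0 one_mem_shell), hx1⟩
  · lift n to ℕ using h0
    by_contra! h2
    have : n ∈ {m : ℕ | 1 ≤ m ∧ ∀ x, x - 1 ∈ primePow F m → extend χ x = 1} :=
      ⟨by omega, fun x hx => h2 x (mem_shell_of_sub_one_mem (by omega) hx) hx⟩
    rw [← condMul_set_eq] at this
    have h3 := Nat.sInf_le this
    rw [condMul, if_neg h] at hn
    omega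

lemma isRamified_of_extend_ne_one {x : F} (hx : x ∈ shell F 0) (h : extend χ x ≠ 1) : IsRamified χ :=
  fun h1 => h (isUnramified_iff.1 h1 x hx)

/-- The conductor exponent only depends on the restriction to the units. -/
lemma condMul_eq_of (h : IsRamified χ) {m : ℕ} (hm : 1 ≤ m)
    (h1 : ∀ x, x - 1 ∈ primePow F m → extend χ x = 1)
    (h2 : ∃ x ∈ shell F 0, x - 1 ∈ primePow F (m - 1 : ℤ) ∧ extend χ x ≠ 1) : condMul χ = m := by
  refine le_antisymm ?_ ?_
  · rw [condMul, if_neg h, condMul_set_eq]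
    exact Nat.sInf_le ⟨hm, h1⟩
  · by_contra hlt
    obtain ⟨x, -, hx1, hx2⟩ := h2
    exact hx2 (extend_eq_one h (by omega) hx1)

lemma isRamified_inv (h : IsRamified χ) : IsRamified χ⁻¹ := by
  obtain ⟨x, hx, hx1⟩ := h.exists_ne_one
  exact isRamified_of_extend_ne_one hx (by rwa [extend_inv, ne_eq, inv_eq_one])

lemma condMul_inv (h : IsRamified χ) : condMul χ⁻¹ = condMul χ := by
  refine condMul_eq_of (isRamified_inv h) (one_le_condMul h) (fun x hx => ?_) ?_
  · rw [extend_inv, extend_eq_one h le_rfl hx, inv_one]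
  · have := one_le_condMul h
    obtain ⟨x, hx, hx1, hx2⟩ := exists_extend_ne_one h (n := condMul χ - 1) (by omega) (by omega)
    exact ⟨x, hx, hx1, by rwa [extend_inv, ne_eq, inv_eq_one]⟩

/-- `χ` is trivial on `1 + 𝔭 ^ m`, so it is constant on the cosets of `𝔭 ^ (n + m)` in a shell. -/
lemma extend_add (h : IsRamified χ) {n k : ℤ} {x y : F} (hx : x ∈ shell F n)
    (hk : n + condMul χ ≤ k) (hy : y ∈ primePow F k) : extend χ (x + y) = extend χ x := by
  have hx0 := ne_zero_of_mem_shell hx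
  have h1 : x + y = x * (1 + x⁻¹ * y) := by rw [mul_add, mul_one, mul_inv_cancel_left₀ hx0]
  have h2 : x⁻¹ * y ∈ primePow F (k - n) := by
    rw [← mul_mem_primePow_iff hx, mul_inv_cancel_left₀ hx0]; exact hy
  have h3 : extend χ (1 + x⁻¹ * y) = 1 :=
    extend_eq_one h (n := k - n) (by omega) (by rwa [add_sub_cancel_left])
  rw [h1, extend_mul, h3, mul_one]

end Conductor

/-! ### Gauss integrals and the functional equation shell by shell. -/

section GaussIntegral

variable {F : Type*} [NontriviallyNormedField F] [IsUltrametricDist F] [IsNormalizedLocalField F]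
  [MeasurableSpace F] [BorelSpace F] {μ : Measure F} [μ.IsAddHaarMeasure]
  {χ : Fˣ →ₜ* ℂˣ} {ψ : AddChar F ℂ}

lemma setIntegral_shell_extend (h : IsRamified χ) (n : ℤ) : ∫ x in shell F n, extend χ x ∂μ = 0 := by
  obtain ⟨u, hu, hu1⟩ := h.exists_ne_one
  refine setIntegral_eq_zero_of_mul (measurableSet_shell n) (by simpa [mem_shell] using hu) hu1
    (fun x => by rw [mul_mem_shell_iff hu, sub_zero]) fun x _ => extend_mul χ u x

/-- The Gauss integrals of a ramified character vanish on all shells but one. -/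
lemma setIntegral_shell_gauss_eq_zero (hψc : Continuous ψ) (hψ : ψ ≠ 1) (h : IsRamified χ) {n : ℤ}
    (hn : n ≠ condAdd ψ - condMul χ) : ∫ x in shell F n, ψ x * extend χ x ∂μ = 0 := by
  have hm := one_le_condMul h
  rcases lt_or_gt_of_ne hn with hlt | hgt
  -- On a shell of larger elements, `χ` is invariant under translation by `𝔭 ^ (e(ψ) - 1)` but `ψ`
  -- is not.
  · obtain ⟨y, hy, hψy⟩ := exists_map_ne_one_of_lt hψc hψ (show condAdd ψ - 1 < condAdd ψ by omega)
    refine setIntegral_eq_zero_of_add (a := y) (measurableSet_shell n) hψy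
      (fun x => add_mem_shell_iff (by omega) hy) fun x hx => ?_
    rw [AddChar.map_add_eq_mul, extend_add h hx (by omega) hy]; ring
  -- On a shell of smaller elements, `ψ` is invariant under multiplication by `1 + 𝔭 ^ (e(χ) - 1)`
  -- but `χ` is not.
  · obtain ⟨u, hu, hu1, hu2⟩ := exists_extend_ne_one h (n := condMul χ - 1) (by omega) (by omega)
    refine setIntegral_eq_zero_of_mul (measurableSet_shell n) (by simpa [mem_shell] using hu) hu2
      (fun x => by rw [mul_mem_shell_iff hu, sub_zero]) fun x hx => ?_
    have h1 : ψ (u * x) = ψ x := by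
      have h2 : u * x = x + (u - 1) * x := by ring
      have h3 : ψ ((u - 1) * x) = 1 := map_eq_one_of_mem hψc hψ (n := condAdd ψ) le_rfl
        (mul_mem_primePow_le (by omega) hu1 (shell_subset n hx))
      rw [h2, AddChar.map_add_eq_mul, h3, mul_one]
    rw [h1, extend_mul]; ring

/-- The Gauss integral `∫ ψ(x) χ⁻¹(x) dx` over the shell of valuation `e(ψ) - e(χ)`. -/
def gaussInt (μ : Measure F) (ψ : AddChar F ℂ) (χ : Fˣ →ₜ* ℂˣ) : ℂ :=
  ∫ x in shell F (condAdd ψ - condMul χ), ψ x * extend χ⁻¹ x ∂μ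

/-- The integral of `φ χ` over a shell. -/
def shellInt (μ : Measure F) (χ : Fˣ →ₜ* ℂˣ) (φ : F → ℂ) (n : ℤ) : ℂ :=
  ∫ x in shell F n, φ x * extend χ x ∂μ

/-- Scaling by `y` gives an untwisted Gauss integral over the shell of valuation `n + v(y)`, which
vanishes except at `e(ψ) - e(χ)`. -/
lemma setIntegral_shell_twisted (hψc : Continuous ψ) (hψ : ψ ≠ 1) (h : IsRamified χ) (n : ℤ) (y : F) :
    ∫ x in shell F n, ψ (x * y) * extend χ⁻¹ x ∂μ =
      (shell F (condAdd ψ - condMul χ - n)).indicator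
        (fun y => ((‖y‖⁻¹ : ℝ) : ℂ) * extend χ y * gaussInt μ ψ χ) y := by
  by_cases hy : y = 0
  · rw [Set.indicator_of_notMem fun h => ne_zero_of_mem_shell h hy]
    simp only [hy, mul_zero, AddChar.map_zero_eq_one, one_mul]
    exact setIntegral_shell_extend (isRamified_inv h) n
  obtain ⟨k, hk⟩ := exists_mem_shell hy
  have h1 := setIntegral_comp_mul (μ := μ) (measurableSet_shell n) (measurableSet_shell (n + k)) hy
    (fun x => by rw [mul_mem_shell_iff hk, add_sub_cancel_right]) fun x => ψ x * extend χ⁻¹ x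
  have h2 : ∫ x in shell F n, ψ (x * y) * extend χ⁻¹ x ∂μ =
      extend χ y * ((‖y‖⁻¹ : ℝ) * ∫ x in shell F (n + k), ψ x * extend χ⁻¹ x ∂μ) := by
    rw [← h1, ← integral_const_mul]
    congr 1 with x
    rw [extend_mul, extend_inv χ y, mul_comm x y]
    field_simp [extend_ne_zero (χ := χ) hy]
  rw [h2]
  by_cases hN : n + k = condAdd ψ - condMul χ
  · rw [Set.indicator_of_mem (by rwa [← hN, add_sub_cancel_left]), hN, gaussInt]; ring
  · rw [setIntegral_shell_gauss_eq_zero hψc hψ (isRamified_inv h) (by rwa [condMul_inv h]),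
      Set.indicator_of_notMem fun h => hN (by have := shell_unique hk h; omega)]
    simp

/-- After interchanging the integrals, the inner one is `setIntegral_shell_twisted`, supported on a
single shell. This is the core of Tate's functional equation. -/
lemma shellInt_fourierWith (hψc : Continuous ψ) (hψ : ψ ≠ 1) (h : IsRamified χ) {φ : F → ℂ}
    (hφ : IsSchwartz φ) (n : ℤ) :
    shellInt μ χ⁻¹ (fourierWith μ ψ φ) n = gaussInt μ ψ χ *
      (residueCard F : ℂ) ^ (condAdd ψ - condMul χ - n) *
        shellInt μ χ φ (condAdd ψ - condMul χ - n) := by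
  obtain ⟨m, -, hm, -⟩ := isSchwartz_iff.1 hφ
  set N := condAdd ψ - condMul χ with hN
  set P := shell F n with hP
  have hPm : MeasurableSet P := measurableSet_shell n
  set g : F → F → ℂ := fun y z => P.indicator (fun y => φ z * (ψ (y * z) * extend χ⁻¹ y)) y with hg
  have h1 : shellInt μ χ⁻¹ (fourierWith μ ψ φ) n = ∫ y, ∫ z, g y z ∂μ ∂μ := by
    rw [shellInt, ← integral_indicator hPm]
    refine integral_congr_ae (Eventually.of_forall fun y => ?_)
    by_cases hy : y ∈ P
    · simp only [hg, Set.indicator_of_mem hy]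
      rw [PadicEpsilon.fourierWith, ← integral_mul_const]
      simp only [mul_assoc]
    · simp [hg, Set.indicator_of_notMem hy]
  have hgc : Continuous g.uncurry := by
    have h2 : g.uncurry = (P ×ˢ (Set.univ : Set F)).indicator
        (fun w : F × F => φ w.2 * (ψ (w.1 * w.2) * extend χ⁻¹ w.1)) := by
      ext ⟨y, z⟩
      by_cases hy : y ∈ P <;> simp [hg, hy, Function.uncurry, Set.indicator]
    rw [h2]
    refine continuous_indicator_of_isClopen ((isClopen_shell _).prod isClopen_univ) ?_
    have hφ := hφ.continuous
    have h3 : ContinuousOn (fun w : F × F => extend χ⁻¹ w.1) (P ×ˢ (Set.univ : Set F)) :=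
      (continuousOn_extend_shell χ⁻¹ n).comp continuousOn_fst fun w hw => hw.1
    exact ContinuousOn.mul (by fun_prop) (ContinuousOn.mul (by fun_prop) h3)
  have hgs : HasCompactSupport g.uncurry := by
    refine HasCompactSupport.intro ((isCompact_shell n).prod (isCompact_primePow m)) ?_
    rintro ⟨y, z⟩ hx
    by_cases hy : y ∈ P
    · have hz : z ∉ primePow F m := fun hz => hx ⟨hy, hz⟩
      simp [hg, Function.uncurry, Set.indicator_of_mem hy, hm z hz]
    · simp [hg, Function.uncurry, Set.indicator_of_notMem hy]
  rw [h1, integral_integral_swap_of_hasCompactSupport hgc hgs]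
  have h2 : ∀ z, ∫ y, g y z ∂μ = (shell F (N - n)).indicator (fun z =>
      gaussInt μ ψ χ * (residueCard F : ℂ) ^ (N - n) * (φ z * extend χ z)) z := by
    intro z
    have h3 : ∀ y, g y z = φ z * P.indicator (fun y => ψ (y * z) * extend χ⁻¹ y) y := by
      intro y
      by_cases hy : y ∈ P
      · simp only [hg, Set.indicator_of_mem hy]
      · simp [hg, Set.indicator_of_notMem hy]
    simp_rw [h3]
    rw [integral_const_mul, integral_indicator hPm, hP, setIntegral_shell_twisted hψc hψ h]
    by_cases hz : z ∈ shell F (N - n)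
    · rw [Set.indicator_of_mem hz, Set.indicator_of_mem hz, mem_shell.1 hz, ← zpow_neg, neg_neg]
      push_cast; ring
    · rw [Set.indicator_of_notMem hz, Set.indicator_of_notMem hz, mul_zero]
  simp_rw [h2]
  rw [integral_indicator (measurableSet_shell _), integral_const_mul, shellInt]

end GaussIntegral

end PadicEpsilon

end

noncomputable section

namespace PadicEpsilon

/-! ### Zeta integrals of ramified characters. -/

section Zeta

variable {F : Type*} [NontriviallyNormedField F] [IsUltrametricDist F] [IsNormalizedLocalField F]
  [MeasurableSpace F] [BorelSpace F] {μ : Measure F} [μ.IsAddHaarMeasure]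
  {χ : Fˣ →ₜ* ℂˣ} {ψ : AddChar F ℂ} {φ : F → ℂ}

omit [MeasurableSpace F] [BorelSpace F] in
variable (F) in
lemma residueCard_ne_zero : (residueCard F : ℂ) ≠ 0 := by
  exact_mod_cast (residueCard_pos F).ne'

omit [MeasurableSpace F] [BorelSpace F] in
lemma norm_cpow_mul_inv {n : ℤ} {x : F} (hx : x ∈ shell F n) (s : ℂ) :
    (‖x‖ : ℂ) ^ s * (‖x‖ : ℂ)⁻¹ = (residueCard F : ℂ) ^ ((n : ℂ) * (1 - s)) := by
  have hq := residueCard_pos F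
  have h0 : (‖x‖ : ℂ) ≠ 0 := by
    exact_mod_cast (norm_pos_iff.2 (ne_zero_of_mem_shell hx)).ne'
  rw [← Complex.cpow_neg_one, ← Complex.cpow_add _ _ h0, Complex.cpow_def_of_ne_zero h0,
    Complex.cpow_def_of_ne_zero (residueCard_ne_zero F), ← Complex.ofReal_log (norm_nonneg x),
    mem_shell.1 hx, Real.log_zpow, ← Complex.ofReal_natCast, ← Complex.ofReal_log hq.le]
  congr 1
  push_cast
  ring

lemma shellInt_eq_zero_of_lt {a n : ℤ} (ha : ∀ x, x ∉ primePow F a → φ x = 0) (hn : n < a) :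
    shellInt μ χ φ n = 0 := by
  rw [shellInt, setIntegral_congr_fun (g := fun _ => 0) (measurableSet_shell n) fun x hx => ?_]
  · simp
  · have : φ x = 0 := ha x fun h => (mem_shell_iff.1 hx).2 (primePow_anti (by omega) h)
    simp only [this, zero_mul]

/-- Close to `0` the function `φ` is constant, and a ramified character integrates to `0` over a
shell. Hence only finitely many shells contribute, and the zeta function is entire. -/
lemma shellInt_eq_zero_of_le (h : IsRamified χ) {b n : ℤ}
    (hb : ∀ x, ∀ y ∈ primePow F b, φ (x + y) = φ x) (hn : b ≤ n) : shellInt μ χ φ n = 0 := by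
  rw [shellInt, setIntegral_congr_fun (g := fun x => φ 0 * extend χ x) (measurableSet_shell n)
    fun x hx => ?_, integral_const_mul, setIntegral_shell_extend h, mul_zero]
  have := hb 0 x (primePow_anti hn (shell_subset n hx))
  rw [zero_add] at this
  simp only [this]

/-- `∑ q ^ (n (1 - s)) ∫ φ χ`, the sum over all shells. -/
def zetaSeries (μ : Measure F) (χ : Fˣ →ₜ* ℂˣ) (φ : F → ℂ) (s : ℂ) : ℂ :=
  ∑ᶠ n : ℤ, (residueCard F : ℂ) ^ ((n : ℂ) * (1 - s)) * shellInt μ χ φ n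

lemma zetaSeries_eq_sum (h : IsRamified χ) {a b : ℤ} (ha : ∀ x, x ∉ primePow F a → φ x = 0)
    (hb : ∀ x, ∀ y ∈ primePow F b, φ (x + y) = φ x) {k : ℕ} (hk : b ≤ a + k) (s : ℂ) :
    zetaSeries μ χ φ s = ∑ i ∈ Finset.range k,
      (residueCard F : ℂ) ^ (((a + i : ℤ) : ℂ) * (1 - s)) * shellInt μ χ φ (a + i) := by
  have hinj : Function.Injective fun i : ℕ => a + (i : ℤ) := fun i j hij => by simpa using hij
  rw [zetaSeries, finsum_eq_sum_of_support_subset (s := (Finset.range k).image fun i : ℕ => a + (i : ℤ)),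
    Finset.sum_image fun i _ j _ hij => hinj hij]
  intro n hn
  have h1 : a ≤ n := by
    by_contra hlt
    exact hn (by simp [shellInt_eq_zero_of_lt ha (not_le.1 hlt)])
  have h2 : n < b := by
    by_contra hlt
    exact hn (by simp [shellInt_eq_zero_of_le h hb (not_lt.1 hlt)])
  rw [Finset.coe_image, Set.mem_image]
  refine ⟨(n - a).toNat, ?_, ?_⟩
  · rw [Finset.mem_coe, Finset.mem_range]; omega
  · omega

lemma differentiable_zetaSeries (h : IsRamified χ) (hφ : IsSchwartz φ) :
    Differentiable ℂ (zetaSeries μ χ φ) := by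
  obtain ⟨a, b, ha, hb⟩ := isSchwartz_iff.1 hφ
  have : zetaSeries μ χ φ = fun s => ∑ i ∈ Finset.range (b - a).toNat,
      (residueCard F : ℂ) ^ (((a + i : ℤ) : ℂ) * (1 - s)) * shellInt μ χ φ (a + i) :=
    funext fun s => zetaSeries_eq_sum h ha hb (by omega) s
  rw [this]
  refine Differentiable.fun_sum fun i _ => Differentiable.mul_const ?_ _
  refine Differentiable.const_cpow (by fun_prop) (Or.inl (residueCard_ne_zero F))

lemma setIntegral_primePow_eq_sum_shell {f : F → ℂ} {a : ℤ} (hf : IntegrableOn f (primePow F a) μ)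
    (k : ℕ) : ∫ x in primePow F a, f x ∂μ =
      ∑ i ∈ Finset.range k, ∫ x in shell F (a + i), f x ∂μ + ∫ x in primePow F (a + k), f x ∂μ := by
  induction k with
  | zero => simp
  | succ k ih =>
    have hsub : primePow F (a + k + 1) ⊆ primePow F (a + k) := primePow_anti (by omega)
    have h1 : ∫ x in primePow F (a + k), f x ∂μ =
        ∫ x in shell F (a + k), f x ∂μ + ∫ x in primePow F (a + k + 1), f x ∂μ := by
      rw [shell_eq_diff, ← setIntegral_union Set.disjoint_sdiff_left (measurableSet_primePow _),
        Set.sdiff_union_of_subset hsub]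
      · exact hf.mono_set (Set.sdiff_subset.trans (primePow_anti (by omega)))
      · exact hf.mono_set (primePow_anti (by omega))
    rw [ih, h1, Finset.sum_range_succ, Nat.cast_succ, ← add_assoc a,
      ← add_assoc]

variable (χ) in
omit [MeasurableSpace F] [BorelSpace F] in
lemma exists_norm_extend_le : ∃ C : ℝ, 0 ≤ C ∧ ∀ n : ℤ, ∀ x ∈ shell F n,
    ‖extend χ x‖ ≤ C * ‖extend χ (unif F)‖ ^ n := by
  obtain ⟨C, hC⟩ := (isCompact_shell (F := F) 0).exists_bound_of_continuousOn
    (continuousOn_extend_shell χ 0)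
  refine ⟨C, (norm_nonneg _).trans (hC 1 one_mem_shell), fun n x hx => ?_⟩
  have h0 := zpow_ne_zero n (unif_ne_zero F)
  have hu : (unif F ^ n)⁻¹ * x ∈ shell F 0 := by
    have h1 := mul_mem_shell_iff (m := n) (y := (unif F ^ n)⁻¹ * x) (unif_zpow_mem_shell (F := F) n)
    rw [mul_inv_cancel_left₀ h0, sub_self] at h1
    exact h1.1 hx
  have h2 : extend χ (unif F ^ n) = extend χ (unif F) ^ n := by
    rcases n with n | n
    · simpa using extend_pow_apply χ (unif F) n
    · rw [zpow_negSucc, zpow_negSucc, extend_inv_apply, extend_pow_apply]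
  rw [← norm_zpow, ← h2]
  calc ‖extend χ x‖ = ‖extend χ ((unif F ^ n)⁻¹ * x)‖ * ‖extend χ (unif F ^ n)‖ := by
        rw [← norm_mul, ← extend_mul, mul_comm, mul_inv_cancel_left₀ h0]
    _ ≤ _ := by gcongr; exact hC _ hu

/-- On the shell of valuation `n` the integrand is at most a constant times the `n`-th power of the
quantity in the hypothesis, hence bounded on a ball of finite volume. -/
lemma integrableOn_zeta (hφ : IsSchwartz φ) (a : ℤ) {s : ℂ}
    (hs : ‖extend χ (unif F)‖ * (residueCard F : ℝ) ^ (1 - s.re) ≤ 1) :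
    IntegrableOn (fun x => φ x * (extend χ x * (‖x‖ : ℂ) ^ s) * (‖x‖ : ℂ)⁻¹) (primePow F a) μ := by
  have hq := residueCard_pos F
  obtain ⟨M, hM⟩ := hφ.continuous.bounded_above_of_compact_support hφ.2
  have hM0 : 0 ≤ M := (norm_nonneg _).trans (hM 0)
  obtain ⟨C, hC0, hC⟩ := exists_norm_extend_le χ
  have hmeas : Measurable fun x : F => φ x * (extend χ x * (‖x‖ : ℂ) ^ s) * (‖x‖ : ℂ)⁻¹ := by
    refine Measurable.mul (hφ.continuous.measurable.mul (Measurable.mul ?_ ?_)) ?_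
    · refine measurable_of_measurable_on_compl_singleton 0 ?_
      exact (continuousOn_iff_continuous_domRestrict.1 (continuousOn_extend χ)).measurable
    · fun_prop
    · fun_prop
  refine Measure.integrableOn_of_bounded
    (M := M * (C * (‖extend χ (unif F)‖ * (residueCard F : ℝ) ^ (1 - s.re)) ^ a))
    (isCompact_primePow a).measure_lt_top.ne hmeas.aestronglyMeasurable ?_
  refine (ae_restrict_iff' (measurableSet_primePow a)).2 (Eventually.of_forall fun x hx => ?_)
  have hB : 0 < ‖extend χ (unif F)‖ := norm_pos_iff.2 (extend_ne_zero (unif_ne_zero F))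
  have hr : 0 < ‖extend χ (unif F)‖ * (residueCard F : ℝ) ^ (1 - s.re) :=
    mul_pos hB (Real.rpow_pos_of_pos hq _)
  by_cases hx0 : x = 0
  · subst hx0
    simp only [extend_zero, norm_zero, zero_mul, mul_zero]
    positivity
  obtain ⟨n, hn⟩ := exists_mem_shell hx0
  have hna : a ≤ n := by
    by_contra hlt
    exact (mem_shell_iff.1 hn).2 (primePow_anti (by omega) hx)
  have h1 : φ x * (extend χ x * (‖x‖ : ℂ) ^ s) * (‖x‖ : ℂ)⁻¹ =
      φ x * (extend χ x * (residueCard F : ℂ) ^ ((n : ℂ) * (1 - s))) := by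
    rw [← norm_cpow_mul_inv hn s]; ring
  have h2 : ‖(residueCard F : ℂ) ^ ((n : ℂ) * (1 - s))‖ = ((residueCard F : ℝ) ^ (1 - s.re)) ^ n := by
    rw [← Complex.ofReal_natCast, Complex.norm_cpow_eq_rpow_re_of_pos hq, ← Real.rpow_intCast,
      ← Real.rpow_mul hq.le]
    congr 1
    simp [mul_comm]
  rw [h1, norm_mul, norm_mul, h2]
  calc ‖φ x‖ * (‖extend χ x‖ * ((residueCard F : ℝ) ^ (1 - s.re)) ^ n)
      ≤ M * (C * ‖extend χ (unif F)‖ ^ n * ((residueCard F : ℝ) ^ (1 - s.re)) ^ n) := by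
        gcongr
        · exact hM x
        · exact hC n x hn
    _ = M * (C * (‖extend χ (unif F)‖ * (residueCard F : ℝ) ^ (1 - s.re)) ^ n) := by
        rw [mul_zpow]; ring
    _ ≤ _ := by
        gcongr M * (C * ?_)
        exact zpow_le_zpow_right_of_le_one₀ hr hs hna

/-- The ball on which `φ` is constant contributes `0`: multiplication by a unit `u` with `χ(u) ≠ 1`
preserves the ball and multiplies the integrand by `χ(u)`. The finitely many remaining shells are
those of the series. -/
lemma integral_zeta_eq (h : IsRamified χ) (hφ : IsSchwartz φ) {s : ℂ}
    (hs : ‖extend χ (unif F)‖ * (residueCard F : ℝ) ^ (1 - s.re) ≤ 1) :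
    ∫ x, φ x * (extend χ x * (‖x‖ : ℂ) ^ s) * (‖x‖ : ℂ)⁻¹ ∂μ = zetaSeries μ χ φ s := by
  obtain ⟨a, b, ha, hb⟩ := isSchwartz_iff.1 hφ
  have hk : b ≤ a + ((b - a).toNat : ℤ) := by omega
  set f : F → ℂ := fun x => φ x * (extend χ x * (‖x‖ : ℂ) ^ s) * (‖x‖ : ℂ)⁻¹ with hf
  have h1 : ∫ x, f x ∂μ = ∫ x in primePow F a, f x ∂μ := by
    rw [setIntegral_eq_integral_of_forall_compl_eq_zero]
    intro x hx
    simp [hf, ha x hx]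
  have h2 : ∫ x in primePow F (a + (b - a).toNat), f x ∂μ = 0 := by
    obtain ⟨u, hu, hu1⟩ := h.exists_ne_one
    have hun : ‖u‖ = 1 := by simpa [mem_shell] using hu
    refine setIntegral_eq_zero_of_mul (measurableSet_primePow _) hun hu1
      (fun x => by rw [mul_mem_primePow_iff hu, sub_zero]) fun x hx => ?_
    have h3 : ∀ y ∈ primePow F (a + (b - a).toNat), φ y = φ 0 := fun y hy => by
      rw [← hb 0 y (primePow_anti hk hy), zero_add]
    have h4 : u * x ∈ primePow F (a + (b - a).toNat) := by rwa [mul_mem_primePow_iff hu, sub_zero]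
    simp only [hf, h3 _ hx, h3 _ h4, norm_mul, hun, one_mul, extend_mul]
    ring
  rw [h1, setIntegral_primePow_eq_sum_shell (integrableOn_zeta hφ a hs) (b - a).toNat, h2, add_zero,
    zetaSeries_eq_sum h ha hb hk]
  refine Finset.sum_congr rfl fun i _ => ?_
  rw [shellInt, ← integral_const_mul]
  refine setIntegral_congr_fun (measurableSet_shell _) fun x hx => ?_
  rw [← norm_cpow_mul_inv hx s]
  ring

lemma isNormalizedZeta_zetaSeries (hμ : (selfDual ψ).IsAddHaarMeasure) (h : IsRamified χ)
    (hφ : IsSchwartz φ) (ϖ : F) : IsNormalizedZeta ϖ ψ χ φ (zetaSeries (selfDual ψ) χ φ) := by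
  have hq := residueCard_pos F
  have hB : 0 < ‖extend χ (unif F)‖ := norm_pos_iff.2 (extend_ne_zero (unif_ne_zero F))
  refine ⟨differentiable_zetaSeries h hφ, 1 + Real.logb (residueCard F) ‖extend χ (unif F)‖,
    fun s hs => ?_⟩
  rw [localL, if_neg h, inv_one, one_mul, zetaIntegral, integral_zeta_eq h hφ]
  rw [← Real.rpow_logb hq (one_lt_residueCard F).ne' hB, ← Real.rpow_add hq]
  exact Real.rpow_le_one_of_one_le_of_nonpos (one_lt_residueCard F).le (by linarith)

omit [IsNormalizedLocalField F] [BorelSpace F] in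
-- Two entire functions agreeing on a half plane are equal; this identifies the continuation chosen
-- in `normalizedZeta`.
lemma IsNormalizedZeta.unique {ϖ : F} {Z Z' : ℂ → ℂ} (h : IsNormalizedZeta ϖ ψ χ φ Z)
    (h' : IsNormalizedZeta ϖ ψ χ φ Z') : Z = Z' := by
  obtain ⟨hd, σ, hσ⟩ := h
  obtain ⟨hd', σ', hσ'⟩ := h'
  refine AnalyticOnNhd.eq_of_eventuallyEq (Complex.analyticOnNhd_univ_iff_differentiable.2 hd)
    (Complex.analyticOnNhd_univ_iff_differentiable.2 hd') (z₀ := ((max σ σ' + 1 : ℝ) : ℂ)) ?_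
  have : {s : ℂ | max σ σ' < s.re} ∈ 𝓝 ((max σ σ' + 1 : ℝ) : ℂ) :=
    (isOpen_lt continuous_const Complex.continuous_re).mem_nhds (by
      change max σ σ' < _
      rw [Complex.ofReal_re]; linarith)
  filter_upwards [this] with s hs
  rw [hσ s (lt_of_le_of_lt (le_max_left _ _) hs), hσ' s (lt_of_le_of_lt (le_max_right _ _) hs)]

lemma normalizedZeta_eq (hμ : (selfDual ψ).IsAddHaarMeasure) (h : IsRamified χ) (hφ : IsSchwartz φ)
    (ϖ : F) : normalizedZeta ϖ ψ χ φ = zetaSeries (selfDual ψ) χ φ := by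
  have h1 := isNormalizedZeta_zetaSeries hμ h hφ ϖ
  exact (Classical.epsilon_spec (p := IsNormalizedZeta ϖ ψ χ φ) ⟨_, h1⟩).unique h1

end Zeta

/-! ### Epsilon factors of ramified characters. -/

section Epsilon

variable {F : Type*} [NontriviallyNormedField F] [IsUltrametricDist F] [IsNormalizedLocalField F]
  [MeasurableSpace F] [BorelSpace F] {μ : Measure F} [μ.IsAddHaarMeasure]
  {χ : Fˣ →ₜ* ℂˣ} {ψ : AddChar F ℂ} {φ : F → ℂ}

/-- `shellInt_fourierWith` is summed over all shells, with the reindexing `n ↦ e(ψ) - e(χ) - n`. -/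
lemma zetaSeries_fourierWith (hψc : Continuous ψ) (hψ : ψ ≠ 1) (h : IsRamified χ)
    (hφ : IsSchwartz φ) (s : ℂ) : zetaSeries μ χ⁻¹ (fourierWith μ ψ φ) (1 - s) =
      (residueCard F : ℂ) ^ (((condAdd ψ - condMul χ : ℤ) : ℂ) * s) * gaussInt μ ψ χ *
        zetaSeries μ χ φ s := by
  have hq := residueCard_ne_zero F
  set N := condAdd ψ - condMul χ with hN
  rw [zetaSeries, zetaSeries, mul_finsum, ← finsum_comp_equiv (Equiv.subLeft N)]
  refine finsum_congr fun n => ?_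
  rw [Equiv.subLeft_apply, shellInt_fourierWith hψc hψ h hφ, ← hN, sub_sub_cancel,
    ← Complex.cpow_intCast, sub_sub_cancel]
  have h1 : (residueCard F : ℂ) ^ (((N - n : ℤ) : ℂ) * s) * (residueCard F : ℂ) ^ (n : ℂ) =
      (residueCard F : ℂ) ^ ((N : ℂ) * s) * (residueCard F : ℂ) ^ ((n : ℂ) * (1 - s)) := by
    rw [← Complex.cpow_add _ _ hq, ← Complex.cpow_add _ _ hq]
    congr 1
    push_cast
    ring
  linear_combination (gaussInt μ ψ χ * shellInt μ χ φ n) * h1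

/-- The indicator function of `1 + 𝔭 ^ n`. -/
def oneAddIndicator (F : Type*) [NontriviallyNormedField F] [IsUltrametricDist F] (n : ℕ) : F → ℂ :=
  {x : F | x - 1 ∈ primePow F n}.indicator 1

omit [MeasurableSpace F] [BorelSpace F] in
lemma isSchwartz_oneAddIndicator (n : ℕ) : IsSchwartz (oneAddIndicator F n) := by
  classical
  refine isSchwartz_iff.2 ⟨0, n, fun x hx => Set.indicator_of_notMem (fun h => hx ?_) _,
    fun x y hy => ?_⟩
  · have := add_mem_primePow (primePow_anti (by omega) h) (shell_subset 0 (one_mem_shell (F := F)))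
    rwa [sub_add_cancel] at this
  · rw [oneAddIndicator, Set.indicator_apply, Set.indicator_apply]
    have : x + y - 1 = x - 1 + y := by ring
    congr 1
    rw [Set.mem_ofPred_eq, Set.mem_ofPred_eq, this, add_mem_primePow_iff hy]

lemma shellInt_oneAddIndicator (h : IsRamified χ) (n : ℤ) :
    shellInt μ χ (oneAddIndicator F (condMul χ)) n =
      if n = 0 then (μ.real (primePow F (condMul χ)) : ℂ) else 0 := by
  have hm := one_le_condMul h
  split_ifs with hn
  · subst hn
    have hT : MeasurableSet {x : F | x - 1 ∈ primePow F (condMul χ)} :=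
      (measurable_id.sub_const _) (measurableSet_primePow _)
    have hsub : {x : F | x - 1 ∈ primePow F (condMul χ)} ⊆ shell F 0 := fun x hx =>
      mem_shell_of_sub_one_mem (by exact_mod_cast hm) hx
    have h1 : ∀ x, oneAddIndicator F (condMul χ) x * extend χ x =
        {x : F | x - 1 ∈ primePow F (condMul χ)}.indicator (extend χ) x := by
      intro x
      by_cases hx : x ∈ {x : F | x - 1 ∈ primePow F (condMul χ)}
      · rw [oneAddIndicator, Set.indicator_of_mem hx, Set.indicator_of_mem hx]; simp
      · rw [oneAddIndicator, Set.indicator_of_notMem hx, Set.indicator_of_notMem hx, zero_mul]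
    simp_rw [shellInt, h1]
    rw [setIntegral_indicator hT, Set.inter_eq_right.2 hsub, (setIntegral_coset 1 _ fun y hy => ?_).2,
      extend_one, mul_one]
    rw [extend_eq_one h le_rfl (by rwa [add_sub_cancel_left]), extend_one]
  · rw [shellInt, setIntegral_congr_fun (g := fun _ => 0) (measurableSet_shell n) fun x hx => ?_]
    · simp
    · have : oneAddIndicator F (condMul χ) x = 0 :=
        Set.indicator_of_notMem (s := {x : F | x - 1 ∈ primePow F (condMul χ)}) (fun h1 => hn
          (shell_unique hx (mem_shell_of_sub_one_mem (n := condMul χ) (by exact_mod_cast hm) h1))) _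
      simp only [this, zero_mul]

lemma zetaSeries_oneAddIndicator (h : IsRamified χ) (s : ℂ) :
    zetaSeries μ χ (oneAddIndicator F (condMul χ)) s = (μ.real (primePow F (condMul χ)) : ℂ) := by
  rw [zetaSeries, finsum_eq_single _ 0]
  · rw [shellInt_oneAddIndicator h, if_pos rfl]; simp
  · intro n hn
    rw [shellInt_oneAddIndicator h, if_neg hn, mul_zero]

/-- The epsilon factor of a ramified character is a Gauss integral. -/
theorem tateEpsilon_eq (hψc : Continuous ψ) (hψ : ψ ≠ 1) (h : IsRamified χ) (ϖ : F) (s : ℂ) :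
    tateEpsilon ϖ s χ ψ = (residueCard F : ℂ) ^ (((condAdd ψ - condMul χ : ℤ) : ℂ) * s) *
      gaussInt (selfDual ψ) ψ χ := by
  have hμ := (isSelfDual_selfDual ψ hψc hψ).1
  have key : ∀ c, IsEpsilonFactor ϖ χ ψ s c ↔ c = (residueCard F : ℂ) ^
      (((condAdd ψ - condMul χ : ℤ) : ℂ) * s) * gaussInt (selfDual ψ) ψ χ := by
    intro c
    have hrw : ∀ φ : F → ℂ, IsSchwartz φ →
        (normalizedZeta ϖ ψ χ⁻¹ (fourier ψ φ) (1 - s) = c * normalizedZeta ϖ ψ χ φ s ↔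
          ((residueCard F : ℂ) ^ (((condAdd ψ - condMul χ : ℤ) : ℂ) * s) *
            gaussInt (selfDual ψ) ψ χ) * zetaSeries (selfDual ψ) χ φ s =
              c * zetaSeries (selfDual ψ) χ φ s) := by
      intro φ hφ
      rw [normalizedZeta_eq hμ h hφ, fourier,
        normalizedZeta_eq hμ (isRamified_inv h) (hφ.fourierWith hψc hψ), zetaSeries_fourierWith hψc hψ h hφ]
    constructor
    · intro hc
      -- The zeta function of the indicator of `1 + 𝔭 ^ e(χ)` is a nonzero constant, so this test
      -- function determines the factor uniquely.
      have h1 := (hrw _ (isSchwartz_oneAddIndicator (condMul χ))).1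
        (hc _ (isSchwartz_oneAddIndicator _))
      rw [zetaSeries_oneAddIndicator h] at h1
      refine (mul_right_cancel₀ ?_ h1).symm
      exact_mod_cast (measureReal_primePow_pos _ _).ne'
    · rintro rfl φ hφ
      exact (hrw φ hφ).2 rfl
  exact (key _).1 (Classical.epsilon_spec (p := IsEpsilonFactor ϖ χ ψ s) ⟨_, (key _).2 rfl⟩)

/-- The shell functional equation is applied twice to the indicator of `1 + 𝔭 ^ e(χ)` and compared
with Fourier inversion; the reflection `x ↦ -x` produces `χ(-1)`. -/
lemma gaussInt_mul_gaussInt_inv (hψc : Continuous ψ) (hψ : ψ ≠ 1) (h : IsRamified χ)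
    (hμ : IsSelfDual ψ μ) : gaussInt μ ψ χ * gaussInt μ ψ χ⁻¹ *
      (residueCard F : ℂ) ^ (condAdd ψ - condMul χ) = extend χ (-1) := by
  have hq := residueCard_ne_zero F
  set φ := oneAddIndicator F (condMul χ) with hφdef
  have hφ : IsSchwartz φ := isSchwartz_oneAddIndicator (condMul χ)
  have h' := isRamified_inv h
  have h1 := shellInt_fourierWith (μ := μ) hψc hψ h' (hφ.fourierWith (μ := μ) hψc hψ) 0
  have hii : χ⁻¹⁻¹ = χ := inv_inv χ
  rw [hii, shellInt_fourierWith hψc hψ h hφ, condMul_inv h, sub_zero, sub_self, zpow_zero,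
    mul_one, shellInt_oneAddIndicator h, if_pos rfl] at h1
  have h2 : shellInt μ χ (fourierWith μ ψ (fourierWith μ ψ φ)) 0 =
      extend χ (-1) * (μ.real (primePow F (condMul χ)) : ℂ) := by
    have h3 : shellInt μ χ φ 0 = (μ.real (primePow F (condMul χ)) : ℂ) := by
      rw [shellInt_oneAddIndicator h, if_pos rfl]
    rw [← h3, shellInt, shellInt, ← integral_const_mul]
    have h4 := setIntegral_comp_mul (μ := μ) (S := shell F 0) (T := shell F 0) (measurableSet_shell 0)
      (measurableSet_shell 0) (a := -1) (by simp)
      (fun x => by rw [mul_mem_shell_iff (neg_mem_shell one_mem_shell), sub_zero])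
      fun x => extend χ (-1) * (φ x * extend χ x)
    rw [norm_neg, norm_one, inv_one, Complex.ofReal_one, one_mul] at h4
    rw [← h4]
    refine setIntegral_congr_fun (measurableSet_shell 0) fun x _ => ?_
    rw [hμ.2 φ hφ, neg_one_mul, extend_neg χ x]
    linear_combination (-φ (-x) * extend χ x) * extend_neg_one_sq χ
  rw [h2] at h1
  have hv : (μ.real (primePow F (condMul χ)) : ℂ) ≠ 0 := by
    exact_mod_cast (measureReal_primePow_pos _ _).ne'
  refine mul_right_cancel₀ hv ?_
  rw [h1]
  ring

theorem tateEpsilon_mul_tateEpsilon_inv (hψc : Continuous ψ) (hψ : ψ ≠ 1) (h : IsRamified χ) (ϖ : F)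
    (s : ℂ) : tateEpsilon ϖ s χ ψ * tateEpsilon ϖ (1 - s) χ⁻¹ ψ = extend χ (-1) := by
  have hsd := isSelfDual_selfDual ψ hψc hψ
  have := hsd.1
  rw [tateEpsilon_eq hψc hψ h, tateEpsilon_eq hψc hψ (isRamified_inv h), condMul_inv h,
    ← gaussInt_mul_gaussInt_inv hψc hψ h hsd, ← Complex.cpow_intCast]
  have h1 : (residueCard F : ℂ) ^ (((condAdd ψ - condMul χ : ℤ) : ℂ) * s) *
      (residueCard F : ℂ) ^ (((condAdd ψ - condMul χ : ℤ) : ℂ) * (1 - s)) =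
      (residueCard F : ℂ) ^ ((condAdd ψ - condMul χ : ℤ) : ℂ) := by
    rw [← Complex.cpow_add _ _ (residueCard_ne_zero F)]
    congr 1; ring
  rw [← h1]
  ring

end Epsilon

end PadicEpsilon

end

/-! ### Roots of unity, principal units and the sign of the field. -/

noncomputable section

namespace PadicEpsilon

/-- In `d = ∏ (1 - ζ^k)`, the factors for `k` and `d - k` are paired. With `ξ = ζ^(t+1)`, a square
root of `ζ`, each pair equals `-(ξ^k - ξ^(-k))²`. -/
lemma exists_natCast_eq_neg_one_pow_mul_sq {K : Type*} [Field K] {t : ℕ} {ζ : K}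
    (hζ : IsPrimitiveRoot ζ (2 * t + 1)) : ∃ D : K, ((2 * t + 1 : ℕ) : K) = (-1) ^ t * D ^ 2 := by
  have h1 := hζ.prod_one_sub_pow_eq_order
  have hζ0 : ζ ≠ 0 := hζ.ne_zero (by omega)
  set ξ := ζ ^ (t + 1) with hξ
  have hξ0 : ξ ≠ 0 := pow_ne_zero _ hζ0
  have hξ2 : ξ ^ 2 = ζ := by
    rw [hξ, ← pow_mul, show (t + 1) * 2 = 2 * t + 1 + 1 by ring, pow_succ, hζ.pow_eq_one, one_mul]
  rw [two_mul, Finset.prod_range_add, ← Finset.prod_range_reflect (fun x => 1 - ζ ^ (t + x + 1)),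
    ← Finset.prod_mul_distrib] at h1
  refine ⟨∏ k ∈ Finset.range t, (ξ ^ (k + 1) - (ξ ^ (k + 1))⁻¹), ?_⟩
  have h2 : ((2 * t + 1 : ℕ) : K) = ((2 * t : ℕ) : K) + 1 := by push_cast; ring
  rw [h2, two_mul, ← h1, ← Finset.prod_pow, ← Finset.card_range t, ← Finset.prod_const,
    Finset.card_range, ← Finset.prod_mul_distrib]
  refine Finset.prod_congr rfl fun k hk => ?_
  rw [Finset.mem_range] at hk
  have h3 : ζ ^ (t + (t - 1 - k) + 1) = ((ξ ^ (k + 1)) ^ 2)⁻¹ := by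
    refine eq_inv_of_mul_eq_one_left ?_
    rw [← pow_mul, mul_comm (k + 1), pow_mul, hξ2, ← pow_add,
      show t + (t - 1 - k) + 1 + (k + 1) = 2 * t + 1 by omega, hζ.pow_eq_one]
  have h4 : ζ ^ (k + 1) = (ξ ^ (k + 1)) ^ 2 := by
    rw [← pow_mul, mul_comm (k + 1), pow_mul, hξ2]
  have h5 : ξ ^ (k + 1) ≠ 0 := pow_ne_zero _ hξ0
  rw [h3, h4]
  generalize ξ ^ (k + 1) = a at h5
  field_simp
  ring

section Units

variable {F : Type*} [NontriviallyNormedField F] [IsUltrametricDist F] [IsNormalizedLocalField F]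

/-- The geometric sum in `u^p - 1 = (u - 1)(1 + u + ⋯)` is `p` modulo `𝔭`, hence lies in `𝔭`. -/
lemma pow_sub_one_mem_succ {p : ℕ} (hp : ‖(p : F)‖ < 1) {n : ℤ} (hn : 1 ≤ n) {u : F}
    (hu : u - 1 ∈ primePow F n) : u ^ p - 1 ∈ primePow F (n + 1) := by
  rw [← mul_geom_sum]
  refine mul_mem_primePow hu ?_
  have h1 : ∑ i ∈ Finset.range p, u ^ i = ∑ i ∈ Finset.range p, (u ^ i - 1) + p := by
    simp [Finset.sum_sub_distrib]
  rw [h1]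
  refine add_mem_primePow ?_ (mem_primePow_one.2 hp)
  exact Finset.sum_induction _ (· ∈ primePow F 1) (fun _ _ => add_mem_primePow) (zero_mem_primePow 1)
    fun i _ => pow_sub_one_mem (by omega) (primePow_anti hn hu) i

lemma pow_prime_pow_sub_one_mem {p : ℕ} (hp : ‖(p : F)‖ < 1) {u : F} (hu : u - 1 ∈ primePow F 1)
    (k : ℕ) : u ^ p ^ k - 1 ∈ primePow F (k + 1) := by
  induction k with
  | zero => simpa using hu
  | succ k ih =>
    rw [pow_succ, pow_mul]
    exact_mod_cast pow_sub_one_mem_succ hp (by omega) ih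

/-- For the lifting direction, let `i` lift a square root of `-1`. Then `-i²` is a principal unit,
so its `p^n`-th powers tend to `1`; as `p` is odd, the squares of `i^(p^n)` tend to `-1`. The
squares of integers form a compact, hence closed, set. -/
lemma isSquare_neg_one_iff {p : ℕ} (hp : ‖(p : F)‖ < 1) (hodd : Odd p) :
    IsSquare (-1 : F) ↔ IsSquare (-1 : Valued.ResidueField F) := by
  have h0 : (1 : F) ∈ primePow F 0 := shell_subset 0 one_mem_shell
  constructor
  · rintro ⟨x, hx⟩
    have hx0 : x ∈ primePow F 0 := by
      have h1 : ‖x‖ * ‖x‖ = 1 := by rw [← norm_mul, ← hx, norm_neg, norm_one]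
      rw [mem_primePow_zero]
      nlinarith [norm_nonneg x]
    exact ⟨red x, by rw [← red_mul hx0 hx0, ← hx, red_neg h0, red_one]⟩
  · rintro ⟨r, hr⟩
    set i := resLift r with hi
    have hi0 : i ∈ primePow F 0 := resLift_mem r
    have h1 : -(i * i) - 1 ∈ primePow F 1 := by
      have h2 : i * i ∈ primePow F 0 := mul_mem_primePow_le (by omega) hi0 hi0
      rw [← red_eq_iff (neg_mem_primePow h2) h0, red_neg h2, red_mul hi0 hi0, hi, red_resLift, ← hr,
        red_one, neg_neg]
    have hcl : IsClosed ((fun x : F => x * x) '' primePow F 0) :=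
      ((isCompact_primePow 0).image (by fun_prop)).isClosed
    have hmem : (-1 : F) ∈ (fun x : F => x * x) '' primePow F 0 := by
      rw [← hcl.closure_eq, Metric.mem_closure_iff]
      intro ε hε
      obtain ⟨n, hn⟩ := exists_primePow_subset_ball (F := F) hε
      refine ⟨i ^ p ^ n * i ^ p ^ n, ⟨i ^ p ^ n, ?_, rfl⟩, ?_⟩
      · rw [mem_primePow_zero, norm_pow]
        exact pow_le_one₀ (norm_nonneg _) (mem_primePow_zero.1 hi0)
      · have h3 := pow_prime_pow_sub_one_mem hp h1 n
        rw [(hodd.pow).neg_pow, ← neg_one_mul] at h3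
        have h4 := hn (n + 1) (by omega) h3
        rw [mem_ball_zero_iff] at h4
        rwa [dist_eq_norm, show (-1 : F) - i ^ p ^ n * i ^ p ^ n = -1 * (i * i) ^ p ^ n - 1 by ring]
    obtain ⟨x, -, hx⟩ := hmem
    exact ⟨x, hx.symm⟩

variable [Fintype (Valued.ResidueField F)] [DecidableEq (Valued.ResidueField F)]

lemma signF_eq {p : ℕ} (hp : ‖(p : F)‖ < 1) (hodd : Odd p) :
    signF F = quadraticChar (Valued.ResidueField F) (-1) := by
  rw [signF]
  split_ifs with h
  · exact ((quadraticChar_one_iff_isSquare (by simp)).2 ((isSquare_neg_one_iff hp hodd).1 h)).symm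
  · exact (quadraticChar_neg_one_iff_not_isSquare.2 (mt (isSquare_neg_one_iff hp hodd).2 h)).symm

omit [Fintype (Valued.ResidueField F)] [DecidableEq (Valued.ResidueField F)] in
variable (F) in
lemma signF_sq : (signF F : ℂ) ^ 2 = 1 := by
  rw [signF]; split_ifs <;> simp

omit [Fintype (Valued.ResidueField F)] [DecidableEq (Valued.ResidueField F)] in
variable (F) in
lemma signF_ne_zero : (signF F : ℂ) ≠ 0 := by
  rw [signF]; split_ifs <;> simp

omit [Fintype (Valued.ResidueField F)] [DecidableEq (Valued.ResidueField F)] in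
lemma red_two : red (2 : F) = 2 := by
  rw [← one_add_one_eq_two, red_add (shell_subset 0 one_mem_shell) (shell_subset 0 one_mem_shell),
    red_one, one_add_one_eq_two]

omit [Fintype (Valued.ResidueField F)] [DecidableEq (Valued.ResidueField F)] in
lemma residue_two_ne_zero (h2 : ‖(2 : F)‖ = 1) : (2 : Valued.ResidueField F) ≠ 0 := by
  rw [← red_two, red_ne_zero_iff (mem_primePow_zero.2 h2.le)]
  simpa [mem_shell] using h2

omit [Fintype (Valued.ResidueField F)] [DecidableEq (Valued.ResidueField F)] in
lemma ringChar_residue_ne_two (h2 : ‖(2 : F)‖ = 1) : ringChar (Valued.ResidueField F) ≠ 2 := by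
  intro h
  have := ringChar.Nat.cast_ringChar (R := Valued.ResidueField F)
  rw [h] at this
  exact residue_two_ne_zero h2 (by exact_mod_cast this)

end Units

/-! ### Additive characters of the residue field. -/

section ResidueChar

variable {F : Type*} [NontriviallyNormedField F] [IsUltrametricDist F] [IsNormalizedLocalField F]
  {ψ : AddChar F ℂ}

/-- The additive character of the residue field induced by `x ↦ ψ(c x)`. -/
def resAddChar (hψc : Continuous ψ) (hψ : ψ ≠ 1) {c : F} (hc : c ∈ primePow F (condAdd ψ - 1)) :
    AddChar (Valued.ResidueField F) ℂ where
  toFun r := ψ (c * resLift r)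
  map_zero_eq_one' := by
    refine map_mul_eq_one hψc hψ hc ?_
    rw [← red_eq_zero_iff (resLift_mem _), red_resLift]
  map_add_eq_mul' r s := by
    have hr := resLift_mem (F := F) r
    have hs := resLift_mem (F := F) s
    have h1 : resLift (r + s) - (resLift r + resLift s) ∈ primePow F 1 := by
      rw [← red_eq_iff (resLift_mem _) (add_mem_primePow hr hs), red_add hr hs]
      simp only [red_resLift]
    have h2 : c * resLift (r + s) =
        c * resLift r + c * resLift s + c * (resLift (r + s) - (resLift r + resLift s)) := by ring
    rw [h2, AddChar.map_add_eq_mul, AddChar.map_add_eq_mul, map_mul_eq_one hψc hψ hc h1, mul_one]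

lemma resAddChar_red (hψc : Continuous ψ) (hψ : ψ ≠ 1) {c : F} (hc : c ∈ primePow F (condAdd ψ - 1))
    {x : F} (hx : x ∈ primePow F 0) : resAddChar hψc hψ hc (red x) = ψ (c * x) := by
  change ψ (c * resLift (red x)) = _
  have h1 : resLift (red x) - x ∈ primePow F 1 := by
    rw [← red_eq_iff (resLift_mem _) hx, red_resLift]
  have h2 : c * resLift (red x) = c * x + c * (resLift (red x) - x) := by ring
  rw [h2, AddChar.map_add_eq_mul, map_mul_eq_one hψc hψ hc h1, mul_one]

lemma resAddChar_ne_one (hψc : Continuous ψ) (hψ : ψ ≠ 1) {c : F} (hc : c ∈ shell F (condAdd ψ - 1)) :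
    resAddChar hψc hψ (shell_subset _ hc) ≠ 1 := by
  obtain ⟨y, hy, hy1⟩ := exists_map_mul_ne_one hψc hψ (a := 0) (b := c) (by
    rw [sub_zero]
    have := (mem_shell_iff.1 hc).2
    rwa [sub_add_cancel] at this)
  intro h
  rw [← resAddChar_red hψc hψ (shell_subset _ hc) hy, h] at hy1
  exact hy1 rfl

end ResidueChar

/-! ### Quadratic Gauss integrals. -/

section Quadratic

variable {F : Type*} [NontriviallyNormedField F] [IsUltrametricDist F] [IsNormalizedLocalField F]
  [MeasurableSpace F] [BorelSpace F] {μ : Measure F} [μ.IsAddHaarMeasure] {ψ : AddChar F ℂ}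

/-- The quadratic Gauss integral `∫ ψ(b x²) dx` over `𝔭 ^ a`. -/
def quadInt (μ : Measure F) (ψ : AddChar F ℂ) (a : ℤ) (b : F) : ℂ :=
  ∫ x in primePow F a, ψ (b * x ^ 2) ∂μ

/-- The outer shell contributes `0`. Under a shift of `x` by `𝔭 ^ (e(ψ) - v - a - 1)` the quadratic
term is invisible to `ψ`, while the linear term `2 b x t` gives a nontrivial character of `t`. -/
lemma quadInt_succ (hψc : Continuous ψ) (hψ : ψ ≠ 1) (h2 : ‖(2 : F)‖ = 1) {v a : ℤ} {b : F}
    (hb : b ∈ shell F v) (h : v + 2 * (a + 1) ≤ condAdd ψ) :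
    quadInt μ ψ a b = quadInt μ ψ (a + 1) b := by
  have hc : Continuous fun x : F => ψ (b * x ^ 2) := by fun_prop
  have h1 := setIntegral_primePow_eq_sum_shell (μ := μ)
    (hc.continuousOn.integrableOn_compact (isCompact_primePow a)) 1
  rw [Finset.sum_range_one] at h1
  push_cast at h1
  rw [quadInt, h1, add_zero, quadInt, add_eq_right]
  refine setIntegral_eq_zero_of_cosets (isClopen_shell a) (isCompact_shell a)
    (condAdd ψ - v - a - 1) (fun x y hy => add_mem_shell_iff (by omega) hy) hc.continuousOn
    fun x hx => ?_
  have h3 : ∀ t ∈ primePow F (condAdd ψ - v - a - 1),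
      ψ (b * (x + t) ^ 2) = ψ (b * x ^ 2) * ψ (2 * (b * x) * t) := by
    intro t ht
    have h4 : b * (x + t) ^ 2 = b * x ^ 2 + 2 * (b * x) * t + b * (t * t) := by ring
    have h5 : ψ (b * (t * t)) = 1 := map_eq_one_of_mem hψc hψ le_rfl
      (mul_mem_primePow_le (by omega) (shell_subset _ hb) (mul_mem_primePow ht ht))
    rw [h4, AddChar.map_add_eq_mul, h5, mul_one, AddChar.map_add_eq_mul]
  classical
  rw [setIntegral_congr_fun (measurableSet_primePow _) h3, integral_const_mul,
    setIntegral_addChar hψc hψ, if_neg, mul_zero]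
  have h6 : 2 * (b * x) ∈ shell F (v + a) := by
    have h7 : (2 : F) ∈ shell F 0 := by simpa [mem_shell] using h2
    rw [mul_mem_shell_iff h7, mul_mem_shell_iff hb]
    convert hx using 2; ring
  intro h8
  exact (mem_shell_iff.1 h6).2 (primePow_anti (by omega) h8)

lemma quadInt_eq_of_le (hψc : Continuous ψ) (hψ : ψ ≠ 1) (h2 : ‖(2 : F)‖ = 1) {v a a' : ℤ} {b : F}
    (hb : b ∈ shell F v) (h : v + 2 * a' ≤ condAdd ψ) (haa : a ≤ a') :
    quadInt μ ψ a b = quadInt μ ψ a' b := by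
  induction a', haa using Int.leInduction with
  | base => rfl
  | succ k hk ih => rw [ih (by omega), quadInt_succ hψc hψ h2 hb h]

lemma quadInt_eq (hψc : Continuous ψ) (hψ : ψ ≠ 1) (h2 : ‖(2 : F)‖ = 1) {v a a' : ℤ} {b : F}
    (hb : b ∈ shell F v) (h : v + 2 * a ≤ condAdd ψ) (h' : v + 2 * a' ≤ condAdd ψ) :
    quadInt μ ψ a b = quadInt μ ψ a' b := by
  rcases le_total a a' with h1 | h1
  · exact quadInt_eq_of_le hψc hψ h2 hb h' h1
  · exact (quadInt_eq_of_le hψc hψ h2 hb h h1).symm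

lemma quadInt_even (hψc : Continuous ψ) (hψ : ψ ≠ 1) {v a : ℤ} {b : F}
    (hb : b ∈ shell F v) (h : v + 2 * a = condAdd ψ) : quadInt μ ψ a b = μ.real (primePow F a) := by
  rw [quadInt, setIntegral_congr_fun (g := fun _ => (1 : ℂ)) (measurableSet_primePow a) fun x hx => ?_,
    setIntegral_const]
  · simp
  · rw [sq]
    exact map_eq_one_of_mem hψc hψ le_rfl
      (mul_mem_primePow_le (by omega) (shell_subset _ hb) (mul_mem_primePow hx hx))

variable [Fintype (Valued.ResidueField F)]

lemma quadInt_odd (hψc : Continuous ψ) (hψ : ψ ≠ 1) {v a : ℤ} {b : F}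
    (hb : b ∈ shell F v) (h : v + 2 * a + 1 = condAdd ψ)
    (hc : b * (unif F ^ a * unif F ^ a) ∈ primePow F (condAdd ψ - 1)) :
    quadInt μ ψ a b = μ.real (primePow F (a + 1)) *
      ∑ r : Valued.ResidueField F, resAddChar hψc hψ hc (r ^ 2) := by
  rw [quadInt, setIntegral_primePow_eq_sum]
  · congr 1
    refine Finset.sum_congr rfl fun r _ => ?_
    have hr := resLift_mem (F := F) r
    have h1 : r ^ 2 = red (resLift r * resLift r : F) := by rw [red_mul hr hr, red_resLift, sq]
    rw [h1, resAddChar_red hψc hψ hc (mul_mem_primePow_le (by omega) hr hr)]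
    congr 1
    ring
  · intro x hx y hy
    have h1 : b * (x + y) ^ 2 = b * x ^ 2 + (b * ((x + x) * y) + b * (y * y)) := by ring
    have h3 : ψ (b * ((x + x) * y)) = 1 := map_eq_one_of_mem hψc hψ le_rfl
      (mul_mem_primePow_le (by omega) (shell_subset _ hb) (mul_mem_primePow (add_mem_primePow hx hx) hy))
    have h4 : ψ (b * (y * y)) = 1 := map_eq_one_of_mem hψc hψ le_rfl
      (mul_mem_primePow_le (by omega) (shell_subset _ hb) (mul_mem_primePow hy hy))
    rw [h1, AddChar.map_add_eq_mul, AddChar.map_add_eq_mul, h3, h4, mul_one, mul_one]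

omit [Fintype (Valued.ResidueField F)] in
lemma mul_unif_sq_mem_shell {v : ℤ} {b : F} (hb : b ∈ shell F v) (a : ℤ) :
    b * (unif F ^ a * unif F ^ a) ∈ shell F (v + 2 * a) := by
  rw [mul_mem_shell_iff hb, mul_mem_shell_iff (unif_zpow_mem_shell a)]
  convert unif_zpow_mem_shell (F := F) a using 2; ring

omit [Fintype (Valued.ResidueField F)] in
lemma quadInt_neg {p : ℕ} (hp : ‖(p : F)‖ < 1) (hodd : Odd p) (hψc : Continuous ψ) (hψ : ψ ≠ 1)
    (h2 : ‖(2 : F)‖ = 1) {v a : ℤ} {b : F}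
    (hb : b ∈ shell F v) (h : v + 2 * a ≤ condAdd ψ) :
    quadInt μ ψ a (-b) = (signF F : ℂ) ^ (condAdd ψ - v) * quadInt μ ψ a b := by
  classical
  have := Fintype.ofFinite (Valued.ResidueField F)
  have hb' := neg_mem_shell hb
  -- All admissible balls give the same integral, so the smallest one is used. If `e(ψ) - v` is even
  -- the integrand is `1` there; if it is odd a quadratic Gauss sum over the residue field remains,
  -- and `-1` acts by its quadratic character, which is `sign(F)`.
  obtain ⟨a', ha' | ha'⟩ := Int.even_or_odd' (condAdd ψ - v)
  · rw [quadInt_eq (a' := a') hψc hψ h2 hb' h (by omega), quadInt_eq (a' := a') hψc hψ h2 hb h (by omega),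
      quadInt_even hψc hψ hb (by omega), quadInt_even hψc hψ hb' (by omega), ha', zpow_mul,
      zpow_ofNat, signF_sq, one_zpow, one_mul]
  · have hc := mul_unif_sq_mem_shell hb a'
    rw [show v + 2 * a' = condAdd ψ - 1 by omega] at hc
    have hc' := shell_subset _ (mul_unif_sq_mem_shell hb' a')
    rw [show v + 2 * a' = condAdd ψ - 1 by omega] at hc'
    rw [quadInt_eq (a' := a') hψc hψ h2 hb' h (by omega), quadInt_eq (a' := a') hψc hψ h2 hb h (by omega),
      quadInt_odd hψc hψ hb (by omega) (shell_subset _ hc), quadInt_odd hψc hψ hb' (by omega) hc', ha',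
      zpow_add₀ (signF_ne_zero F), zpow_mul, zpow_ofNat, signF_sq, one_zpow, one_mul, zpow_one,
      signF_eq hp hodd,
      mul_left_comm ((quadraticChar (Valued.ResidueField F) (-1) : ℤ) : ℂ),
      ← sum_neg_sq (ringChar_residue_ne_two h2) (resAddChar_ne_one hψc hψ hc)]
    congr 1
    refine Finset.sum_congr rfl fun r _ => ?_
    obtain ⟨x, hx, hxr⟩ : ∃ x ∈ primePow F 0, red x = r ^ 2 := ⟨_, resLift_mem _, red_resLift (F := F) _⟩
    rw [← hxr, ← red_neg hx, resAddChar_red hψc hψ _ hx, resAddChar_red hψc hψ _ (neg_mem_primePow hx)]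
    congr 1
    ring

omit [Fintype (Valued.ResidueField F)] in
-- On the smallest admissible ball the integral is a volume, or a volume times a quadratic Gauss sum
-- whose square is `sign(F) q`. Self-duality fixes the square of the volume.
lemma quadInt_sq {p : ℕ} (hp : ‖(p : F)‖ < 1) (hodd : Odd p) (hψc : Continuous ψ) (hψ : ψ ≠ 1)
    (h2 : ‖(2 : F)‖ = 1) (hμ : IsSelfDual ψ μ) {v a : ℤ} {b : F}
    (hb : b ∈ shell F v) (h : v + 2 * a ≤ condAdd ψ) :
    quadInt μ ψ a b ^ 2 = (signF F : ℂ) ^ (condAdd ψ - v) * (residueCard F : ℂ) ^ v := by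
  classical
  have := Fintype.ofFinite (Valued.ResidueField F)
  have hq := residueCard_ne_zero F
  have hv : (μ.real (primePow F 0) : ℂ) ^ 2 = (residueCard F : ℂ) ^ condAdd ψ := by
    have := congrArg (fun x : ℝ => (x : ℂ)) ((isSelfDual_iff hψc hψ).1 hμ)
    simpa using this
  have hva : ∀ n : ℤ, (μ.real (primePow F n) : ℂ) ^ 2 = (residueCard F : ℂ) ^ (condAdd ψ - 2 * n) := by
    intro n
    rw [measureReal_primePow μ n, Complex.ofReal_mul, mul_pow, hv]
    push_cast
    rw [← zpow_natCast, ← zpow_mul, ← zpow_add₀ hq]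
    congr 1
    push_cast
    ring
  obtain ⟨a', ha' | ha'⟩ := Int.even_or_odd' (condAdd ψ - v)
  · rw [quadInt_eq (a' := a') hψc hψ h2 hb h (by omega),
      quadInt_even hψc hψ hb (by omega), hva, ha', zpow_mul,
      zpow_ofNat, signF_sq, one_zpow, one_mul]
    congr 1
    omega
  · have hc := mul_unif_sq_mem_shell hb a'
    rw [show v + 2 * a' = condAdd ψ - 1 by omega] at hc
    rw [quadInt_eq (a' := a') hψc hψ h2 hb h (by omega),
      quadInt_odd hψc hψ hb (by omega) (shell_subset _ hc), mul_pow, hva,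
      sum_sq_sq (ringChar_residue_ne_two h2) (resAddChar_ne_one hψc hψ hc), ← signF_eq hp hodd, ha',
      zpow_add₀ (signF_ne_zero F), zpow_mul, zpow_ofNat, signF_sq, one_zpow, one_mul, zpow_one,
      mul_left_comm]
    congr 1
    rw [show v = condAdd ψ - 2 * (a' + 1) + 1 by omega, zpow_add_one₀ hq]
    rfl

omit [Fintype (Valued.ResidueField F)] in
lemma quadInt_sq_mul {D : F} (hD : ‖D‖ = 1) (a : ℤ) (b : F) :
    quadInt μ ψ a (D ^ 2 * b) = quadInt μ ψ a b := by
  have hD' : D ∈ shell F 0 := by simpa [mem_shell] using hD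
  have h1 := setIntegral_comp_mul (μ := μ) (measurableSet_primePow a) (measurableSet_primePow a)
    (ne_zero_of_mem_shell hD') (fun x => by rw [mul_mem_primePow_iff hD', sub_zero])
    fun x => ψ (b * x ^ 2)
  rw [hD, inv_one, Complex.ofReal_one, one_mul] at h1
  rw [quadInt, quadInt, ← h1]
  congr 1 with x
  congr 1
  ring

omit [Fintype (Valued.ResidueField F)] in
/-- The Davenport–Hasse type relation for quadratic Gauss integrals. -/
lemma quadInt_pow {p : ℕ} (hp : ‖(p : F)‖ < 1) (hodd : Odd p) (hψc : Continuous ψ) (hψ : ψ ≠ 1)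
    (h2 : ‖(2 : F)‖ = 1) (hμ : IsSelfDual ψ μ) {v a : ℤ} {b : F}
    (hb : b ∈ shell F v) (h : v + 2 * a ≤ condAdd ψ) {t : ℕ} {ζ : F}
    (hζ : IsPrimitiveRoot ζ (2 * t + 1)) (hd : ‖((2 * t + 1 : ℕ) : F)‖ = 1) :
    quadInt μ ψ a b ^ (2 * t + 1) =
      (residueCard F : ℂ) ^ (v * t) * quadInt μ ψ a (((2 * t + 1 : ℕ) : F) * b) := by
  -- Since `d = (-1)^t D²`, multiplying `b` by `d` amounts to `t` sign changes, each given by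
  -- `quadInt_neg`. The remaining even power on the left is `quadInt_sq` raised to the power `t`.
  obtain ⟨D, hD⟩ := exists_natCast_eq_neg_one_pow_mul_sq hζ
  have hD1 : ‖D‖ = 1 := by
    rw [hD, norm_mul, norm_pow, norm_neg, norm_one, one_pow, one_mul, norm_pow] at hd
    exact (pow_eq_one_iff_of_nonneg (norm_nonneg D) two_ne_zero).1 hd
  have h3 : quadInt μ ψ a (((2 * t + 1 : ℕ) : F) * b) =
      ((signF F : ℂ) ^ (condAdd ψ - v)) ^ t * quadInt μ ψ a b := by
    rw [hD, show (-1) ^ t * D ^ 2 * b = D ^ 2 * ((-1) ^ t * b) by ring, quadInt_sq_mul hD1]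
    clear hD hd hζ
    induction t with
    | zero => simp
    | succ t ih =>
      have hb' : (-1) ^ t * b ∈ shell F v := by
        rw [mem_shell, norm_mul, norm_pow, norm_neg, norm_one, one_pow, one_mul]; exact hb
      rw [pow_succ, mul_neg_one, neg_mul, quadInt_neg hp hodd hψc hψ h2 hb' h, ih, pow_succ]
      ring
  rw [h3, pow_succ, pow_mul, quadInt_sq hp hodd hψc hψ h2 hμ hb h, mul_pow, zpow_mul, zpow_natCast]
  ring

end Quadratic

end PadicEpsilon

end

noncomputable section

namespace PadicEpsilon

/-! ### Characters of a fractional ideal. -/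

section Duality

variable {F : Type*} [NontriviallyNormedField F] [IsUltrametricDist F] [IsNormalizedLocalField F]
  [MeasurableSpace F] [BorelSpace F] {ψ : AddChar F ℂ}

/-- Pontryagin duality for `𝔭 ^ a / 𝔭 ^ b`. -/
lemma exists_eq_map_mul (hψc : Continuous ψ) (hψ : ψ ≠ 1) {a b : ℤ} {θ : F → ℂ}
    (hadd : ∀ x ∈ primePow F a, ∀ y ∈ primePow F a, θ (x + y) = θ x * θ y)
    (hab : a ≤ b) (hb : ∀ x ∈ primePow F b, θ x = 1) :
    ∃ c ∈ primePow F (condAdd ψ - b), ∀ x ∈ primePow F a, θ x = ψ (c * x) := by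
  classical
  obtain ⟨hμ, hinv⟩ := isSelfDual_selfDual ψ hψc hψ
  set μ := selfDual ψ
  set φ : F → ℂ := (primePow F a).indicator θ with hφ
  have hS : IsSchwartz φ := by
    refine isSchwartz_iff.2 ⟨a, b, fun x hx => Set.indicator_of_notMem hx _, fun x y hy => ?_⟩
    have hya := primePow_anti hab hy
    by_cases hx : x ∈ primePow F a
    · rw [hφ, Set.indicator_of_mem hx, Set.indicator_of_mem (add_mem_primePow hx hya), hadd x hx y hya,
        hb y hy, mul_one]
    · rw [hφ, Set.indicator_of_notMem hx, Set.indicator_of_notMem (mt (add_mem_primePow_iff hya).1 hx)]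
  -- By inversion the transform of `θ` cut off to `𝔭 ^ a` is not identically zero. Where it is
  -- nonzero, `θ(x) ψ(y x)` must be trivial on `𝔭 ^ a`, so `c = -y` works.
  obtain ⟨y, hy⟩ : ∃ y, fourierWith μ ψ φ y ≠ 0 := by
    by_contra! h
    have h1 := hinv φ hS 0
    have h2 : fourierWith μ ψ φ = 0 := funext h
    rw [h2, neg_zero, hφ, Set.indicator_of_mem (zero_mem_primePow a), hb 0 (zero_mem_primePow b)] at h1
    simp [fourierWith] at h1
  have h1 : ∀ x ∈ primePow F a, θ x = ψ (-y * x) := by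
    intro x hx
    by_contra hne
    refine hy ?_
    have h2 : fourierWith μ ψ φ y = ∫ z in primePow F a, θ z * ψ (y * z) ∂μ := by
      rw [fourierWith, ← integral_indicator (measurableSet_primePow a)]
      congr 1 with z
      by_cases hz : z ∈ primePow F a
      · rw [hφ, Set.indicator_of_mem hz, Set.indicator_of_mem hz]
      · rw [hφ, Set.indicator_of_notMem hz, Set.indicator_of_notMem hz, zero_mul]
    rw [h2]
    refine setIntegral_eq_zero_of_add (a := x) (w := θ x * ψ (y * x)) (measurableSet_primePow a) ?_
      (fun z => add_mem_primePow_iff hx) fun z hz => ?_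
    · intro h3
      refine hne ?_
      rw [neg_mul, AddChar.map_neg_eq_inv]
      exact eq_inv_of_mul_eq_one_left h3
    · rw [hadd z hz x hx, mul_add, AddChar.map_add_eq_mul]; ring
  refine ⟨-y, ?_, h1⟩
  by_contra hc
  obtain ⟨x, hx, hx1⟩ := exists_map_mul_ne_one hψc hψ hc
  exact hx1 (by rw [← h1 x (primePow_anti hab hx), hb x hx])

end Duality

/-! ### Stationary phase for characters of conductor at least `2`. -/

section StationaryPhase

variable {F : Type*} [NontriviallyNormedField F] [IsUltrametricDist F] [IsNormalizedLocalField F]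
  [MeasurableSpace F] [BorelSpace F] {μ : Measure F} [μ.IsAddHaarMeasure]
  {χ : Fˣ →ₜ* ℂˣ} {ψ : AddChar F ℂ}

omit [MeasurableSpace F] [BorelSpace F] in
lemma one_add_mem_shell {n : ℤ} (hn : 1 ≤ n) {x : F} (hx : x ∈ primePow F n) : 1 + x ∈ shell F 0 :=
  mem_shell_of_sub_one_mem hn (by rwa [add_sub_cancel_left])

omit [MeasurableSpace F] [BorelSpace F] in
lemma div_two_mem {n : ℤ} (h2 : ‖(2 : F)‖ = 1) {x : F} (hx : x ∈ primePow F n) :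
    x / 2 ∈ primePow F n := by
  rw [mem_primePow, norm_div, h2, div_one]; exact hx

/-- On `1 + 𝔭 ^ r`, with `r` about half of the conductor exponent, a character of `Fˣ` is
given by an additive character through the truncated logarithm. -/
lemma exists_extend_one_add_eq (hψc : Continuous ψ) (hψ : ψ ≠ 1) (h2 : ‖(2 : F)‖ = 1)
    (h : IsRamified χ) {r : ℤ} (hr1 : 1 ≤ r) (hr2 : 2 * r ≤ condMul χ) (hr3 : condMul χ ≤ 3 * r) :
    ∃ c ∈ shell F (condAdd ψ - condMul χ), ∀ x ∈ primePow F r,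
      extend χ (1 + x) = ψ (c * (x - x ^ 2 / 2)) := by
  set m : ℤ := (condMul χ : ℤ) with hm
  set e := condAdd ψ with he
  have h20 : (2 : F) ≠ 0 := norm_pos_iff.1 (by rw [h2]; exact one_pos)
  have hψ1 : ∀ {a b : ℤ} {u v : F}, u ∈ primePow F a → v ∈ primePow F b → e ≤ a + b →
      ψ (u * v) = 1 := fun hu hv hab => map_eq_one_of_mem hψc hψ le_rfl (mul_mem_primePow_le hab hu hv)
  -- On `𝔭 ^ (m - r)` products lie in `𝔭 ^ m`, because `2r ≤ m`, so `x ↦ χ(1 + x)` is additive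
  -- there.
  obtain ⟨c₁, hc₁, hχ₁⟩ : ∃ c ∈ primePow F (e - m), ∀ x ∈ primePow F (m - r),
      extend χ (1 + x) = ψ (c * x) := by
    refine exists_eq_map_mul hψc hψ (θ := fun x => extend χ (1 + x)) (fun x hx y hy => ?_) (by omega)
      fun x hx => extend_eq_one h le_rfl (by rwa [add_sub_cancel_left])
    rw [← extend_mul, show (1 + x) * (1 + y) = (1 + (x + y)) + x * y by ring,
      extend_add h (one_add_mem_shell (by omega) (add_mem_primePow hx hy)) (k := m) (by omega)]
    exact mul_mem_primePow_le (by omega) hx hy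
  have hsq : ∀ {n : ℤ} {x : F}, x ∈ primePow F n → x ^ 2 / 2 ∈ primePow F (n + n) := fun hx => by
    rw [sq]; exact div_two_mem h2 (mul_mem_primePow hx hx)
  -- On the larger ideal additivity fails by exactly `ψ(c₁ x y)`; the further error has order three,
  -- and `m ≤ 3r` makes it invisible.
  have hmulχ : ∀ x ∈ primePow F r, ∀ y ∈ primePow F r,
      extend χ (1 + x) * extend χ (1 + y) = extend χ (1 + (x + y)) * ψ (c₁ * (x * y)) := by
    intro x hx y hy
    have hxy := add_mem_primePow hx hy
    have hs := one_add_mem_shell hr1 hxy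
    have hs0 := ne_zero_of_mem_shell hs
    set w := 1 + (x + y) with hw
    have hz : w⁻¹ * (x * y) ∈ primePow F (2 * r) := by
      have h3 := mul_mem_primePow_iff (m := 2 * r) (y := w⁻¹ * (x * y)) hs
      rw [mul_inv_cancel_left₀ hs0, sub_zero] at h3
      exact h3.1 (mul_mem_primePow_le (by omega) hx hy)
    have h3 : (1 + x) * (1 + y) = w * (1 + w⁻¹ * (x * y)) := by
      rw [mul_add w, mul_inv_cancel_left₀ hs0]; ring
    rw [← extend_mul, h3, extend_mul, hχ₁ _ (primePow_anti (by omega) hz)]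
    congr 1
    have h4 : c₁ * (x * y) = c₁ * (w⁻¹ * (x * y)) + c₁ * ((x + y) * (w⁻¹ * (x * y))) := by
      rw [hw] at hs0 ⊢
      field_simp
    rw [h4, AddChar.map_add_eq_mul, hψ1 hc₁ (mul_mem_primePow hxy hz) (by omega), mul_one]
  -- The function `ψ(c₁ (x - x²/2))` has the same defect of additivity, so the quotient is an
  -- additive character. It is trivial on `𝔭 ^ (m - r)`, hence of the form `ψ(δ x)` with `δ` small
  -- enough to be absorbed into `c = c₁ + δ`. No cubic term is needed, so `p = 3` is not
  -- exceptional.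
  obtain ⟨δ, hδ, hχ₂⟩ : ∃ δ ∈ primePow F (e - (m - r)), ∀ x ∈ primePow F r,
      extend χ (1 + x) * ψ (-(c₁ * (x - x ^ 2 / 2))) = ψ (δ * x) := by
    refine exists_eq_map_mul hψc hψ (θ := fun x => extend χ (1 + x) * ψ (-(c₁ * (x - x ^ 2 / 2))))
      (fun x hx y hy => ?_) (by omega) fun x hx => ?_
    · have h3 : -(c₁ * (x - x ^ 2 / 2)) + -(c₁ * (y - y ^ 2 / 2)) =
          -(c₁ * (x * y)) + -(c₁ * (x + y - (x + y) ^ 2 / 2)) := by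
        field_simp; ring
      have h4 := hmulχ x hx y hy
      have h5 : ψ (-(c₁ * (x - x ^ 2 / 2))) * ψ (-(c₁ * (y - y ^ 2 / 2))) =
          ψ (-(c₁ * (x * y))) * ψ (-(c₁ * (x + y - (x + y) ^ 2 / 2))) := by
        rw [← AddChar.map_add_eq_mul, ← AddChar.map_add_eq_mul, h3]
      have h6 : ψ (c₁ * (x * y)) * ψ (-(c₁ * (x * y))) = 1 := by
        rw [← AddChar.map_add_eq_mul, add_neg_cancel, AddChar.map_zero_eq_one]
      calc _ = extend χ (1 + (x + y)) * (ψ (c₁ * (x * y)) * ψ (-(c₁ * (x * y)))) *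
            ψ (-(c₁ * (x + y - (x + y) ^ 2 / 2))) := by rw [h6]; ring
        _ = (extend χ (1 + (x + y)) * ψ (c₁ * (x * y))) *
            (ψ (-(c₁ * (x * y))) * ψ (-(c₁ * (x + y - (x + y) ^ 2 / 2)))) := by ring
        _ = _ := by rw [← h4, ← h5]; ring
    · rw [hχ₁ x hx, ← AddChar.map_add_eq_mul,
        show c₁ * x + -(c₁ * (x - x ^ 2 / 2)) = c₁ * (x ^ 2 / 2) by ring]
      exact hψ1 hc₁ (hsq hx) (by omega)
  refine ⟨c₁ + δ, mem_shell_iff.2 ⟨add_mem_primePow hc₁ (primePow_anti (by omega) hδ), fun hc => ?_⟩,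
    fun x hx => ?_⟩
  · have hc' : c₁ ∈ primePow F (e - m + 1) :=
      (add_mem_primePow_iff (primePow_anti (by omega) hδ)).1 hc
    obtain ⟨u, hu, hu1, hu2⟩ := exists_extend_ne_one h (n := m - 1) (by omega) (by omega)
    refine hu2 ?_
    have h3 := hχ₁ (u - 1) (primePow_anti (by omega) hu1)
    rw [add_sub_cancel] at h3
    rw [h3]
    exact hψ1 hc' hu1 (by omega)
  · have h3 : (c₁ + δ) * (x - x ^ 2 / 2) = c₁ * (x - x ^ 2 / 2) + δ * x + -δ * (x ^ 2 / 2) := by ring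
    rw [h3, AddChar.map_add_eq_mul, AddChar.map_add_eq_mul, ← hχ₂ x hx,
      hψ1 (neg_mem_primePow hδ) (hsq hx) (by omega), mul_one, mul_left_comm, ← AddChar.map_add_eq_mul,
      add_neg_cancel, AddChar.map_zero_eq_one, mul_one]

/-- Only the critical coset `c (1 + 𝔭 ^ r)` contributes. On it the linear terms of `ψ(c (1 + t))`
and of `χ(1 + t)⁻¹` cancel, leaving `ψ(c t² / 2)`. -/
lemma gaussInt_eq_quadInt (hψc : Continuous ψ) (hψ : ψ ≠ 1) (h2 : ‖(2 : F)‖ = 1)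
    {r : ℤ} (hr1 : 1 ≤ r) (hr2 : 2 * r ≤ condMul χ) {c : F}
    (hc : c ∈ shell F (condAdd ψ - condMul χ))
    (hχ : ∀ x ∈ primePow F r, extend χ (1 + x) = ψ (c * (x - x ^ 2 / 2))) :
    gaussInt μ ψ χ = (residueCard F : ℂ) ^ (condMul χ - condAdd ψ) * (extend χ c)⁻¹ * ψ c *
      quadInt μ ψ r (c / 2) := by
  set m : ℤ := (condMul χ : ℤ) with hm
  set e := condAdd ψ with he
  set N := e - m with hN
  have h20 : (2 : F) ≠ 0 := norm_pos_iff.1 (by rw [h2]; exact one_pos)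
  have hc0 := ne_zero_of_mem_shell hc
  set f : F → ℂ := fun x => ψ x * extend χ⁻¹ x with hf
  set T : Set F := {x | x - c ∈ primePow F (N + r)} with hT
  have hTc : IsClopen T := (isClopen_primePow (N + r)).preimage (continuous_sub_right c)
  have hTs : T ⊆ shell F N := fun x hx => by
    have := (add_mem_shell_iff (n := N) (by omega) hx).2 hc
    rwa [add_sub_cancel] at this
  have hfc : ContinuousOn f (shell F N) :=
    hψc.continuousOn.mul (continuousOn_extend_shell χ⁻¹ N)
  have hfi : IntegrableOn f (shell F N) μ := hfc.integrableOn_compact (isCompact_shell N)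
  -- Shifting `x` by `t` in `𝔭 ^ (N + m - r)` multiplies the integrand by `ψ((1 - c/x) t)`, which is
  -- trivial for all such `t` only when `x - c` lies in `𝔭 ^ (N + r)`.
  have h3 : ∫ x in shell F N \ T, f x ∂μ = 0 := by
    refine setIntegral_eq_zero_of_cosets ((isClopen_shell N).diff hTc)
      ((isCompact_shell N).diff hTc.isOpen) (N + (m - r)) (fun x y hy => ?_)
      (hfc.mono Set.sdiff_subset) fun x hx => ?_
    · refine and_congr (add_mem_shell_iff (by omega) hy) (not_congr ?_)
      change x + y - c ∈ primePow F (N + r) ↔ x - c ∈ primePow F (N + r)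
      rw [add_sub_right_comm, add_mem_primePow_iff (primePow_anti (by omega) hy)]
    · have hx0 := ne_zero_of_mem_shell hx.1
      have h4 : ∀ t ∈ primePow F (N + (m - r)), f (x + t) = f x * ψ ((1 - c * x⁻¹) * t) := by
        intro t ht
        have hz : x⁻¹ * t ∈ primePow F (m - r) := by
          have h5 := mul_mem_primePow_iff (m := N + (m - r)) (y := x⁻¹ * t) hx.1
          rw [mul_inv_cancel_left₀ hx0, add_sub_cancel_left] at h5
          exact h5.1 ht
        have h5 : x + t = x * (1 + x⁻¹ * t) := by rw [mul_add, mul_one, mul_inv_cancel_left₀ hx0]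
        have h6 : ψ (c * ((x⁻¹ * t) ^ 2 / 2)) = 1 := by
          refine map_eq_one_of_mem hψc hψ le_rfl (mul_mem_primePow_le (b := (m - r) + (m - r))
            (by omega) (shell_subset _ hc) (div_two_mem h2 ?_))
          rw [sq]; exact mul_mem_primePow hz hz
        have h7 : extend χ (1 + x⁻¹ * t) = ψ (c * x⁻¹ * t) := by
          rw [hχ _ (primePow_anti (by omega) hz), mul_sub, sub_eq_add_neg, AddChar.map_add_eq_mul,
            AddChar.map_neg_eq_inv, h6, inv_one, mul_one, mul_assoc]
        have h8 : (1 - c * x⁻¹) * t = t + -(c * x⁻¹ * t) := by ring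
        simp only [hf]
        rw [AddChar.map_add_eq_mul, h5, extend_mul, extend_inv, extend_inv, h7, h8,
          AddChar.map_add_eq_mul, AddChar.map_neg_eq_inv]
        ring
      classical
      rw [setIntegral_congr_fun (measurableSet_primePow _) h4, integral_const_mul,
        setIntegral_addChar hψc hψ, if_neg, mul_zero]
      intro h5
      refine hx.2 ?_
      have h6 := (mul_mem_primePow_iff (m := N + r) hx.1).2 (primePow_anti (by omega) h5)
      rw [mul_sub, mul_one, mul_comm c, mul_inv_cancel_left₀ hx0] at h6
      exact h6
  have h4 : gaussInt μ ψ χ = ∫ x in T, f x ∂μ := by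
    have h5 : gaussInt μ ψ χ = ∫ x in (shell F N \ T) ∪ T, f x ∂μ := by
      rw [Set.sdiff_union_of_subset hTs]; rfl
    rw [h5, setIntegral_union Set.disjoint_sdiff_left hTc.isClosed.measurableSet
      (hfi.mono_set Set.sdiff_subset) (hfi.mono_set hTs), h3, zero_add]
  have hS : MeasurableSet {y : F | y - 1 ∈ primePow F r} :=
    (measurable_id.sub_const _) (measurableSet_primePow r)
  have h5 := setIntegral_comp_mul (μ := μ) hS hTc.isClosed.measurableSet hc0 (fun y => by
    change c * y - c ∈ primePow F (N + r) ↔ y - 1 ∈ primePow F r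
    rw [show c * y - c = c * (y - 1) by ring, mul_mem_primePow_iff hc, add_sub_cancel_left]) f
  have h6 := setIntegral_comp_add (μ := μ) (measurableSet_primePow r) hS 1 (fun y => by
    change y + 1 - 1 ∈ primePow F r ↔ _
    rw [add_sub_cancel_right]) fun y => f (c * y)
  have h7 : ∫ y in primePow F r, f (c * (y + 1)) ∂μ =
      (extend χ c)⁻¹ * ψ c * quadInt μ ψ r (c / 2) := by
    rw [quadInt, ← integral_const_mul]
    refine setIntegral_congr_fun (measurableSet_primePow r) fun t ht => ?_
    simp only [hf]
    have h8 : c * (t + 1) = c + c * t := by ring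
    have h9 : ψ (c * t) = ψ (c * (t - t ^ 2 / 2)) * ψ (c / 2 * t ^ 2) := by
      rw [← AddChar.map_add_eq_mul]; congr 1; ring
    have h10 : ψ (c * (t - t ^ 2 / 2)) ≠ 0 := by
      rw [← hχ t ht]
      exact extend_ne_zero (ne_zero_of_mem_shell (one_add_mem_shell hr1 ht))
    rw [extend_mul, extend_inv, extend_inv, add_comm t 1, hχ t ht, add_comm 1 t, h8,
      AddChar.map_add_eq_mul, h9]
    generalize ψ (c * (t - t ^ 2 / 2)) = A at h10
    generalize ψ (c / 2 * t ^ 2) = B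
    field_simp
  rw [h7] at h6
  rw [← h6, mem_shell.1 hc] at h5
  rw [h4]
  have h12 : ∫ x in T, f x ∂μ = (((residueCard F : ℝ) ^ (-N) : ℝ) : ℂ) *
      ((extend χ c)⁻¹ * ψ c * quadInt μ ψ r (c / 2)) := by
    rw [h5, ← mul_assoc, ← Complex.ofReal_mul, mul_inv_cancel₀ (zpow_pos (residueCard_pos F) _).ne', Complex.ofReal_one, one_mul]
  rw [h12, show m - e = -N by omega]
  push_cast
  ring

end StationaryPhase

end PadicEpsilon

end

noncomputable section

namespace PadicEpsilon

/-! ### Conductors under powers and tame twists. -/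

section Conductors

variable {F : Type*} [NontriviallyNormedField F] [IsUltrametricDist F] [IsNormalizedLocalField F]
  {χ η : Fˣ →ₜ* ℂˣ} {p d : ℕ}

variable (χ) in
lemma exists_extend_pow_prime_pow_eq_one (hp : ‖(p : F)‖ < 1) {n : ℤ} (hn : 1 ≤ n) {x : F}
    (hx : x - 1 ∈ primePow F n) : ∃ k : ℕ, extend χ x ^ p ^ k = 1 := by
  obtain ⟨m, -, hm⟩ := exists_extend_eq_one χ
  refine ⟨m, ?_⟩
  rw [← extend_pow_apply]
  exact hm _ (primePow_anti (by omega) (pow_prime_pow_sub_one_mem hp (primePow_anti hn hx) m))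

lemma eq_one_of_pow_eq_one_of_coprime {M : Type*} [Monoid M] {z : M} {k : ℕ} (hd : d.Coprime p)
    (h1 : z ^ d = 1) (h2 : z ^ p ^ k = 1) : z = 1 := by
  have h3 := pow_gcd_eq_one.2 ⟨h1, h2⟩
  rwa [(hd.pow_right k).gcd_eq_one, pow_one] at h3

lemma extend_pow_eq_one (hη : η ∈ dualModPow F d) {x : F} (hx : x ≠ 0) : extend η x ^ d = 1 := by
  have h1 : η (Units.mk0 x hx ^ d) = 1 := hη (Units.mk0 x hx)
  rw [extend_of_ne_zero hx, ← Units.val_pow_eq_pow_val, ← map_pow, h1, Units.val_one]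

/-- Characters of order prime to `p` are tame. -/
lemma extend_eq_one_of_mem_dualModPow (hp : ‖(p : F)‖ < 1) (hd : d.Coprime p)
    (hη : η ∈ dualModPow F d) {x : F} (hx : x - 1 ∈ primePow F 1) : extend η x = 1 := by
  obtain ⟨k, hk⟩ := exists_extend_pow_prime_pow_eq_one η hp le_rfl hx
  exact eq_one_of_pow_eq_one_of_coprime hd
    (extend_pow_eq_one hη (ne_zero_of_mem_shell (mem_shell_of_sub_one_mem le_rfl hx))) hk

lemma condMul_eq_one_iff (h : IsRamified χ) :
    condMul χ = 1 ↔ ∀ x, x - 1 ∈ primePow F 1 → extend χ x = 1 := by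
  constructor
  · intro h1 x hx
    exact extend_eq_one h (n := 1) (by omega) hx
  · intro h1
    refine condMul_eq_of h le_rfl h1 ?_
    obtain ⟨x, hx, hx1⟩ := h.exists_ne_one
    refine ⟨x, hx, ?_, hx1⟩
    exact sub_mem_primePow (shell_subset 0 hx) (shell_subset 0 one_mem_shell)

lemma isRamified_of_pow (h : IsRamified (χ ^ d)) : IsRamified χ := by
  obtain ⟨x, hx, hx1⟩ := h.exists_ne_one
  refine isRamified_of_extend_ne_one hx fun h1 => hx1 ?_
  rw [extend_pow _ (ne_zero_of_mem_shell hx), h1, one_pow]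

/-- Values of `χ` on `1 + 𝔭` have `p`-power order, so raising them to a power prime to `p` loses
nothing there. For conductor exponent `1` the ramification hypothesis on `χ ^ d` is what matters. -/
lemma condMul_pow (hp : ‖(p : F)‖ < 1) (hd : d.Coprime p) (h : IsRamified (χ ^ d)) :
    condMul (χ ^ d) = condMul χ := by
  have h1 := isRamified_of_pow h
  have hm := one_le_condMul h1
  refine condMul_eq_of h hm (fun x hx => ?_) ?_
  · have hx0 := ne_zero_of_mem_shell (mem_shell_of_sub_one_mem (by exact_mod_cast hm) hx)
    rw [extend_pow _ hx0, extend_eq_one h1 le_rfl hx, one_pow]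
  · rcases hm.eq_or_lt with hm1 | hm1
    · obtain ⟨x, hx, hx1⟩ := h.exists_ne_one
      refine ⟨x, hx, ?_, hx1⟩
      rw [← hm1]
      exact sub_mem_primePow (shell_subset 0 hx) (shell_subset 0 one_mem_shell)
    · obtain ⟨x, hx, hx1, hx2⟩ := exists_extend_ne_one h1 (n := condMul χ - 1) (by omega) (by omega)
      refine ⟨x, hx, hx1, fun h2 => hx2 ?_⟩
      rw [extend_pow _ (ne_zero_of_mem_shell hx)] at h2
      obtain ⟨k, hk⟩ := exists_extend_pow_prime_pow_eq_one χ hp (by omega) hx1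
      exact eq_one_of_pow_eq_one_of_coprime hd h2 hk

lemma mul_pow_eq_of_mem (hη : η ∈ dualModPow F d) {x : F} (hx : x ≠ 0) :
    extend (χ * η) x ^ d = extend χ x ^ d := by
  rw [extend_mul_char, mul_pow, extend_pow_eq_one hη hx, mul_one]

lemma isRamified_mul (hη : η ∈ dualModPow F d) (h : IsRamified (χ ^ d)) : IsRamified (χ * η) := by
  obtain ⟨x, hx, hx1⟩ := h.exists_ne_one
  have hx0 := ne_zero_of_mem_shell hx
  refine isRamified_of_extend_ne_one hx fun h1 => hx1 ?_
  rw [extend_pow _ hx0, ← mul_pow_eq_of_mem hη hx0, h1, one_pow]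

lemma condMul_mul (hp : ‖(p : F)‖ < 1) (hd : d.Coprime p) (hη : η ∈ dualModPow F d)
    (h : IsRamified (χ ^ d)) : condMul (χ * η) = condMul χ := by
  have h1 := isRamified_of_pow h
  have hm := one_le_condMul h1
  have key : ∀ x, x - 1 ∈ primePow F 1 → extend (χ * η) x = extend χ x := fun x hx => by
    rw [extend_mul_char, extend_eq_one_of_mem_dualModPow hp hd hη hx, mul_one]
  refine condMul_eq_of (isRamified_mul hη h) hm (fun x hx => ?_) ?_
  · rw [key x (primePow_anti (by omega) hx), extend_eq_one h1 le_rfl hx]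
  · rcases hm.eq_or_lt with hm1 | hm1
    · obtain ⟨x, hx, hx1⟩ := (isRamified_mul hη h).exists_ne_one
      refine ⟨x, hx, ?_, hx1⟩
      rw [← hm1]
      exact sub_mem_primePow (shell_subset 0 hx) (shell_subset 0 one_mem_shell)
    · obtain ⟨x, hx, hx1, hx2⟩ := exists_extend_ne_one h1 (n := condMul χ - 1) (by omega) (by omega)
      exact ⟨x, hx, hx1, by rwa [key x (primePow_anti (by omega) hx1)]⟩

lemma eq_one_of_pow_eq_one (hd : ‖(d : F)‖ = 1) {u : F} (hu : u - 1 ∈ primePow F 1)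
    (h : u ^ d = 1) : u = 1 := by
  have h1 := mul_geom_sum u d
  rw [h, sub_self, mul_eq_zero, sub_eq_zero] at h1
  refine h1.resolve_right fun h2 => ?_
  have h3 : ∑ i ∈ Finset.range d, u ^ i = ∑ i ∈ Finset.range d, (u ^ i - 1) + d := by
    simp [Finset.sum_sub_distrib]
  have h4 : ∑ i ∈ Finset.range d, (u ^ i - 1) ∈ primePow F 1 :=
    Finset.sum_induction _ (· ∈ primePow F 1) (fun _ _ => add_mem_primePow) (zero_mem_primePow 1)
      fun i _ => pow_sub_one_mem (by omega) hu i
  have h5 : (d : F) ∈ primePow F 1 := by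
    have := neg_mem_primePow h4
    rwa [show -∑ i ∈ Finset.range d, (u ^ i - 1) = d by linear_combination h3 - h2] at this
  rw [mem_primePow_one, hd] at h5
  exact lt_irrefl _ h5

lemma red_pow {x : F} (hx : x ∈ primePow F 0) (n : ℕ) : red (x ^ n) = red x ^ n := by
  obtain ⟨y, rfl⟩ := exists_coe_eq hx
  rw [red_coe, ← map_pow, ← red_coe]; rfl

/-- Reduction is injective on `d`-th roots of unity: a principal unit `u` with `u ^ d = 1` is `1`,
because `d` is a unit. -/
lemma dvd_card_residue_sub_one (hd : ‖(d : F)‖ = 1) {ζ : F} (hζ : IsPrimitiveRoot ζ d) :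
    d ∣ Nat.card (Valued.ResidueField F) - 1 := by
  classical
  have := Fintype.ofFinite (Valued.ResidueField F)
  have hd0 : d ≠ 0 := by rintro rfl; simp at hd
  have hn : ‖ζ‖ = 1 := by
    have h1 : ‖ζ‖ ^ d = 1 := by rw [← norm_pow, hζ.pow_eq_one, norm_one]
    exact (pow_eq_one_iff_of_nonneg (norm_nonneg ζ) hd0).1 h1
  have hζ0 : ζ ∈ primePow F 0 := mem_primePow_zero.2 hn.le
  have h1 : ∀ j, red ζ ^ j = 1 ↔ ζ ^ j = 1 := by
    intro j
    constructor
    · intro h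
      refine eq_one_of_pow_eq_one hd ?_ (by rw [← pow_mul, mul_comm, pow_mul, hζ.pow_eq_one, one_pow])
      rw [← red_eq_iff (mem_primePow_zero.2 (by rw [norm_pow, hn, one_pow]))
        (shell_subset 0 one_mem_shell), red_pow hζ0, h, red_one]
    · intro h
      rw [← red_pow hζ0, h, red_one]
  have hr : red ζ ≠ 0 := by
    rw [red_ne_zero_iff hζ0]; simpa [mem_shell] using hn
  refine (hζ.dvd_of_pow_eq_one _ ((h1 _).1 ?_))
  rw [Nat.card_eq_fintype_card]
  exact FiniteField.pow_card_sub_one_eq_one _ hr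

end Conductors

/-! ### Scaling the additive character, and the Weil index. -/

section MulShift

variable {F : Type*} [NontriviallyNormedField F] [IsUltrametricDist F] [IsNormalizedLocalField F]
  {ψ : AddChar F ℂ} {a : F}

lemma continuous_mulShift (hψc : Continuous ψ) (a : F) : Continuous (ψ.mulShift a) := by
  have : (ψ.mulShift a : F → ℂ) = fun x => ψ (a * x) := by ext x; rw [AddChar.mulShift_apply]
  rw [this]
  fun_prop

lemma mulShift_ne_one_of_ne_zero (hψ : ψ ≠ 1) (ha : a ≠ 0) : ψ.mulShift a ≠ 1 := by
  obtain ⟨x, hx⟩ := AddChar.ne_one_iff.1 hψ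
  refine AddChar.ne_one_iff.2 ⟨a⁻¹ * x, ?_⟩
  rwa [AddChar.mulShift_apply, mul_inv_cancel_left₀ ha]

lemma condAdd_mulShift (ha : ‖a‖ = 1) : condAdd (ψ.mulShift a) = condAdd ψ := by
  have ha' : a ∈ shell F 0 := by simpa [mem_shell] using ha
  rw [condAdd, condAdd]
  congr 1
  ext n
  constructor
  · intro h x hx
    have h1 := h (a⁻¹ * x) (by
      rw [← sub_zero n, ← mul_mem_primePow_iff ha', mul_inv_cancel_left₀ (ne_zero_of_mem_shell ha')]
      exact hx)
    rwa [AddChar.mulShift_apply, mul_inv_cancel_left₀ (ne_zero_of_mem_shell ha')] at h1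
  · intro h x hx
    rw [AddChar.mulShift_apply]
    exact h _ (by rwa [mul_mem_primePow_iff ha', sub_zero])

variable [MeasurableSpace F] [BorelSpace F]

lemma isSelfDual_mulShift_iff {μ : Measure F} [μ.IsAddHaarMeasure] (hψc : Continuous ψ) (hψ : ψ ≠ 1)
    (ha : ‖a‖ = 1) : IsSelfDual (ψ.mulShift a) μ ↔ IsSelfDual ψ μ := by
  have ha0 : a ≠ 0 := norm_pos_iff.1 (by rw [ha]; exact one_pos)
  rw [isSelfDual_iff (continuous_mulShift hψc a) (mulShift_ne_one_of_ne_zero hψ ha0),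
    isSelfDual_iff hψc hψ, condAdd_mulShift ha]

lemma IsSelfDual.unique {μ ν : Measure F} (hψc : Continuous ψ) (hψ : ψ ≠ 1) (hμ : IsSelfDual ψ μ)
    (hν : IsSelfDual ψ ν) : μ = ν := by
  have := hμ.1
  have := hν.1
  have h1 : μ.real (primePow F 0) = ν.real (primePow F 0) := by
    have := (isSelfDual_iff hψc hψ).1 hμ
    rw [← (isSelfDual_iff hψc hψ).1 hν] at this
    exact (pow_left_inj₀ measureReal_nonneg measureReal_nonneg two_ne_zero).1 this
  have h2 : μ (primePow F 0) = ν (primePow F 0) :=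
    (measureReal_eq_measureReal_iff (isCompact_primePow 0).measure_lt_top.ne
      (isCompact_primePow 0).measure_lt_top.ne).1 h1
  let K : TopologicalSpace.PositiveCompacts F :=
    { carrier := primePow F 0
      isCompact' := isCompact_primePow 0
      interior_nonempty' := by
        rw [(isOpen_primePow 0).interior_eq]; exact ⟨0, zero_mem_primePow 0⟩ }
  rw [Measure.addHaarMeasure_unique μ K, Measure.addHaarMeasure_unique ν K]
  congr 1

lemma selfDual_mulShift (hψc : Continuous ψ) (hψ : ψ ≠ 1) (ha : ‖a‖ = 1) :
    selfDual (ψ.mulShift a) = selfDual ψ := by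
  have ha0 : a ≠ 0 := norm_pos_iff.1 (by rw [ha]; exact one_pos)
  have h := isSelfDual_selfDual _ (continuous_mulShift hψc a) (mulShift_ne_one_of_ne_zero hψ ha0)
  have := h.1
  exact IsSelfDual.unique hψc hψ ((isSelfDual_mulShift_iff hψc hψ ha).1 h) (isSelfDual_selfDual ψ hψc hψ)

lemma quadInt_mulShift (μ : Measure F) (n : ℤ) (a b : F) :
    quadInt μ (ψ.mulShift a) n b = quadInt μ ψ n (a * b) := by
  simp only [quadInt, AddChar.mulShift_apply, mul_assoc]

/-- The sequence in the limit is eventually constant by `quadInt_eq`, and the factor `|2|^(1/2)` is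
`1`. -/
lemma weilIndex_eq (hψc : Continuous ψ) (hψ : ψ ≠ 1) (h2 : ‖(2 : F)‖ = 1) {n : ℤ}
    (hn : 2 * n ≤ condAdd ψ) : weilIndex ψ = quadInt (selfDual ψ) ψ n 1 := by
  have := (isSelfDual_selfDual ψ hψc hψ).1
  rw [weilIndex, h2, Real.one_rpow, Complex.ofReal_one, one_mul]
  refine Tendsto.limUnder_eq (tendsto_const_nhds.congr' ?_)
  filter_upwards [eventually_ge_atTop n.natAbs] with r hr
  rw [quadInt_eq (a' := -(r : ℤ)) hψc hψ h2 (one_mem_shell (F := F)) (by omega) (by omega), quadInt]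
  simp only [one_mul]

end MulShift

/-! ### Tame characters and characters of the residue field. -/

section ResidueMulChar

variable {F : Type*} [NontriviallyNormedField F] [IsUltrametricDist F] [IsNormalizedLocalField F]
  {χ η : Fˣ →ₜ* ℂˣ}

/-- A character of `Fˣ` is tame if it is trivial on `1 + 𝔭`. -/
def IsTame (χ : Fˣ →ₜ* ℂˣ) : Prop := ∀ x, x - 1 ∈ primePow F 1 → extend χ x = 1

lemma IsTame.mul (h : IsTame χ) (h' : IsTame η) : IsTame (χ * η) := fun x hx => by
  rw [extend_mul_char, h x hx, h' x hx, mul_one]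

lemma IsTame.inv (h : IsTame χ) : IsTame χ⁻¹ := fun x hx => by
  rw [extend_inv, h x hx, inv_one]

lemma IsTame.extend_eq (h : IsTame χ) {x y : F} (hx : x ∈ shell F 0) (hxy : y - x ∈ primePow F 1) :
    extend χ y = extend χ x := by
  have hx0 := ne_zero_of_mem_shell hx
  have h1 : x⁻¹ * y - 1 ∈ primePow F 1 := by
    rw [← sub_zero (1 : ℤ), ← mul_mem_primePow_iff hx, mul_sub, mul_inv_cancel_left₀ hx0, mul_one]
    exact hxy
  have h2 := h _ h1
  rw [extend_mul, extend_inv_apply] at h2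
  exact (inv_mul_eq_one₀ (extend_ne_zero hx0)).1 h2 |>.symm

lemma resLift_mem_shell {r : Valued.ResidueField F} (hr : r ≠ 0) : resLift r ∈ shell F 0 := by
  rwa [← red_ne_zero_iff (resLift_mem r), red_resLift]

open Classical in
/-- The multiplicative character of the residue field induced by a tame character. -/
def resMulChar (h : IsTame χ) : MulChar (Valued.ResidueField F) ℂ where
  toFun r := if r = 0 then 0 else extend χ (resLift r)
  map_one' := by
    rw [if_neg one_ne_zero]
    refine h _ ?_
    rw [← red_eq_iff (resLift_mem _) (shell_subset 0 one_mem_shell), red_resLift, red_one]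
  map_mul' r s := by
    by_cases hr : r = 0
    · simp [hr]
    by_cases hs : s = 0
    · simp [hs]
    simp only [if_neg hr, if_neg hs, if_neg (mul_ne_zero hr hs)]
    have hr' := resLift_mem_shell hr
    have hs' := resLift_mem_shell hs
    rw [← extend_mul]
    refine h.extend_eq (by rw [mul_mem_shell_iff hr', sub_zero]; exact hs') ?_
    rw [← red_eq_iff (resLift_mem _) (mul_mem_primePow_le (by omega) (shell_subset 0 hr')
      (shell_subset 0 hs')), red_mul (shell_subset 0 hr') (shell_subset 0 hs')]
    simp only [red_resLift]
  map_nonunit' r hr := by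
    rw [isUnit_iff_ne_zero, not_not] at hr
    rw [if_pos hr]

lemma resMulChar_red (h : IsTame χ) {x : F} (hx : x ∈ shell F 0) :
    resMulChar h (red x) = extend χ x := by
  have hr : red x ≠ 0 := (red_ne_zero_iff (shell_subset 0 hx)).2 hx
  classical
  change (if red x = 0 then 0 else extend χ (resLift (red x))) = _
  rw [if_neg hr]
  refine h.extend_eq hx ?_
  rw [← red_eq_iff (resLift_mem _) (shell_subset 0 hx), red_resLift]

lemma resMulChar_eq (h : IsTame χ) {κ : MulChar (Valued.ResidueField F) ℂ}
    (hκ : ∀ x ∈ shell F 0, extend χ x = κ (red x)) : resMulChar h = κ := by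
  refine MulChar.ext fun a => ?_
  have ha := resLift_mem_shell a.ne_zero
  have h1 := resMulChar_red h ha
  rw [red_resLift] at h1
  rw [h1, hκ _ ha, red_resLift]

end ResidueMulChar

/-! ### Gauss integrals of conductor `1` as finite Gauss sums. -/

section TameGauss

variable {F : Type*} [NontriviallyNormedField F] [IsUltrametricDist F] [IsNormalizedLocalField F]
  [MeasurableSpace F] [BorelSpace F] {μ : Measure F} [μ.IsAddHaarMeasure]
  {χ : Fˣ →ₜ* ℂˣ} {ψ : AddChar F ℂ} [Fintype (Valued.ResidueField F)]

/-- Scaling by `w` moves the integral to the units, where the integrand depends only on the residue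
class. The finite character comes from `χ⁻¹`, since the Gauss integral contains `χ⁻¹`. -/
lemma gaussInt_tame (hψc : Continuous ψ) (hψ : ψ ≠ 1) (h1 : condMul χ = 1)
    (ht : IsTame χ⁻¹) {w : F} (hw : w ∈ shell F (condAdd ψ - 1)) :
    gaussInt μ ψ χ = (residueCard F : ℂ) ^ (-condAdd ψ) * μ.real (primePow F 0) * (extend χ w)⁻¹ *
      gaussSum (resMulChar ht) (resAddChar hψc hψ (shell_subset _ hw)) := by
  have hq := residueCard_ne_zero F
  have hw0 := ne_zero_of_mem_shell hw
  have hc := shell_subset _ hw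
  have e1 := setIntegral_comp_mul (μ := μ) (measurableSet_shell 0)
    (measurableSet_shell (condAdd ψ - 1)) hw0
    (fun x => by rw [mul_mem_shell_iff hw, sub_self]) fun x => ψ x * extend χ⁻¹ x
  have e2 : ∫ x in shell F 0, ψ (w * x) * extend χ⁻¹ (w * x) ∂μ = (extend χ w)⁻¹ *
      ∫ x in primePow F 0, resMulChar ht (red x) * ψ (w * x) ∂μ := by
    have e3 : ∫ x in primePow F 0, resMulChar ht (red x) * ψ (w * x) ∂μ =
        ∫ x in shell F 0, resMulChar ht (red x) * ψ (w * x) ∂μ := by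
      refine (setIntegral_eq_of_subset_of_forall_sdiff_eq_zero (measurableSet_primePow 0)
        (shell_subset 0) fun x hx => ?_)
      have : red x = 0 := by
        by_contra h
        exact hx.2 ((red_ne_zero_iff hx.1).1 h)
      rw [this, MulChar.map_zero, zero_mul]
    rw [e3, ← integral_const_mul]
    refine setIntegral_congr_fun (measurableSet_shell 0) fun x hx => ?_
    rw [resMulChar_red ht hx, extend_mul, extend_inv χ w]
    ring
  have e4 : ∫ x in primePow F 0, resMulChar ht (red x) * ψ (w * x) ∂μ =
      μ.real (primePow F 1) * gaussSum (resMulChar ht) (resAddChar hψc hψ hc) := by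
    rw [setIntegral_primePow_eq_sum, gaussSum, zero_add]
    · congr 1
      refine Finset.sum_congr rfl fun r _ => ?_
      rw [zpow_zero, one_mul, red_resLift]; rfl
    · intro x hx y hy
      rw [zero_add] at hy
      have : red (x + y) = red x :=
        (red_eq_iff (add_mem_primePow hx (primePow_anti (by omega) hy)) hx).2
          (by rwa [add_sub_cancel_left])
      rw [this, mul_add, AddChar.map_add_eq_mul, map_mul_eq_one hψc hψ hc hy, mul_one]
  rw [e2, e4] at e1
  have e5 : gaussInt μ ψ χ = ((‖w‖ : ℝ) : ℂ) * ((extend χ w)⁻¹ * (μ.real (primePow F 1) *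
      gaussSum (resMulChar ht) (resAddChar hψc hψ hc))) := by
    rw [e1, gaussInt, h1, ← mul_assoc, ← Complex.ofReal_mul, mul_inv_cancel₀ (norm_ne_zero_iff.2 hw0)]
    simp
  rw [e5, mem_shell.1 hw, measureReal_primePow μ 1, neg_sub, sub_eq_add_neg, add_comm,
    zpow_add₀ (residueCard_pos F).ne', zpow_one, zpow_neg_one]
  push_cast
  field_simp

end TameGauss

end PadicEpsilon

end

noncomputable section

namespace PadicEpsilon

/-! ### Lifts of the characters of the residue field. -/

section Lift

variable {F : Type*} [NontriviallyNormedField F] [IsUltrametricDist F] [IsNormalizedLocalField F]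
  {d : ℕ} {J : Subgroup (Fˣ →ₜ* ℂˣ)}

lemma exists_unit_of_mem_shell {x : F} (hx : x ∈ shell F 0) :
    ∃ u : (Valued.integer F)ˣ, ((unitsIncl u : Fˣ) : F) = x ∧
      ((unitsResidue u : (Valued.ResidueField F)ˣ) : Valued.ResidueField F) = red x := by
  have hx1 : ‖x‖ = 1 := by simpa [mem_shell] using hx
  obtain ⟨u, hu⟩ : IsUnit (⟨x, Valued.integer.mem_iff.2 hx1.le⟩ : Valued.integer F) :=
    Valued.integer.isUnit_iff_norm_eq_one.2 hx1
  have h1 : ((u : Valued.integer F) : F) = x := by rw [hu]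
  refine ⟨u, h1, ?_⟩
  rw [← h1, red_coe]; rfl

lemma mulChar_pow_eq_one_iff {k : Type*} [Field k] (κ : kˣ →* ℂˣ) (d : ℕ) :
    (MulChar.ofUnitHom κ) ^ d = 1 ↔ ∀ x, κ (x ^ d) = 1 := by
  rw [MulChar.ext_iff]
  refine forall_congr' fun x => ?_
  rw [MulChar.pow_apply_coe, MulChar.ofUnitHom_coe, MulChar.one_apply_coe, map_pow,
    ← Units.val_pow_eq_pow_val, Units.val_eq_one]

lemma IsLift.exists_equiv (hJ : IsLift d J) :
    ∃ E : J ≃ {κ : MulChar (Valued.ResidueField F) ℂ // κ ^ d = 1},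
      ∀ η : J, ∀ x ∈ shell F 0, extend (η : Fˣ →ₜ* ℂˣ) x = (E η).1 (red x) := by
  obtain ⟨-, Φ, hΦ⟩ := hJ
  refine ⟨Φ.toEquiv.trans (MulChar.equivToUnitHom.symm.subtypeEquiv fun κ =>
    (mulChar_pow_eq_one_iff κ d).symm), fun η x hx => ?_⟩
  obtain ⟨u, hu, hur⟩ := exists_unit_of_mem_shell hx
  rw [← hu, extend_coe, hΦ, hu, ← hur]
  exact (MulChar.ofUnitHom_coe _ _).symm

end Lift

/-! ### Classification of tame and of quadratic characters. -/

section TameChar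

variable {F : Type*} [NontriviallyNormedField F] [IsUltrametricDist F] [IsNormalizedLocalField F]

/-- The normalized valuation of a nonzero element. -/
def unitVal (x : Fˣ) : ℤ := (exists_mem_shell x.ne_zero).choose

lemma mem_shell_unitVal (x : Fˣ) : (x : F) ∈ shell F (unitVal x) :=
  (exists_mem_shell x.ne_zero).choose_spec

lemma unitVal_eq {x : Fˣ} {n : ℤ} (h : (x : F) ∈ shell F n) : unitVal x = n :=
  shell_unique (mem_shell_unitVal x) h

lemma unitVal_mul (x y : Fˣ) : unitVal (x * y) = unitVal x + unitVal y := by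
  refine unitVal_eq ?_
  rw [Units.val_mul, mul_mem_shell_iff (mem_shell_unitVal x), add_sub_cancel_left]
  exact mem_shell_unitVal y

lemma unif_zpow_neg_mul_mem_shell {x : F} {n : ℤ} (hx : x ∈ shell F n) : unif F ^ (-n) * x ∈ shell F 0 := by
  rw [mul_mem_shell_iff (unif_zpow_mem_shell (-n)), zero_sub, neg_neg]
  exact hx

/-- The tame character of `Fˣ` with a given value at the uniformizer and a given restriction
to the units. -/
def tameChar (z : ℂˣ) (κ : MulChar (Valued.ResidueField F) ℂ) : Fˣ →ₜ* ℂˣ where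
  toMonoidHom := MonoidHom.toHomUnits
    { toFun := fun x => ((z ^ unitVal x : ℂˣ) : ℂ) * κ (red (unif F ^ (-unitVal x) * (x : F)))
      map_one' := by
        have h : unitVal (1 : Fˣ) = 0 := unitVal_eq (by rw [Units.val_one]; exact one_mem_shell)
        rw [h, neg_zero, zpow_zero, zpow_zero, one_mul, Units.val_one, Units.val_one, red_one, map_one,
          one_mul]
      map_mul' := fun x y => by
        have hx := unif_zpow_neg_mul_mem_shell (mem_shell_unitVal x)
        have hy := unif_zpow_neg_mul_mem_shell (mem_shell_unitVal y)
        have h1 : unif F ^ (-unitVal (x * y)) * ((x * y : Fˣ) : F) =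
            (unif F ^ (-unitVal x) * (x : F)) * (unif F ^ (-unitVal y) * (y : F)) := by
          rw [unitVal_mul, neg_add, zpow_add₀ (unif_ne_zero F), Units.val_mul]; ring
        rw [h1, red_mul (shell_subset 0 hx) (shell_subset 0 hy), map_mul, unitVal_mul, zpow_add,
          Units.val_mul]
        ring }
  continuous_toFun := by
    refine continuous_of_continuousAt_one (MonoidHom.toHomUnits _) ?_
    refine ContinuousAt.congr (f := fun _ => (1 : ℂˣ)) continuousAt_const ?_
    have h1 : (fun u : Fˣ => (u : F) - 1) ⁻¹' primePow F 1 ∈ 𝓝 (1 : Fˣ) :=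
      ((isOpen_primePow 1).preimage (Units.continuous_val.sub continuous_const)).mem_nhds
        (by simpa using zero_mem_primePow (F := F) 1)
    filter_upwards [h1] with u hu
    have hu0 := mem_shell_of_sub_one_mem le_rfl hu
    refine Units.ext ?_
    rw [MonoidHom.coe_toHomUnits]
    change _ = ((z ^ unitVal u : ℂˣ) : ℂ) * κ (red (unif F ^ (-unitVal u) * (u : F)))
    have h2 : red (u : F) = 1 := by
      rw [← red_one, red_eq_iff (shell_subset 0 hu0) (shell_subset 0 one_mem_shell)]; exact hu
    rw [unitVal_eq hu0, neg_zero, zpow_zero, zpow_zero, one_mul, h2, map_one, Units.val_one, one_mul]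

variable (z : ℂˣ) (κ : MulChar (Valued.ResidueField F) ℂ)

lemma extend_tameChar {x : F} {n : ℤ} (hx : x ∈ shell F n) :
    extend (tameChar z κ) x = (z : ℂ) ^ n * κ (red (unif F ^ (-n) * x)) := by
  have hx0 := ne_zero_of_mem_shell hx
  rw [extend_of_ne_zero hx0, ← unitVal_eq (x := Units.mk0 x hx0) hx, ← Units.val_zpow_eq_zpow_val]
  rfl

lemma extend_tameChar_of_unit {x : F} (hx : x ∈ shell F 0) : extend (tameChar z κ) x = κ (red x) := by
  rw [extend_tameChar z κ hx, zpow_zero, neg_zero, zpow_zero, one_mul, one_mul]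

lemma extend_tameChar_unif_zpow (n : ℤ) : extend (tameChar z κ) (unif F ^ n) = (z : ℂ) ^ n := by
  rw [extend_tameChar z κ (unif_zpow_mem_shell n), ← zpow_add₀ (unif_ne_zero F), neg_add_cancel,
    zpow_zero, red_one, map_one, mul_one]

lemma isTame_tameChar : IsTame (tameChar (F := F) z κ) := fun x hx => by
  have hx0 := mem_shell_of_sub_one_mem le_rfl hx
  have h2 : red x = 1 := by
    rw [← red_one, red_eq_iff (shell_subset 0 hx0) (shell_subset 0 one_mem_shell)]; exact hx
  rw [extend_tameChar_of_unit z κ hx0, h2, map_one]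

lemma ext_extend {χ η : Fˣ →ₜ* ℂˣ} (h : ∀ n, ∀ x ∈ shell F n, extend χ x = extend η x) : χ = η := by
  refine ContinuousMonoidHom.ext fun u => Units.ext ?_
  rw [← extend_coe, ← extend_coe]
  exact h _ _ (mem_shell_unitVal u)

lemma eq_tameChar {χ : Fˣ →ₜ* ℂˣ} (h : IsTame χ) :
    χ = tameChar (χ (Units.mk0 (unif F) (unif_ne_zero F))) (resMulChar h) := by
  refine ext_extend fun n x hx => ?_
  have hu := unif_zpow_neg_mul_mem_shell hx
  rw [extend_tameChar _ _ hx, resMulChar_red h hu, extend_mul, zpow_neg, extend_inv_apply]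
  have h1 : extend χ (unif F ^ n) = ((χ (Units.mk0 (unif F) (unif_ne_zero F)) : ℂˣ) : ℂ) ^ n := by
    rw [← Units.val_zpow_eq_zpow_val, ← map_zpow, ← extend_coe, Units.val_zpow_eq_zpow_val,
      Units.val_mk0]
  rw [← h1, mul_inv_cancel_left₀ (extend_ne_zero (zpow_ne_zero _ (unif_ne_zero F)))]

lemma tameChar_mem_dualModPow {d : ℕ} (hz : z ^ d = 1) (hκ : κ ^ d = 1) :
    tameChar z κ ∈ dualModPow F d := by
  intro x
  refine Units.ext ?_
  obtain ⟨n, hn⟩ := exists_mem_shell x.ne_zero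
  have hr : red (unif F ^ (-n) * (x : F)) ≠ 0 :=
    (red_ne_zero_iff (shell_subset 0 (unif_zpow_neg_mul_mem_shell hn))).2 (unif_zpow_neg_mul_mem_shell hn)
  rw [map_pow, Units.val_pow_eq_pow_val, ← extend_coe, extend_tameChar z κ hn, mul_pow,
    ← Units.val_zpow_eq_zpow_val, ← Units.val_pow_eq_pow_val, ← zpow_natCast, zpow_comm, zpow_natCast,
    hz, one_zpow, Units.val_one, one_mul]
  lift red (unif F ^ (-n) * (x : F)) to (Valued.ResidueField F)ˣ using hr.isUnit with r
  rw [← MulChar.pow_apply_coe, hκ, MulChar.one_apply_coe]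

/-- A quadratic character is tame because `p` is odd, so it is determined by its sign at the
uniformizer and a residue character of order dividing `2`. -/
lemma exists_bijective_tameChar {p : ℕ} (hp : ‖(p : F)‖ < 1) (hodd : Odd p) :
    ∃ T : Bool × {κ : MulChar (Valued.ResidueField F) ℂ // κ ^ 2 = 1} → dualModPow F 2,
      Function.Bijective T ∧ ∀ a, (T a : Fˣ →ₜ* ℂˣ) = tameChar (if a.1 then 1 else -1) a.2.1 := by
  have hcop : Nat.Coprime 2 p := (Nat.coprime_two_left).2 hodd
  let T : Bool × {κ : MulChar (Valued.ResidueField F) ℂ // κ ^ 2 = 1} → dualModPow F 2 := fun a =>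
    ⟨tameChar (if a.1 then 1 else -1) a.2.1, tameChar_mem_dualModPow _ _ (by split_ifs <;> simp) a.2.2⟩
  refine ⟨T, ?_, fun _ => rfl⟩
  constructor
  · rintro ⟨b, κ⟩ ⟨b', κ'⟩ h
    have h1 : tameChar (F := F) (if b then 1 else -1) κ.1 = tameChar (if b' then 1 else -1) κ'.1 :=
      congrArg Subtype.val h
    have h2 := extend_tameChar_unif_zpow (F := F) (if b then 1 else -1) κ.1 1
    rw [h1, extend_tameChar_unif_zpow] at h2
    have h3 : κ.1 = κ'.1 := by
      refine MulChar.ext fun r => ?_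
      have hr := resLift_mem_shell (F := F) r.ne_zero
      have h4 := extend_tameChar_of_unit (if b then 1 else -1) κ.1 hr
      rw [h1, extend_tameChar_of_unit _ _ hr, red_resLift] at h4
      exact h4.symm
    have h5 : b = b' := by
      have h6 : (-1 : ℂ) ≠ 1 := by norm_num
      cases b <;> cases b' <;> simp [h6, h6.symm] at h2 ⊢
    rw [h5, Subtype.ext h3]
  · rintro ⟨β, hβ⟩
    have ht : IsTame β := fun x hx => extend_eq_one_of_mem_dualModPow hp hcop hβ hx
    have hκ : resMulChar ht ^ 2 = 1 := by
      refine MulChar.ext fun r => ?_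
      have hr := resLift_mem_shell (F := F) r.ne_zero
      rw [MulChar.pow_apply_coe, MulChar.one_apply_coe, ← red_resLift (r : Valued.ResidueField F),
        resMulChar_red ht hr, extend_pow_eq_one hβ (ne_zero_of_mem_shell hr)]
    set z := β (Units.mk0 (unif F) (unif_ne_zero F)) with hz
    have hz2 : z ^ 2 = 1 := by rw [hz, ← map_pow]; exact hβ _
    have hz3 : (z : ℂ) = 1 ∨ (z : ℂ) = -1 := 
      sq_eq_one_iff.1 (by simpa using congrArg Units.val hz2)
    rcases hz3 with hz4 | hz4
    · refine ⟨⟨true, ⟨_, hκ⟩⟩, Subtype.ext ?_⟩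
      have : z = 1 := Units.ext hz4
      change tameChar 1 (resMulChar ht) = β
      conv_rhs => rw [eq_tameChar ht, ← hz, this]
    · refine ⟨⟨false, ⟨_, hκ⟩⟩, Subtype.ext ?_⟩
      have : z = -1 := Units.ext hz4
      change tameChar (-1) (resMulChar ht) = β
      conv_rhs => rw [eq_tameChar ht, ← hz, this]

lemma finite_dualModPow_two {p : ℕ} (hp : ‖(p : F)‖ < 1) (hodd : Odd p) :
    Finite (dualModPow F 2) := by
  classical
  obtain ⟨T, hT, -⟩ := exists_bijective_tameChar hp hodd
  exact Finite.of_surjective T hT.2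

open Classical in
lemma finprod_dualModPow_two [Fintype (Valued.ResidueField F)]
    [Fintype (MulChar (Valued.ResidueField F) ℂ)]
    {p : ℕ} (hp : ‖(p : F)‖ < 1) (hodd : Odd p) (f : (Fˣ →ₜ* ℂˣ) → ℂ) :
    ∏ᶠ β : dualModPow F 2, f β =
      ∏ κ ∈ torsionChars (Valued.ResidueField F) 2, f (tameChar 1 κ) * f (tameChar (-1) κ) := by
  obtain ⟨T, hT, hT'⟩ := exists_bijective_tameChar hp hodd
  rw [← finprod_eq_of_bijective T hT (f := fun a => f (T a)) (fun _ => rfl),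
    finprod_eq_prod_of_fintype, Fintype.prod_prod_type_right,
    Finset.prod_subtype (torsionChars (Valued.ResidueField F) 2) (fun κ => mem_torsionChars)]
  refine Finset.prod_congr rfl fun κ _ => ?_
  rw [Fintype.prod_bool, hT', hT']
  rfl

end TameChar

end PadicEpsilon

end

noncomputable section

namespace PadicEpsilon

/-! ### Products of values over a lift. -/

section LiftProducts

variable {F : Type*} [NontriviallyNormedField F] [IsUltrametricDist F] [IsNormalizedLocalField F]
  {d : ℕ} {J : Subgroup (Fˣ →ₜ* ℂˣ)}

lemma IsLift.finite (hJ : IsLift d J) : Finite J := by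
  classical
  obtain ⟨E, -⟩ := hJ.exists_equiv
  exact Finite.of_equiv _ E.symm

lemma IsLift.card_eq (hJ : IsLift d J) (hd : d ∣ Nat.card (Valued.ResidueField F) - 1) :
    Nat.card J = d := by
  classical
  have := Fintype.ofFinite (Valued.ResidueField F)
  have := Fintype.ofFinite (MulChar (Valued.ResidueField F) ℂ)
  obtain ⟨E, -⟩ := hJ.exists_equiv
  rw [Nat.card_congr E, Nat.subtype_card _ fun κ => mem_torsionChars, card_torsionChars hd]

lemma IsLift.isTame (hJ : IsLift d J) (η : J) : IsTame (η : Fˣ →ₜ* ℂˣ) := fun x hx => by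
  obtain ⟨E, hE⟩ := hJ.exists_equiv
  have hx0 := mem_shell_of_sub_one_mem le_rfl hx
  have h2 : red x = 1 := by
    rw [← red_one, red_eq_iff (shell_subset 0 hx0) (shell_subset 0 one_mem_shell)]; exact hx
  rw [hE η x hx0, h2, map_one]

/-- Inversion in `J` shows that the product squares to `1`, while its `d`-th power is also `1`; as
`d` is odd, it is `1`. -/
lemma IsLift.finprod_extend (hJ : IsLift d J) (hd : Odd d) {x : F} (hx : x ≠ 0) :
    ∏ᶠ η : J, extend (η : Fˣ →ₜ* ℂˣ) x = 1 := by
  have := hJ.finite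
  have := Fintype.ofFinite J
  rw [finprod_eq_prod_of_fintype]
  set P := ∏ η : J, extend (η : Fˣ →ₜ* ℂˣ) x with hP
  have h1 : P * P = 1 := by
    have h2 : P = ∏ η : J, extend ((η⁻¹ : J) : Fˣ →ₜ* ℂˣ) x :=
      (Equiv.prod_comp (Equiv.inv J) fun η : J => extend (η : Fˣ →ₜ* ℂˣ) x).symm
    nth_rewrite 2 [h2]
    rw [hP, ← Finset.prod_mul_distrib]
    refine Finset.prod_eq_one fun η _ => ?_
    change _ * extend ((η : Fˣ →ₜ* ℂˣ)⁻¹) x = 1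
    rw [extend_inv, mul_inv_cancel₀ (extend_ne_zero hx)]
  have h3 : P ^ d = 1 := by
    rw [hP, ← Finset.prod_pow]
    exact Finset.prod_eq_one fun η _ => extend_pow_eq_one (hJ.1 η.2) hx
  have h4 := pow_gcd_eq_one.2 ⟨h3, show P ^ 2 = 1 by rw [sq, h1]⟩
  rwa [(Nat.coprime_two_right.2 hd : Nat.gcd d 2 = 1), pow_one] at h4

end LiftProducts

/-! ### Product formula for Gauss integrals over a lift. -/

section GaussProducts

variable {F : Type*} [NontriviallyNormedField F] [IsUltrametricDist F] [IsNormalizedLocalField F]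
  [MeasurableSpace F] [BorelSpace F] {μ : Measure F} {p t : ℕ}
  {χ : Fˣ →ₜ* ℂˣ} {ψ : AddChar F ℂ} {J : Subgroup (Fˣ →ₜ* ℂˣ)} {ζ : F}

omit [MeasurableSpace F] [BorelSpace F] in
lemma map_natCast_mul (ψ : AddChar F ℂ) (n : ℕ) (x : F) : ψ (n * x) = ψ x ^ n := by
  rw [← nsmul_eq_mul, AddChar.map_nsmul_eq_pow]

/-- The product formula for Gauss integrals over a lift: conductor exponent at least `2`. -/
lemma finprod_gaussInt_lift_of_two_le (hp : ‖(p : F)‖ < 1) (hodd : Odd p)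
    (hd : (2 * t + 1).Coprime p) (hζ : IsPrimitiveRoot ζ (2 * t + 1)) (hJ : IsLift (2 * t + 1) J)
    (hψc : Continuous ψ) (hψ : ψ ≠ 1) (hμ : IsSelfDual ψ μ) (h : IsRamified (χ ^ (2 * t + 1)))
    (hm : 2 ≤ condMul χ) :
    ∏ᶠ η : J, gaussInt μ ψ (χ * (η : Fˣ →ₜ* ℂˣ)) =
      (residueCard F : ℂ) ^ (-((condAdd ψ - condMul χ) * t) : ℤ) *
        gaussInt μ (ψ.mulShift ((2 * t + 1 : ℕ) : F)) (χ ^ (2 * t + 1)) := by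
  have := hμ.1
  have := hJ.finite
  have := Fintype.ofFinite J
  have hq := residueCard_ne_zero F
  have h2 : ‖(2 : F)‖ = 1 := by
    have := norm_natCast_eq_one_of_coprime hp (Nat.coprime_two_left.2 hodd)
    exact_mod_cast this
  have hd1 := norm_natCast_eq_one_of_coprime hp hd
  have hd0 : ((2 * t + 1 : ℕ) : F) ≠ 0 := norm_pos_iff.1 (by rw [hd1]; exact one_pos)
  have hχ := isRamified_of_pow h
  obtain ⟨c, hc, hcχ⟩ := exists_extend_one_add_eq hψc hψ h2 hχ (r := (condMul χ : ℤ) / 2)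
    (by omega) (by omega) (by omega)
  have hr1 : 1 ≤ (condMul χ : ℤ) / 2 := by omega
  have hr2 : 2 * ((condMul χ : ℤ) / 2) ≤ condMul χ := by omega
  set r := (condMul χ : ℤ) / 2 with hr
  have hc0 := ne_zero_of_mem_shell hc
  have hc2 : c / 2 ∈ shell F (condAdd ψ - condMul χ) := by
    rw [mem_shell, norm_div, h2, div_one]; exact hc
  -- A tame twist does not affect `χ` on `1 + 𝔭 ^ r`, so the same critical point `c` serves all `η`,
  -- and `η` enters only through its value at `c`.
  have e1 : ∀ η : J, gaussInt μ ψ (χ * (η : Fˣ →ₜ* ℂˣ)) =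
      (residueCard F : ℂ) ^ (condMul χ - condAdd ψ) * (extend χ c)⁻¹ * ψ c *
        quadInt μ ψ r (c / 2) * (extend (η : Fˣ →ₜ* ℂˣ) c)⁻¹ := by
    intro η
    have hcm := condMul_mul hp hd (hJ.1 η.2) h
    rw [gaussInt_eq_quadInt hψc hψ h2 hr1 (by rw [hcm]; exact hr2)
      (c := c) (by rwa [hcm]), hcm, extend_mul_char, mul_inv]
    · ring
    · intro x hx
      rw [extend_mul_char, hcχ x hx, hJ.isTame η (1 + x), mul_one]
      rw [add_sub_cancel_left]
      exact primePow_anti hr1 hx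
  have e2 : gaussInt μ (ψ.mulShift ((2 * t + 1 : ℕ) : F)) (χ ^ (2 * t + 1)) =
      (residueCard F : ℂ) ^ (condMul χ - condAdd ψ) * (extend χ c ^ (2 * t + 1))⁻¹ *
        ψ c ^ (2 * t + 1) * quadInt μ ψ r (((2 * t + 1 : ℕ) : F) * (c / 2)) := by
    have hcm := condMul_pow hp hd h
    rw [gaussInt_eq_quadInt (continuous_mulShift hψc _) (mulShift_ne_one_of_ne_zero hψ hd0) h2 hr1
      (by rw [hcm]; exact hr2) (c := c) (by rwa [hcm, condAdd_mulShift hd1]), hcm,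
      condAdd_mulShift hd1, extend_pow _ hc0, quadInt_mulShift, AddChar.mulShift_apply,
      map_natCast_mul]
    intro x hx
    rw [extend_pow _ (ne_zero_of_mem_shell (one_add_mem_shell hr1 hx)), hcχ x hx,
      AddChar.mulShift_apply, map_natCast_mul]
  have e3 := quadInt_pow (μ := μ) (a := r) hp hodd hψc hψ h2 hμ hc2 (by omega) hζ hd1
  have e4 : ∏ η : J, (extend (η : Fˣ →ₜ* ℂˣ) c)⁻¹ = 1 := by
    rw [Finset.prod_inv_distrib, ← finprod_eq_prod_of_fintype,
      hJ.finprod_extend (odd_two_mul_add_one t) hc0, inv_one]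
  rw [finprod_eq_prod_of_fintype, Finset.prod_congr rfl fun η _ => e1 η, Finset.prod_mul_distrib, e4,
    mul_one, Finset.prod_const, Finset.card_univ, ← Nat.card_eq_fintype_card,
    hJ.card_eq (dvd_card_residue_sub_one hd1 hζ), e2, mul_pow, mul_pow, mul_pow, e3]
  have e5 : ((residueCard F : ℂ) ^ ((condMul χ : ℤ) - condAdd ψ)) ^ (2 * t + 1) *
      (residueCard F : ℂ) ^ ((condAdd ψ - condMul χ) * t) =
      (residueCard F : ℂ) ^ (-((condAdd ψ - condMul χ) * t) : ℤ) *
        (residueCard F : ℂ) ^ ((condMul χ : ℤ) - condAdd ψ) := by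
    rw [← zpow_natCast, ← zpow_mul, ← zpow_add₀ hq, ← zpow_add₀ hq]
    congr 1
    push_cast
    ring
  rw [inv_pow]
  linear_combination ((extend χ c ^ (2 * t + 1))⁻¹ * ψ c ^ (2 * t + 1) *
    quadInt μ ψ r (((2 * t + 1 : ℕ) : F) * (c / 2))) * e5

/-- The product formula for Gauss integrals over a lift: tame case. -/
lemma finprod_gaussInt_lift_of_eq_one (hp : ‖(p : F)‖ < 1)
    (hd : (2 * t + 1).Coprime p) (hζ : IsPrimitiveRoot ζ (2 * t + 1)) (hJ : IsLift (2 * t + 1) J)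
    (hψc : Continuous ψ) (hψ : ψ ≠ 1) (hμ : IsSelfDual ψ μ) (h : IsRamified (χ ^ (2 * t + 1)))
    (hm : condMul χ = 1) :
    ∏ᶠ η : J, gaussInt μ ψ (χ * (η : Fˣ →ₜ* ℂˣ)) =
      (residueCard F : ℂ) ^ (-((condAdd ψ - condMul χ) * t) : ℤ) *
        gaussInt μ (ψ.mulShift ((2 * t + 1 : ℕ) : F)) (χ ^ (2 * t + 1)) := by
  classical
  have := hμ.1
  have := hJ.finite
  have := Fintype.ofFinite J
  have := Fintype.ofFinite (Valued.ResidueField F)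
  have := Fintype.ofFinite (MulChar (Valued.ResidueField F) ℂ)
  have hq := residueCard_ne_zero F
  have hd1 := norm_natCast_eq_one_of_coprime hp hd
  have hd0 : ((2 * t + 1 : ℕ) : F) ≠ 0 := norm_pos_iff.1 (by rw [hd1]; exact one_pos)
  have hdvd := dvd_card_residue_sub_one hd1 hζ
  have hχ := isRamified_of_pow h
  have ht : IsTame χ := (condMul_eq_one_iff hχ).1 hm
  set w := unif F ^ (condAdd ψ - 1) with hw
  have hws : w ∈ shell F (condAdd ψ - 1) := unif_zpow_mem_shell _
  have hw0 := ne_zero_of_mem_shell hws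
  set A : ℂ := (residueCard F : ℂ) ^ (-condAdd ψ) * μ.real (primePow F 0) with hA
  set θ := resAddChar hψc hψ (shell_subset _ hws) with hθ
  obtain ⟨E, hE⟩ := hJ.exists_equiv
  -- The inverse in `E η⁻¹` comes from the `χ⁻¹` in the Gauss integral; inversion in `J` removes it
  -- from the product.
  have e1 : ∀ η : J, gaussInt μ ψ (χ * (η : Fˣ →ₜ* ℂˣ)) = A * (extend χ w)⁻¹ *
      (extend (η : Fˣ →ₜ* ℂˣ) w)⁻¹ * gaussSum (resMulChar ht.inv * (E η⁻¹).1) θ := by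
    intro η
    have hcm : condMul (χ * (η : Fˣ →ₜ* ℂˣ)) = 1 := (condMul_mul hp hd (hJ.1 η.2) h).trans hm
    have htη : IsTame (χ * (η : Fˣ →ₜ* ℂˣ))⁻¹ := (ht.mul (hJ.isTame η)).inv
    rw [gaussInt_tame hψc hψ hcm htη hws, extend_mul_char, mul_inv, hA]
    have h3 : resMulChar htη = resMulChar ht.inv * (E η⁻¹).1 := by
      refine resMulChar_eq htη fun x hx => ?_
      rw [MulChar.mul_apply, resMulChar_red ht.inv hx, ← hE _ x hx, extend_inv, extend_mul_char,
        extend_inv]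
      change _ = _ * extend ((η : Fˣ →ₜ* ℂˣ)⁻¹) x
      rw [extend_inv, mul_inv]
    rw [h3]
    ring
  have hθ' : resAddChar (continuous_mulShift hψc ((2 * t + 1 : ℕ) : F))
      (mulShift_ne_one_of_ne_zero hψ hd0) (c := w) (by rw [condAdd_mulShift hd1]; exact shell_subset _ hws) =
      θ.mulShift ((2 * t + 1 : ℕ) : Valued.ResidueField F) := by
    refine DFunLike.ext _ _ fun r => ?_
    rw [AddChar.mulShift_apply, ← red_resLift r, resAddChar_red _ _ _ (resLift_mem r),
      AddChar.mulShift_apply, map_natCast_mul, ← nsmul_eq_mul, AddChar.map_nsmul_eq_pow, hθ,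
      resAddChar_red hψc hψ _ (resLift_mem r)]
  have e2 : gaussInt μ (ψ.mulShift ((2 * t + 1 : ℕ) : F)) (χ ^ (2 * t + 1)) =
      A * (extend χ w ^ (2 * t + 1))⁻¹ * gaussSum (resMulChar ht.inv ^ (2 * t + 1))
        (θ.mulShift ((2 * t + 1 : ℕ) : Valued.ResidueField F)) := by
    have hcm : condMul (χ ^ (2 * t + 1)) = 1 := (condMul_pow hp hd h).trans hm
    have htd : IsTame (χ ^ (2 * t + 1))⁻¹ := IsTame.inv ((condMul_eq_one_iff h).1 hcm)
    rw [gaussInt_tame (continuous_mulShift hψc _) (mulShift_ne_one_of_ne_zero hψ hd0) hcm htd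
      (w := w) (by rw [condAdd_mulShift hd1]; exact hws), hθ', condAdd_mulShift hd1, extend_pow _ hw0]
    congr 2
    refine resMulChar_eq htd fun x hx => ?_
    rw [MulChar.pow_apply' _ (by omega), resMulChar_red ht.inv hx, extend_inv, extend_inv,
      extend_pow _ (ne_zero_of_mem_shell hx), inv_pow]
  have e3 : ∏ η : J, gaussSum (resMulChar ht.inv * (E η⁻¹).1) θ =
      ∏ κ ∈ torsionChars (Valued.ResidueField F) (2 * t + 1), gaussSum (resMulChar ht.inv * κ) θ := by
    rw [Finset.prod_subtype (torsionChars (Valued.ResidueField F) (2 * t + 1))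
      (fun κ => mem_torsionChars) fun κ => gaussSum (resMulChar ht.inv * κ) θ]
    exact Equiv.prod_comp ((Equiv.inv J).trans E) fun κ => gaussSum (resMulChar ht.inv * κ.1) θ
  have e4 : ∏ η : J, (extend (η : Fˣ →ₜ* ℂˣ) w)⁻¹ = 1 := by
    rw [Finset.prod_inv_distrib, ← finprod_eq_prod_of_fintype,
      hJ.finprod_extend (odd_two_mul_add_one t) hw0, inv_one]
  rw [finprod_eq_prod_of_fintype, Finset.prod_congr rfl fun η _ => e1 η, Finset.prod_mul_distrib,
    Finset.prod_mul_distrib, e3, e4, mul_one,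
    prod_gaussSum_torsionChars _ (resAddChar_ne_one hψc hψ hws) hdvd, Finset.prod_const,
    Finset.card_univ, ← Nat.card_eq_fintype_card, hJ.card_eq hdvd, e2, mul_pow, hm]
  -- Self-duality gives `A² = q ^ (-e(ψ))`; the `q ^ t` is the constant of the Hasse-Davenport
  -- formula.
  have e5 : A ^ (2 * t + 1) * (residueCard F : ℂ) ^ t =
      (residueCard F : ℂ) ^ (-((condAdd ψ - (1 : ℕ)) * t) : ℤ) * A := by
    have hv : (μ.real (primePow F 0) : ℂ) ^ 2 = (residueCard F : ℂ) ^ condAdd ψ := by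
      have := congrArg (fun x : ℝ => (x : ℂ)) ((isSelfDual_iff hψc hψ).1 hμ)
      simpa using this
    have hA2 : A ^ 2 = (residueCard F : ℂ) ^ (-condAdd ψ) := by
      rw [hA, mul_pow, hv, ← zpow_natCast, ← zpow_mul, ← zpow_add₀ hq]
      congr 1
      push_cast
      ring
    rw [pow_succ, pow_mul, hA2, mul_right_comm]
    congr 1
    rw [← zpow_natCast, ← zpow_natCast, ← zpow_mul, ← zpow_add₀ hq]
    congr 1
    push_cast
    ring
  change _ * ((residueCard F : ℂ) ^ t * _) = _
  rw [inv_pow]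
  linear_combination ((extend χ w ^ (2 * t + 1))⁻¹ * gaussSum (resMulChar ht.inv ^ (2 * t + 1))
        (θ.mulShift ((2 * t + 1 : ℕ) : Valued.ResidueField F))) * e5

end GaussProducts

end PadicEpsilon

end

noncomputable section

namespace PadicEpsilon

/-! ### Product formula for Gauss integrals over the quadratic characters. -/

section QuadraticProducts

variable {F : Type*} [NontriviallyNormedField F] [IsUltrametricDist F] [IsNormalizedLocalField F]
  {p : ℕ}

lemma norm_two_eq_one (hp : ‖(p : F)‖ < 1) (hodd : Odd p) : ‖(2 : F)‖ = 1 := by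
  have := norm_natCast_eq_one_of_coprime hp (Nat.coprime_two_left.2 hodd)
  exact_mod_cast this

lemma two_dvd_card_residue_sub_one (h2 : ‖(2 : F)‖ = 1) :
    2 ∣ Nat.card (Valued.ResidueField F) - 1 := by
  refine dvd_card_residue_sub_one (by exact_mod_cast h2) (ζ := (-1 : F)) ?_
  refine IsPrimitiveRoot.mk_of_lt _ two_pos (by norm_num) fun l hl hl2 => ?_
  obtain rfl : l = 1 := by omega
  rw [pow_one]
  intro h
  have h3 : (2 : F) = 0 := by linear_combination -h
  rw [h3, norm_zero] at h2
  exact zero_ne_one h2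

lemma finprod_dualModPow_two_const (hp : ‖(p : F)‖ < 1) (hodd : Odd p) (c : ℂ) :
    ∏ᶠ _β : dualModPow F 2, c = c ^ 4 := by
  classical
  have := Fintype.ofFinite (Valued.ResidueField F)
  have := Fintype.ofFinite (MulChar (Valued.ResidueField F) ℂ)
  rw [finprod_dualModPow_two hp hodd fun _ => c, Finset.prod_const,
    card_torsionChars (two_dvd_card_residue_sub_one (norm_two_eq_one hp hodd))]
  ring

/-- The two characters over one residue character have product `(-1) ^ n` at an element of valuation
`n`, and there are two residue characters. -/
lemma finprod_dualModPow_two_extend (hp : ‖(p : F)‖ < 1) (hodd : Odd p) {x : F} (hx : x ≠ 0) :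
    ∏ᶠ β : dualModPow F 2, extend (β : Fˣ →ₜ* ℂˣ) x = 1 := by
  classical
  have := Fintype.ofFinite (Valued.ResidueField F)
  have := Fintype.ofFinite (MulChar (Valued.ResidueField F) ℂ)
  obtain ⟨n, hn⟩ := exists_mem_shell hx
  have hu := unif_zpow_neg_mul_mem_shell hn
  have hr : red (unif F ^ (-n) * x) ≠ 0 := (red_ne_zero_iff (shell_subset 0 hu)).2 hu
  have h1 : ∀ κ ∈ torsionChars (Valued.ResidueField F) 2,
      extend (tameChar 1 κ) x * extend (tameChar (-1) κ) x = (-1) ^ n := by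
    intro κ hκ
    rw [extend_tameChar _ _ hn, extend_tameChar _ _ hn]
    lift red (unif F ^ (-n) * x) to (Valued.ResidueField F)ˣ using hr.isUnit with r
    have h2 : κ r * κ r = 1 := by
      rw [← sq, ← MulChar.pow_apply_coe, mem_torsionChars.1 hκ, MulChar.one_apply_coe]
    rw [Units.val_one, one_zpow, one_mul, Units.val_neg, Units.val_one]
    linear_combination ((-1 : ℂ) ^ n) * h2
  rw [finprod_dualModPow_two hp hodd fun β => extend β x, Finset.prod_congr rfl h1, Finset.prod_const,
    card_torsionChars (two_dvd_card_residue_sub_one (norm_two_eq_one hp hodd)), ← zpow_natCast,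
    ← zpow_mul, mul_comm, zpow_mul]
  norm_num

variable [MeasurableSpace F] [BorelSpace F] {μ : Measure F} {χ : Fˣ →ₜ* ℂˣ} {ψ : AddChar F ℂ}

/-- All four twists share the critical point `c`, which also serves `χ²` and `ψ₂`. Both sides then
have the same factor `χ(c)⁻⁴ ψ(c)⁴`, and `quadInt_sq` evaluates the powers of the quadratic
integrals at `c/2` and `c`. -/
lemma finprod_gaussInt_two_of_two_le (hp : ‖(p : F)‖ < 1) (hodd : Odd p)
    (hψc : Continuous ψ) (hψ : ψ ≠ 1) (hμ : IsSelfDual ψ μ) (h : IsRamified (χ ^ 2))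
    (hm : 2 ≤ condMul χ) :
    ∏ᶠ β : dualModPow F 2, gaussInt μ ψ (χ * (β : Fˣ →ₜ* ℂˣ)) =
      (residueCard F : ℂ) ^ (condMul χ - condAdd ψ) * (signF F : ℂ) ^ condMul χ *
        gaussInt μ (ψ.mulShift 2) (χ ^ 2) ^ 2 := by
  have := hμ.1
  have := finite_dualModPow_two hp hodd
  have := Fintype.ofFinite (dualModPow F 2)
  have hq := residueCard_ne_zero F
  have hd : Nat.Coprime 2 p := Nat.coprime_two_left.2 hodd
  have h2 := norm_two_eq_one hp hodd
  have h20 : (2 : F) ≠ 0 := norm_pos_iff.1 (by rw [h2]; exact one_pos)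
  have hχ := isRamified_of_pow h
  obtain ⟨c, hc, hcχ⟩ := exists_extend_one_add_eq hψc hψ h2 hχ (r := (condMul χ : ℤ) / 2)
    (by omega) (by omega) (by omega)
  have hr1 : 1 ≤ (condMul χ : ℤ) / 2 := by omega
  have hr2 : 2 * ((condMul χ : ℤ) / 2) ≤ condMul χ := by omega
  set r := (condMul χ : ℤ) / 2 with hr
  have hc0 := ne_zero_of_mem_shell hc
  have hc2 : c / 2 ∈ shell F (condAdd ψ - condMul χ) := by
    rw [mem_shell, norm_div, h2, div_one]; exact hc
  have hψ2 : ∀ x, (ψ.mulShift 2) x = ψ x ^ 2 := fun x => by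
    rw [AddChar.mulShift_apply, two_mul, AddChar.map_add_eq_mul, sq]
  have e1 : ∀ β : dualModPow F 2, gaussInt μ ψ (χ * (β : Fˣ →ₜ* ℂˣ)) =
      (residueCard F : ℂ) ^ (condMul χ - condAdd ψ) * (extend χ c)⁻¹ * ψ c *
        quadInt μ ψ r (c / 2) * (extend (β : Fˣ →ₜ* ℂˣ) c)⁻¹ := by
    intro β
    have hcm := condMul_mul hp hd β.2 h
    rw [gaussInt_eq_quadInt hψc hψ h2 hr1 (by rw [hcm]; exact hr2)
      (c := c) (by rwa [hcm]), hcm, extend_mul_char, mul_inv]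
    · ring
    · intro x hx
      rw [extend_mul_char, hcχ x hx, extend_eq_one_of_mem_dualModPow hp hd β.2 (x := 1 + x), mul_one]
      rw [add_sub_cancel_left]
      exact primePow_anti hr1 hx
  have e2 : gaussInt μ (ψ.mulShift 2) (χ ^ 2) =
      (residueCard F : ℂ) ^ (condMul χ - condAdd ψ) * (extend χ c ^ 2)⁻¹ *
        ψ c ^ 2 * quadInt μ ψ r (2 * (c / 2)) := by
    have hcm := condMul_pow hp hd h
    rw [gaussInt_eq_quadInt (continuous_mulShift hψc _) (mulShift_ne_one_of_ne_zero hψ h20) h2 hr1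
      (by rw [hcm]; exact hr2) (c := c) (by rwa [hcm, condAdd_mulShift h2]), hcm,
      condAdd_mulShift h2, extend_pow _ hc0, quadInt_mulShift, hψ2]
    intro x hx
    rw [extend_pow _ (ne_zero_of_mem_shell (one_add_mem_shell hr1 hx)), hcχ x hx, hψ2]
  have e3 := quadInt_sq (μ := μ) (a := r) hp hodd hψc hψ h2 hμ hc2 (by omega)
  have e3' := quadInt_sq (μ := μ) (a := r) (b := 2 * (c / 2)) hp hodd hψc hψ h2 hμ
    (by rwa [mul_div_cancel₀ _ h20]) (by omega)
  have e4 : ∏ β : dualModPow F 2, (extend (β : Fˣ →ₜ* ℂˣ) c)⁻¹ = 1 := by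
    rw [Finset.prod_inv_distrib, ← finprod_eq_prod_of_fintype,
      finprod_dualModPow_two_extend hp hodd hc0, inv_one]
  rw [sub_sub_cancel, zpow_natCast] at e3 e3'
  rw [finprod_eq_prod_of_fintype, Finset.prod_congr rfl fun β _ => e1 β, Finset.prod_mul_distrib, e4,
    mul_one, ← finprod_eq_prod_of_fintype, finprod_dualModPow_two_const hp hodd, e2]
  set Q := quadInt μ ψ r (c / 2)
  set Q' := quadInt μ ψ r (2 * (c / 2))
  set s := (signF F : ℂ) ^ condMul χ with hs
  have hs2 : s ^ 2 = 1 := by rw [hs, ← pow_mul, mul_comm, pow_mul, signF_sq, one_pow]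
  have hN : (residueCard F : ℂ) ^ (condAdd ψ - (condMul χ : ℤ)) =
      ((residueCard F : ℂ) ^ ((condMul χ : ℤ) - condAdd ψ))⁻¹ := by
    rw [← zpow_neg, neg_sub]
  rw [hN] at e3 e3'
  have hA : (residueCard F : ℂ) ^ ((condMul χ : ℤ) - condAdd ψ) ≠ 0 := zpow_ne_zero _ hq
  set A := (residueCard F : ℂ) ^ ((condMul χ : ℤ) - condAdd ψ)
  have e5 : A ^ 2 * Q ^ 4 = 1 := by
    rw [show Q ^ 4 = (Q ^ 2) ^ 2 by ring, e3, mul_pow, hs2]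
    field_simp
  have e6 : A * s * Q' ^ 2 = 1 := by
    rw [e3', ← hs2]
    field_simp
  linear_combination (A ^ 2 * (extend χ c)⁻¹ ^ 4 * ψ c ^ 4) * e5 -
    (A ^ 2 * (extend χ c)⁻¹ ^ 4 * ψ c ^ 4) * e6

/-- The two twists over one residue character `κ` have the same finite Gauss sum, which enters
squared. The product over `κ` is thus the square of the Hasse-Davenport formula for `d = 2`, in
which the squared quadratic Gauss sum is `sign(F) q`; the signs from the uniformizer cancel. -/
lemma finprod_gaussInt_two_of_eq_one (hp : ‖(p : F)‖ < 1) (hodd : Odd p)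
    (hψc : Continuous ψ) (hψ : ψ ≠ 1) (hμ : IsSelfDual ψ μ) (h : IsRamified (χ ^ 2))
    (hm : condMul χ = 1) :
    ∏ᶠ β : dualModPow F 2, gaussInt μ ψ (χ * (β : Fˣ →ₜ* ℂˣ)) =
      (residueCard F : ℂ) ^ (condMul χ - condAdd ψ) * (signF F : ℂ) ^ condMul χ *
        gaussInt μ (ψ.mulShift 2) (χ ^ 2) ^ 2 := by
  classical
  have := hμ.1
  have := Fintype.ofFinite (Valued.ResidueField F)
  have := Fintype.ofFinite (MulChar (Valued.ResidueField F) ℂ)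
  have hq := residueCard_ne_zero F
  have hd : Nat.Coprime 2 p := Nat.coprime_two_left.2 hodd
  have h2 := norm_two_eq_one hp hodd
  have h20 : (2 : F) ≠ 0 := norm_pos_iff.1 (by rw [h2]; exact one_pos)
  have hdvd := two_dvd_card_residue_sub_one h2
  have hχ := isRamified_of_pow h
  have ht : IsTame χ := (condMul_eq_one_iff hχ).1 hm
  set w := unif F ^ (condAdd ψ - 1) with hw
  have hws : w ∈ shell F (condAdd ψ - 1) := unif_zpow_mem_shell _
  have hw0 := ne_zero_of_mem_shell hws
  set A : ℂ := (residueCard F : ℂ) ^ (-condAdd ψ) * μ.real (primePow F 0) with hA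
  set θ := resAddChar hψc hψ (shell_subset _ hws) with hθ
  have hθ1 : θ ≠ 1 := resAddChar_ne_one hψc hψ hws
  have e1 : ∀ z : ℂˣ, z ^ 2 = 1 → ∀ κ ∈ torsionChars (Valued.ResidueField F) 2,
      gaussInt μ ψ (χ * tameChar z κ) = A * (extend χ w)⁻¹ *
        ((z : ℂ) ^ (condAdd ψ - 1))⁻¹ * gaussSum (resMulChar ht.inv * κ) θ := by
    intro z hz κ hκ
    have hκ2 := mem_torsionChars.1 hκ
    have hβ := tameChar_mem_dualModPow (F := F) z κ hz hκ2
    have hcm : condMul (χ * tameChar z κ) = 1 := (condMul_mul hp hd hβ h).trans hm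
    have htη : IsTame (χ * tameChar z κ)⁻¹ := (ht.mul (isTame_tameChar z κ)).inv
    rw [gaussInt_tame hψc hψ hcm htη hws, extend_mul_char, mul_inv, hA, extend_tameChar_unif_zpow]
    have h3 : resMulChar htη = resMulChar ht.inv * κ := by
      refine resMulChar_eq htη fun x hx => ?_
      have hr : red x ≠ 0 := (red_ne_zero_iff (shell_subset 0 hx)).2 hx
      have h4 : (κ (red x))⁻¹ = κ (red x) := by
        refine inv_eq_of_mul_eq_one_left ?_
        rw [← sq, ← MulChar.pow_apply' κ two_ne_zero, hκ2, MulChar.one_apply hr.isUnit]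
      rw [MulChar.mul_apply, resMulChar_red ht.inv hx, extend_inv, extend_mul_char,
        extend_inv, extend_tameChar_of_unit z κ hx, mul_inv, h4]
    rw [h3]
    ring
  have hθ' : resAddChar (continuous_mulShift hψc (2 : F))
      (mulShift_ne_one_of_ne_zero hψ h20) (c := w) (by rw [condAdd_mulShift h2]; exact shell_subset _ hws) =
      θ.mulShift 2 := by
    refine DFunLike.ext _ _ fun r => ?_
    rw [AddChar.mulShift_apply, ← red_resLift r, resAddChar_red _ _ _ (resLift_mem r),
      AddChar.mulShift_apply, two_mul, AddChar.map_add_eq_mul, two_mul, AddChar.map_add_eq_mul, hθ,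
      resAddChar_red hψc hψ _ (resLift_mem r)]
  have e2 : gaussInt μ (ψ.mulShift 2) (χ ^ 2) =
      A * (extend χ w ^ 2)⁻¹ * gaussSum (resMulChar ht.inv ^ 2) (θ.mulShift 2) := by
    have hcm : condMul (χ ^ 2) = 1 := (condMul_pow hp hd h).trans hm
    have htd : IsTame (χ ^ 2)⁻¹ := IsTame.inv ((condMul_eq_one_iff h).1 hcm)
    rw [gaussInt_tame (continuous_mulShift hψc _) (mulShift_ne_one_of_ne_zero hψ h20) hcm htd
      (w := w) (by rw [condAdd_mulShift h2]; exact hws), hθ', condAdd_mulShift h2, extend_pow _ hw0]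
    congr 2
    refine resMulChar_eq htd fun x hx => ?_
    rw [MulChar.pow_apply' _ (by omega), resMulChar_red ht.inv hx, extend_inv, extend_inv,
      extend_pow _ (ne_zero_of_mem_shell hx), inv_pow]
  have e3 : ∀ κ ∈ torsionChars (Valued.ResidueField F) 2,
      gaussInt μ ψ (χ * tameChar 1 κ) * gaussInt μ ψ (χ * tameChar (-1) κ) =
        (A * (extend χ w)⁻¹) ^ 2 * ((-1 : ℂ) ^ (condAdd ψ - 1))⁻¹ *
          (gaussSum (resMulChar ht.inv * κ) θ) ^ 2 := by
    intro κ hκ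
    rw [e1 1 (one_pow 2) κ hκ, e1 (-1) (by simp) κ hκ, Units.val_one, one_zpow, Units.val_neg,
      Units.val_one]
    ring
  have e4 : (((-1 : ℂ) ^ (condAdd ψ - 1))⁻¹) ^ 2 = 1 := by
    rw [inv_pow, ← zpow_natCast, ← zpow_mul, mul_comm, zpow_mul]
    norm_num
  have hv : (μ.real (primePow F 0) : ℂ) ^ 2 = (residueCard F : ℂ) ^ condAdd ψ := by
    have := congrArg (fun x : ℝ => (x : ℂ)) ((isSelfDual_iff hψc hψ).1 hμ)
    simpa using this
  have hA2 : A ^ 2 = (residueCard F : ℂ) ^ (-condAdd ψ) := by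
    rw [hA, mul_pow, hv, ← zpow_natCast, ← zpow_mul, ← zpow_add₀ hq]
    congr 1
    push_cast
    ring
  have e5 : (∑ b, θ (b ^ 2)) ^ 2 = (signF F : ℂ) * (residueCard F : ℂ) := by
    rw [sum_sq_sq (ringChar_residue_ne_two h2) hθ1, ← signF_eq hp hodd]; rfl
  rw [finprod_dualModPow_two hp hodd fun β => gaussInt μ ψ (χ * β), Finset.prod_congr rfl e3,
    Finset.prod_mul_distrib, Finset.prod_const, card_torsionChars hdvd, Finset.prod_pow,
    prod_gaussSum_torsionChars_two _ hθ1 hdvd, mul_pow, e4, mul_one, mul_pow, mul_pow (∑ b, θ (b ^ 2)), e5, e2, hm, pow_one]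
  have e6 : (residueCard F : ℂ) ^ ((1 : ℕ) - condAdd ψ : ℤ) = (residueCard F : ℂ) * A ^ 2 := by
    rw [hA2, sub_eq_add_neg, zpow_add₀ hq, zpow_natCast, pow_one]
  rw [e6]
  have hX : extend χ w ≠ 0 := extend_ne_zero hw0
  field_simp

/-- The product formula for Gauss integrals over the quadratic characters. -/
lemma finprod_gaussInt_two (hp : ‖(p : F)‖ < 1) (hodd : Odd p)
    (hψc : Continuous ψ) (hψ : ψ ≠ 1) (hμ : IsSelfDual ψ μ) (h : IsRamified (χ ^ 2)) :
    ∏ᶠ β : dualModPow F 2, gaussInt μ ψ (χ * (β : Fˣ →ₜ* ℂˣ)) =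
      (residueCard F : ℂ) ^ (condMul χ - condAdd ψ) * (signF F : ℂ) ^ condMul χ *
        gaussInt μ (ψ.mulShift 2) (χ ^ 2) ^ 2 := by
  rcases (one_le_condMul (isRamified_of_pow h)).eq_or_lt with h1 | h1
  · exact finprod_gaussInt_two_of_eq_one hp hodd hψc hψ hμ h h1.symm
  · exact finprod_gaussInt_two_of_two_le hp hodd hψc hψ hμ h h1

/-- The product formula for Gauss integrals over a lift. -/
lemma finprod_gaussInt_lift {t : ℕ} {J : Subgroup (Fˣ →ₜ* ℂˣ)} {ζ : F} (hp : ‖(p : F)‖ < 1)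
    (hodd : Odd p) (hd : (2 * t + 1).Coprime p) (hζ : IsPrimitiveRoot ζ (2 * t + 1))
    (hJ : IsLift (2 * t + 1) J) (hψc : Continuous ψ) (hψ : ψ ≠ 1) (hμ : IsSelfDual ψ μ)
    (h : IsRamified (χ ^ (2 * t + 1))) :
    ∏ᶠ η : J, gaussInt μ ψ (χ * (η : Fˣ →ₜ* ℂˣ)) =
      (residueCard F : ℂ) ^ (-((condAdd ψ - condMul χ) * t) : ℤ) *
        gaussInt μ (ψ.mulShift ((2 * t + 1 : ℕ) : F)) (χ ^ (2 * t + 1)) := by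
  rcases (one_le_condMul (isRamified_of_pow h)).eq_or_lt with h1 | h1
  · exact finprod_gaussInt_lift_of_eq_one hp hd hζ hJ hψc hψ hμ h h1.symm
  · exact finprod_gaussInt_lift_of_two_le hp hodd hd hζ hJ hψc hψ hμ h h1

end QuadraticProducts

end PadicEpsilon

end

noncomputable section

namespace PadicEpsilon

/-! ### Products of Tate and metaplectic epsilon factors. -/

section EpsilonProducts

variable {F : Type*} [NontriviallyNormedField F] [IsUltrametricDist F] [IsNormalizedLocalField F]
  [MeasurableSpace F] [BorelSpace F] {p t : ℕ} {χ : Fˣ →ₜ* ℂˣ} {ψ : AddChar F ℂ}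
  {J : Subgroup (Fˣ →ₜ* ℂˣ)} {ζ ϖ : F}

/-- The epsilon factor of a power of `χ`, in terms of the conductor exponent of `χ`. -/
lemma tateEpsilon_pow_mulShift {d : ℕ} {a : F} (hp : ‖(p : F)‖ < 1) (hd : d.Coprime p) (ha : ‖a‖ = 1)
    (hψc : Continuous ψ) (hψ : ψ ≠ 1) (h : IsRamified (χ ^ d)) (s : ℂ) :
    tateEpsilon ϖ s (χ ^ d) (ψ.mulShift a) =
      (residueCard F : ℂ) ^ (((condAdd ψ - condMul χ : ℤ) : ℂ) * s) *
        gaussInt (selfDual ψ) (ψ.mulShift a) (χ ^ d) := by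
  have ha0 : a ≠ 0 := norm_pos_iff.1 (by rw [ha]; exact one_pos)
  rw [tateEpsilon_eq (continuous_mulShift hψc a) (mulShift_ne_one_of_ne_zero hψ ha0) h,
    condAdd_mulShift ha, condMul_pow hp hd h, selfDual_mulShift hψc hψ ha]

lemma finprod_tateEpsilon_lift (hp : ‖(p : F)‖ < 1) (hodd : Odd p) (hd : (2 * t + 1).Coprime p)
    (hζ : IsPrimitiveRoot ζ (2 * t + 1)) (hJ : IsLift (2 * t + 1) J) (hψc : Continuous ψ) (hψ : ψ ≠ 1)
    (h : IsRamified (χ ^ (2 * t + 1))) (s : ℂ) :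
    ∏ᶠ η : J, tateEpsilon ϖ s (χ * (η : Fˣ →ₜ* ℂˣ)) ψ =
      (residueCard F : ℂ) ^ (((condAdd ψ - condMul χ : ℤ) : ℂ) * ((2 * t + 1) * s - t)) *
        gaussInt (selfDual ψ) (ψ.mulShift ((2 * t + 1 : ℕ) : F)) (χ ^ (2 * t + 1)) := by
  have := hJ.finite
  have := Fintype.ofFinite J
  have hq := residueCard_ne_zero F
  have hdvd := dvd_card_residue_sub_one (norm_natCast_eq_one_of_coprime hp hd) hζ
  have e1 : ∀ η : J, tateEpsilon ϖ s (χ * (η : Fˣ →ₜ* ℂˣ)) ψ =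
      (residueCard F : ℂ) ^ (((condAdd ψ - condMul χ : ℤ) : ℂ) * s) *
        gaussInt (selfDual ψ) ψ (χ * (η : Fˣ →ₜ* ℂˣ)) := fun η => by
    rw [tateEpsilon_eq hψc hψ (isRamified_mul (hJ.1 η.2) h), condMul_mul hp hd (hJ.1 η.2) h]
  rw [finprod_eq_prod_of_fintype, Finset.prod_congr rfl fun η _ => e1 η, Finset.prod_mul_distrib,
    Finset.prod_const, Finset.card_univ, ← Nat.card_eq_fintype_card, hJ.card_eq hdvd,
    ← finprod_eq_prod_of_fintype,
    finprod_gaussInt_lift hp hodd hd hζ hJ hψc hψ (isSelfDual_selfDual ψ hψc hψ) h, ← mul_assoc]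
  congr 1
  rw [← Complex.cpow_nat_mul, ← Complex.cpow_intCast, ← Complex.cpow_add _ _ hq]
  congr 1
  push_cast
  ring

lemma metaEpsilon_inv (s : ℂ) (χ : Fˣ →ₜ* ℂˣ) (ψ : AddChar F ℂ) :
    metaEpsilon ϖ (1 - s) χ⁻¹ ψ = weilIndex ψ * extend χ (-1) * tateEpsilon ϖ (s + 1 / 2) χ ψ /
      tateEpsilon ϖ (2 * s) (χ ^ 2) (ψ.mulShift 2) := by
  have hii : χ⁻¹⁻¹ = χ := inv_inv χ
  rw [metaEpsilon, hii, sub_sub_cancel, extend_neg_one]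

/-- The Weil index is a quadratic Gauss integral with `b = 1`, of valuation `0`, so `quadInt_pow`
applies with no power of `q`. -/
lemma weilIndex_pow (hp : ‖(p : F)‖ < 1) (hodd : Odd p) (hd : (2 * t + 1).Coprime p)
    (hζ : IsPrimitiveRoot ζ (2 * t + 1)) (hψc : Continuous ψ) (hψ : ψ ≠ 1) :
    weilIndex ψ ^ (2 * t + 1) = weilIndex (ψ.mulShift ((2 * t + 1 : ℕ) : F)) := by
  have h2 := norm_two_eq_one hp hodd
  have hd1 := norm_natCast_eq_one_of_coprime hp hd
  have hd0 : ((2 * t + 1 : ℕ) : F) ≠ 0 := norm_pos_iff.1 (by rw [hd1]; exact one_pos)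
  have hsd := isSelfDual_selfDual ψ hψc hψ
  have := hsd.1
  have hn : 2 * (condAdd ψ / 2) ≤ condAdd ψ := by omega
  rw [weilIndex_eq hψc hψ h2 hn, weilIndex_eq (continuous_mulShift hψc _)
    (mulShift_ne_one_of_ne_zero hψ hd0) h2 (n := condAdd ψ / 2) (by rwa [condAdd_mulShift hd1]),
    selfDual_mulShift hψc hψ hd1, quadInt_mulShift,
    quadInt_pow hp hodd hψc hψ h2 hsd (one_mem_shell (F := F)) (by omega) hζ hd1, zero_mul, zpow_zero,
    one_mul]

lemma weilIndex_pow_four (hp : ‖(p : F)‖ < 1) (hodd : Odd p) (hψc : Continuous ψ) (hψ : ψ ≠ 1) :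
    weilIndex ψ ^ 4 = 1 := by
  have h2 := norm_two_eq_one hp hodd
  have hsd := isSelfDual_selfDual ψ hψc hψ
  have := hsd.1
  have hn : 2 * (condAdd ψ / 2) ≤ condAdd ψ := by omega
  rw [weilIndex_eq hψc hψ h2 hn, show 4 = 2 * 2 by norm_num, pow_mul,
    quadInt_sq hp hodd hψc hψ h2 hsd (one_mem_shell (F := F)) (by omega), zpow_zero, mul_one,
    ← zpow_natCast, ← zpow_mul, mul_comm, zpow_mul, zpow_natCast, signF_sq, one_zpow]

theorem finprod_tateEpsilon_inv_lift (hp : ‖(p : F)‖ < 1) (hodd : Odd p) (hd : (2 * t + 1).Coprime p)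
    (hζ : IsPrimitiveRoot ζ (2 * t + 1)) (hJ : IsLift (2 * t + 1) J) (hψc : Continuous ψ) (hψ : ψ ≠ 1)
    (h : IsRamified (χ ^ (2 * t + 1))) (s : ℂ) :
    ∏ᶠ η : J, tateEpsilon ϖ (1 - s) (χ * (η : Fˣ →ₜ* ℂˣ))⁻¹ ψ =
      (residueCard F : ℂ) ^ ((t : ℤ) * (condAdd ψ - (condMul (χ ^ (2 * t + 1)) : ℤ))) *
        tateEpsilon ϖ (1 - (2 * t + 1 : ℕ) * s) (χ ^ (2 * t + 1))⁻¹
          (ψ.mulShift ((2 * t + 1 : ℕ) : F)) := by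
  have hq := residueCard_ne_zero F
  have hd1 := norm_natCast_eq_one_of_coprime hp hd
  have h' : IsRamified (χ⁻¹ ^ (2 * t + 1)) := by
    have : χ⁻¹ ^ (2 * t + 1) = (χ ^ (2 * t + 1))⁻¹ := inv_pow χ _
    rw [this]; exact isRamified_inv h
  have e1 : ∏ᶠ η : J, tateEpsilon ϖ (1 - s) (χ * (η : Fˣ →ₜ* ℂˣ))⁻¹ ψ =
      ∏ᶠ η : J, tateEpsilon ϖ (1 - s) (χ⁻¹ * (η : Fˣ →ₜ* ℂˣ)) ψ := by
    -- Replacing `η` by `η⁻¹` reduces to the product of the twists of `χ⁻¹`.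
    refine Eq.trans (finprod_congr fun η => ?_) (finprod_comp_equiv (Equiv.inv J)
      (f := fun η : J => tateEpsilon ϖ (1 - s) (χ⁻¹ * (η : Fˣ →ₜ* ℂˣ)) ψ))
    congr 1
    exact mul_inv χ (η : Fˣ →ₜ* ℂˣ)
  have e2 : (χ ^ (2 * t + 1))⁻¹ = χ⁻¹ ^ (2 * t + 1) := (inv_pow χ _).symm
  rw [e1, finprod_tateEpsilon_lift hp hodd hd hζ hJ hψc hψ h', e2,
    tateEpsilon_pow_mulShift hp hd hd1 hψc hψ h', condMul_pow hp hd h,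
    condMul_inv (isRamified_of_pow h), ← mul_assoc]
  congr 1
  rw [← Complex.cpow_intCast, ← Complex.cpow_add _ _ hq]
  congr 1
  push_cast
  ring

theorem finprod_metaEpsilon_inv_lift (hp : ‖(p : F)‖ < 1) (hodd : Odd p)
    (hd : (2 * t + 1).Coprime p) (hζ : IsPrimitiveRoot ζ (2 * t + 1)) (hJ : IsLift (2 * t + 1) J)
    (hψc : Continuous ψ) (hψ : ψ ≠ 1) (h : IsRamified (χ ^ (2 * (2 * t + 1)))) (s : ℂ) :
    ∏ᶠ η : J, metaEpsilon ϖ (1 - s) (χ * (η : Fˣ →ₜ* ℂˣ))⁻¹ ψ =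
      (residueCard F : ℂ) ^ ((t : ℤ) * (condAdd ψ - (condMul (χ ^ (2 * (2 * t + 1))) : ℤ))) *
        metaEpsilon ϖ (1 - (2 * t + 1 : ℕ) * s) (χ ^ (2 * t + 1))⁻¹
          (ψ.mulShift ((2 * t + 1 : ℕ) : F)) := by
  have := hJ.finite
  have := Fintype.ofFinite J
  have hq := residueCard_ne_zero F
  have h2 := norm_two_eq_one hp hodd
  have h20 : (2 : F) ≠ 0 := norm_pos_iff.1 (by rw [h2]; exact one_pos)
  have hd1 := norm_natCast_eq_one_of_coprime hp hd
  have hcop2 : Nat.Coprime 2 p := Nat.coprime_two_left.2 hodd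
  have hdvd := dvd_card_residue_sub_one hd1 hζ
  have hcard := hJ.card_eq hdvd
  have hpow1 : χ ^ (2 * (2 * t + 1)) = (χ ^ 2) ^ (2 * t + 1) := pow_mul χ _ _
  have hpow2 : (χ ^ (2 * t + 1)) ^ 2 = (χ ^ 2) ^ (2 * t + 1) := pow_right_comm χ _ _
  have hχ2 : IsRamified ((χ ^ 2) ^ (2 * t + 1)) := hpow1 ▸ h
  have hχd : IsRamified (χ ^ (2 * t + 1)) := isRamified_of_pow (d := 2) (hpow2 ▸ hχ2)
  have hχ2' : IsRamified (χ ^ 2) := isRamified_of_pow hχ2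
  have hcond2 : condMul (χ ^ 2) = condMul χ := condMul_pow hp hcop2 hχ2'
  have hψ2c := continuous_mulShift hψc (2 : F)
  have hψ2 := mulShift_ne_one_of_ne_zero hψ h20
  have hshift : (ψ.mulShift ((2 * t + 1 : ℕ) : F)).mulShift 2 =
      (ψ.mulShift 2).mulShift ((2 * t + 1 : ℕ) : F) := by
    refine DFunLike.ext _ _ fun x => ?_
    simp only [AddChar.mulShift_apply]
    congr 1
    ring
  have e1 : ∏ᶠ η : J, tateEpsilon ϖ (2 * s) ((χ * (η : Fˣ →ₜ* ℂˣ)) ^ 2) (ψ.mulShift 2) =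
      ∏ᶠ η : J, tateEpsilon ϖ (2 * s) (χ ^ 2 * (η : Fˣ →ₜ* ℂˣ)) (ψ.mulShift 2) := by
    have hc : (Nat.card J).Coprime 2 := by
      rw [hcard]; exact Nat.coprime_two_right.2 (odd_two_mul_add_one t)
    -- Squaring permutes `J`, whose order `d` is odd, so the denominators are those of the twists of
    -- `χ²` by `J`.
    refine Eq.trans (finprod_congr fun η => ?_) (finprod_comp_equiv (powCoprime hc)
      (f := fun η : J => tateEpsilon ϖ (2 * s) (χ ^ 2 * (η : Fˣ →ₜ* ℂˣ)) (ψ.mulShift 2)))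
    congr 1
    exact mul_pow χ (η : Fˣ →ₜ* ℂˣ) 2
  rw [finprod_congr fun η : J => metaEpsilon_inv (ϖ := ϖ) s (χ * (η : Fˣ →ₜ* ℂˣ)) ψ,
    finprod_eq_prod_of_fintype, Finset.prod_div_distrib, Finset.prod_mul_distrib,
    ← finprod_eq_prod_of_fintype, ← finprod_eq_prod_of_fintype, ← finprod_eq_prod_of_fintype, e1,
    finprod_tateEpsilon_lift hp hodd hd hζ hJ hψc hψ hχd,
    finprod_tateEpsilon_lift hp hodd hd hζ hJ hψ2c hψ2 hχ2, metaEpsilon_inv, hpow1,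
    condMul_pow hp hd hχ2, hcond2, hpow2, hshift,
    tateEpsilon_pow_mulShift hp hd hd1 hψc hψ hχd, tateEpsilon_pow_mulShift hp hd hd1 hψ2c hψ2 hχ2,
    condAdd_mulShift h2, hcond2, ← weilIndex_pow hp hodd hd hζ hψc hψ]
  have e2 : ∏ᶠ η : J, weilIndex ψ * extend (χ * (η : Fˣ →ₜ* ℂˣ)) (-1) =
      weilIndex ψ ^ (2 * t + 1) * extend (χ ^ (2 * t + 1)) (-1) := by
    rw [finprod_eq_prod_of_fintype,
      Finset.prod_congr rfl fun η _ => by rw [extend_mul_char, ← mul_assoc], Finset.prod_mul_distrib,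
      ← finprod_eq_prod_of_fintype (f := fun η : J => extend (η : Fˣ →ₜ* ℂˣ) (-1)),
      hJ.finprod_extend (odd_two_mul_add_one t) (by simp), Finset.prod_const, Finset.card_univ,
      ← Nat.card_eq_fintype_card, hcard, mul_pow, mul_one, extend_pow _ (by simp)]
  rw [e2]
  set N := ((condAdd ψ - condMul χ : ℤ) : ℂ) with hN
  set G₁ := gaussInt (selfDual ψ) (ψ.mulShift ((2 * t + 1 : ℕ) : F)) (χ ^ (2 * t + 1))
  set G₂ := gaussInt (selfDual (ψ.mulShift 2)) ((ψ.mulShift 2).mulShift ((2 * t + 1 : ℕ) : F))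
    ((χ ^ 2) ^ (2 * t + 1))
  set C := weilIndex ψ ^ (2 * t + 1) * extend (χ ^ (2 * t + 1)) (-1)
  have e3 : (residueCard F : ℂ) ^ (N * ((2 * t + 1) * (s + 1 / 2) - t)) *
      (residueCard F : ℂ) ^ (-(N * ((2 * t + 1) * (2 * s) - t))) =
      (residueCard F : ℂ) ^ ((t : ℤ) * (condAdd ψ - (condMul χ : ℤ))) *
      (residueCard F : ℂ) ^ (N * ((2 * t + 1 : ℕ) * s + 1 / 2)) *
      (residueCard F : ℂ) ^ (-(N * (2 * ((2 * t + 1 : ℕ) * s)))) := by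
    rw [← Complex.cpow_intCast, ← Complex.cpow_add _ _ hq, ← Complex.cpow_add _ _ hq,
      ← Complex.cpow_add _ _ hq, hN]
    congr 1
    push_cast
    ring
  rw [Complex.cpow_neg, Complex.cpow_neg] at e3
  simp only [div_eq_mul_inv, mul_inv] at e3 ⊢
  linear_combination (C * G₁ * G₂⁻¹) * e3

theorem finprod_metaEpsilon_two (hp : ‖(p : F)‖ < 1) (hodd : Odd p)
    (hψc : Continuous ψ) (hψ : ψ ≠ 1) (h : IsRamified (χ ^ 2)) (s : ℂ) :
    ∏ᶠ β : dualModPow F 2, metaEpsilon ϖ (1 - s) (χ⁻¹ * (β : Fˣ →ₜ* ℂˣ)) ψ =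
      (residueCard F : ℂ) ^ (condAdd ψ - (condMul χ : ℤ)) *
        tateEpsilon ϖ (1 - 2 * s) (χ ^ 2)⁻¹ (ψ.mulShift 2) ^ 2 * (signF F : ℂ) ^ condMul χ := by
  have := finite_dualModPow_two hp hodd
  have := Fintype.ofFinite (dualModPow F 2)
  have hq := residueCard_ne_zero F
  have h2 := norm_two_eq_one hp hodd
  have h20 : (2 : F) ≠ 0 := norm_pos_iff.1 (by rw [h2]; exact one_pos)
  have hcop2 : Nat.Coprime 2 p := Nat.coprime_two_left.2 hodd
  have hψ2c := continuous_mulShift hψc (2 : F)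
  have hψ2 := mulShift_ne_one_of_ne_zero hψ h20
  have e1 : ∏ᶠ β : dualModPow F 2, metaEpsilon ϖ (1 - s) (χ⁻¹ * (β : Fˣ →ₜ* ℂˣ)) ψ =
      ∏ᶠ β : dualModPow F 2, metaEpsilon ϖ (1 - s) (χ * (β : Fˣ →ₜ* ℂˣ))⁻¹ ψ := by
    rw [← finprod_comp_equiv (Equiv.inv (dualModPow F 2))]
    refine finprod_congr fun β => ?_
    congr 1
    exact (mul_inv χ (β : Fˣ →ₜ* ℂˣ)).symm
  set N : ℤ := condAdd ψ - condMul χ with hN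
  set G := gaussInt (selfDual ψ) (ψ.mulShift 2) (χ ^ 2) with hG
  set X := (residueCard F : ℂ) ^ ((N : ℂ) * s) with hX
  have hX0 : X ≠ 0 := by
    rw [hX, Complex.cpow_def_of_ne_zero hq]; exact Complex.exp_ne_zero _
  have hT : tateEpsilon ϖ (2 * s) (χ ^ 2) (ψ.mulShift 2) = X ^ 2 * G := by
    rw [tateEpsilon_pow_mulShift hp hcop2 h2 hψc hψ h, hX, ← Complex.cpow_nat_mul, hN]
    congr 2
    push_cast
    ring
  -- Duality gives `χ²(-1) = 1` on the right, so dividing by `ε(2s, χ², ψ₂)` is multiplying by `ε(1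
  -- - 2s, χ⁻², ψ₂)`. Of the four denominators, the product of the Gauss integrals cancels the
  -- square of `G`, and two dual factors remain.
  have hdual : X ^ 2 * G * tateEpsilon ϖ (1 - 2 * s) (χ ^ 2)⁻¹ (ψ.mulShift 2) = 1 := by
    rw [← hT, tateEpsilon_mul_tateEpsilon_inv hψ2c hψ2 h, extend_pow _ (by simp), extend_neg_one_sq]
  have hXG : X ^ 2 * G ≠ 0 := left_ne_zero_of_mul_eq_one hdual
  have hG0 : G ≠ 0 := right_ne_zero_of_mul hXG
  -- Since `β² = 1`, the denominator does not depend on `β`.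
  have e2 : ∀ β : dualModPow F 2, metaEpsilon ϖ (1 - s) (χ * (β : Fˣ →ₜ* ℂˣ))⁻¹ ψ =
      (weilIndex ψ * extend χ (-1) * (residueCard F : ℂ) ^ ((N : ℂ) * (s + 1 / 2)) / (X ^ 2 * G)) *
        extend (β : Fˣ →ₜ* ℂˣ) (-1) * gaussInt (selfDual ψ) ψ (χ * (β : Fˣ →ₜ* ℂˣ)) := by
    intro β
    have h3 : (χ * (β : Fˣ →ₜ* ℂˣ)) ^ 2 = χ ^ 2 := by
      refine ext_extend fun n x hx => ?_
      have hx0 := ne_zero_of_mem_shell hx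
      rw [extend_pow _ hx0, extend_pow _ hx0, extend_mul_char, mul_pow,
        extend_pow_eq_one β.2 hx0, mul_one]
    rw [metaEpsilon_inv, h3, hT, tateEpsilon_eq hψc hψ (isRamified_mul β.2 h),
      condMul_mul hp hcop2 β.2 h, extend_mul_char, ← hN]
    ring
  have e3 : ((residueCard F : ℂ) ^ ((N : ℂ) * (s + 1 / 2))) ^ 4 = X ^ 4 * ((residueCard F : ℂ) ^ N) ^ 2 := by
    rw [hX, ← Complex.cpow_nat_mul, ← Complex.cpow_nat_mul, ← Complex.cpow_intCast,
      ← Complex.cpow_nat_mul, ← Complex.cpow_add _ _ hq]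
    congr 1
    push_cast
    ring
  have e4 : (residueCard F : ℂ) ^ ((condMul χ : ℤ) - condAdd ψ) = ((residueCard F : ℂ) ^ N)⁻¹ := by
    rw [← zpow_neg, hN, neg_sub]
  have hQ : (residueCard F : ℂ) ^ N ≠ 0 := zpow_ne_zero _ hq
  have e5 : extend χ (-1) ^ 4 = 1 := by
    rw [show 4 = 2 * 2 by norm_num, pow_mul, extend_neg_one_sq, one_pow]
  rw [e1, finprod_congr e2, finprod_eq_prod_of_fintype, Finset.prod_mul_distrib,
    Finset.prod_mul_distrib, ← finprod_eq_prod_of_fintype, ← finprod_eq_prod_of_fintype,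
    ← finprod_eq_prod_of_fintype, finprod_dualModPow_two_const hp hodd,
    finprod_dualModPow_two_extend hp hodd (by simp), mul_one,
    finprod_gaussInt_two hp hodd hψc hψ (isSelfDual_selfDual ψ hψc hψ) h, e4, ← hG,
    eq_inv_of_mul_eq_one_right hdual, div_pow, mul_pow, mul_pow, e3, e5,
    weilIndex_pow_four hp hodd hψc hψ]
  generalize (residueCard F : ℂ) ^ N = Q at hQ
  field_simp

end EpsilonProducts

end PadicEpsilon

end

theorem theorem2 {p : ℕ} [Fact p.Prime] {F : Type*} [NontriviallyNormedField F]
    [IsUltrametricDist F] [Algebra ℚ_[p] F] [FiniteDimensional ℚ_[p] F] [ContinuousSMul ℚ_[p] F]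
    [MeasurableSpace F] [BorelSpace F]
    -- a uniformizer, and the normalization of the absolute value of `F`
    (ϖ : Valued.integer F) (hϖ : Valued.maximalIdeal F = Ideal.span {ϖ})
    (hnorm : ‖(ϖ : F)‖ = ((PadicEpsilon.residueCard F : ℝ))⁻¹)
    (hp : p ≠ 2)
    (ψ : AddChar F ℂ) (hψc : Continuous ψ) (hψ : ψ ≠ 1)
    (χ : Fˣ →ₜ* ℂˣ) (s : ℂ) :
    (∀ (d : ℕ) (J : Subgroup (Fˣ →ₜ* ℂˣ)), Odd d → d.Coprime p →
      (∃ ζ : F, IsPrimitiveRoot ζ d) → PadicEpsilon.IsLift d J →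
      (PadicEpsilon.IsRamified (χ ^ d) →
        ∏ᶠ η : J, PadicEpsilon.tateEpsilon (ϖ : F) (1 - s) (χ * (η : Fˣ →ₜ* ℂˣ))⁻¹ ψ =
          (PadicEpsilon.residueCard F : ℂ) ^ (((d : ℤ) - 1) / 2 *
              (PadicEpsilon.condAdd ψ - (PadicEpsilon.condMul (χ ^ d) : ℤ))) *
            PadicEpsilon.tateEpsilon (ϖ : F) (1 - d * s) (χ ^ d)⁻¹ (ψ.mulShift (d : F))) ∧
      (PadicEpsilon.IsRamified (χ ^ (2 * d)) →
        ∏ᶠ η : J, PadicEpsilon.metaEpsilon (ϖ : F) (1 - s) (χ * (η : Fˣ →ₜ* ℂˣ))⁻¹ ψ =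
          (PadicEpsilon.residueCard F : ℂ) ^ (((d : ℤ) - 1) / 2 *
              (PadicEpsilon.condAdd ψ - (PadicEpsilon.condMul (χ ^ (2 * d)) : ℤ))) *
            PadicEpsilon.metaEpsilon (ϖ : F) (1 - d * s) (χ ^ d)⁻¹ (ψ.mulShift (d : F)))) ∧
    (PadicEpsilon.IsRamified (χ ^ 2) →
      ∏ᶠ β : PadicEpsilon.dualModPow F 2,
          PadicEpsilon.metaEpsilon (ϖ : F) (1 - s) (χ⁻¹ * (β : Fˣ →ₜ* ℂˣ)) ψ =
        (PadicEpsilon.residueCard F : ℂ) ^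
            (PadicEpsilon.condAdd ψ - (PadicEpsilon.condMul χ : ℤ)) *
          PadicEpsilon.tateEpsilon (ϖ : F) (1 - 2 * s) (χ ^ 2)⁻¹ (ψ.mulShift 2) ^ 2 *
          (PadicEpsilon.signF F : ℂ) ^ PadicEpsilon.condMul χ) := by
  have := PadicEpsilon.properSpace_of_finiteDimensional (F := F) p
  have := PadicEpsilon.isNormalizedLocalField_of_properSpace ϖ hϖ hnorm
  have hpF := PadicEpsilon.norm_prime_lt_one (F := F) p
  have hodd : Odd p := (Fact.out : p.Prime).odd_of_ne_two hp
  refine ⟨?_, PadicEpsilon.finprod_metaEpsilon_two hpF hodd hψc hψ (s := s)⟩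
  rintro d J ⟨t, rfl⟩ hd ⟨ζ, hζ⟩ hJ
  -- The integer division in the exponent is exact because `d` is odd.
  have ht : (((2 * t + 1 : ℕ) : ℤ) - 1) / 2 = t := by omega
  rw [ht]
  exact ⟨fun h => PadicEpsilon.finprod_tateEpsilon_inv_lift hpF hodd hd hζ hJ hψc hψ h s,
    fun h => PadicEpsilon.finprod_metaEpsilon_inv_lift hpF hodd hd hζ hJ hψc hψ h s⟩
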